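/- Let $K$ be a field and let $X=\bigcup_{n\ge 1}X_n$ be a positively graded set, with a graded coassociative coproduct $\Theta:K[X]\to K[X]\otimes K[X]$, that is $\Theta(K[X_n])\subseteq\bigoplus_{i+j=n}K[X_i]\otimes K[X_j]$. Let $K[T_\infty,X]$ be the vector space whose basis is the set of planar rooted trees $t\neq |$ (where $|$ is the tree with one leaf and no vertex) in which every vertex with $r+1$ inputs is coloured by an element of $X_r$; a tree with $n+1$ leaves (numbered $0,\dots,n$ from left to right) has degree $|t|=n$. Denote by $(\mathfrak c_n,x)$ the tree with a single vertex, coloured by $x\in X_n$, and by $\bigvee_x(t^0,\dots,t^r)$ the tree obtained by joining the roots of $t^0,\dots,t^r$ to a new root coloured by $x\in X_r$. For $0\le i\le |w|$ let $t\circ_i w$ be the tree obtained by attaching the root of $t$ to the $i$-th leaf of $w$; put $\{t,w\}:=w\circ_{|t|}t-t\circ_0 w$, and extend these operations linearly. Let $\Delta_\Theta$ be the coproduct on $K[T_\infty,X]$ extending $\Theta$: with $\Delta_+(|)=|\otimes|$ and $\Delta_+(t)=t\otimes|+|\otimes t+\Delta_\Theta(t)$ for $t\ne|$, it is given recursively by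 $$\Delta_+\Big(\bigvee_x(t^0,\dots,t^r)\Big)=\sum t^0_{(1)}\otimes\bigvee_x(t^0_{(2)},t^1,\dots,t^r)+\sum\bigvee_x(t^0,\dots,t^{r-1},t^r_{(1)})\otimes t^r_{(2)}$$ $$+\sum_{0<k<r}\ \sum_{|x_{(1)}|=k}\bigvee_{x_{(1)}}(t^0,\dots,t^{k-1},t^k_{(1)})\otimes\bigvee_{x_{(2)}}(t^k_{(2)},t^{k+1},\dots,t^r),$$ where $\Delta_+(t^k)=\sum t^k_{(1)}\otimes t^k_{(2)}$ and $\Theta(x)=\sum x_{(1)}\otimes x_{(2)}$. Let $e(z)=\sum_{r\ge 1}(-1)^{r+1}\sum z_{(1)}\circ_0 z_{(2)}\circ_0\cdots\circ_0 z_{(r)}$, the inner sum being over the iterated coproduct $\Delta_\Theta$ of $z$ with values in $K[T_\infty,X]^{\otimes r}$; write $e(x):=e(\mathfrak c_n,x)$ for $x\in X_n$ and $e(X)=\{e(x)\mid x\in X\}$. Let $\mathcal Prim_{gr}(X)$ be the smallest subspace of $K[T_\infty,X]$ that contains $e(X)$ and is closed under $\{-,-\}$ and under the products $x\circ_p y$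 with $y$ homogeneous of degree $n$ and $1\le p<n$. A $\mathcal Prim_{gr}$ algebra is a graded vector space $V=\bigoplus_n V_n$ with degree-preserving linear operations $\{-,-\}:V\otimes V\to V$ and $\bullet_p:V\otimes V_n\to V$, $1\le p<n$, such that, for all homogeneous $x,y,z$ and all indices for which the terms are defined, 1. $\{\{x,y\},z\}=\{x,\{y,z\}\}+y\bullet_{|x|}\{x,z\}$; 2. $\{x\bullet_p y,z\}=x\bullet_p\{y,z\}$; 3. $\{x,y\bullet_p z\}=y\bullet_{|x|+p}\{x,z\}$; 4. $\{x,y\}\bullet_p z=y\bullet_{|x|+p}(x\bullet_p z)-x\bullet_p(y\bullet_p z)$ for $1\le p<|z|$; 5. $(x\bullet_p y)\bullet_q z=x\bullet_{p+q}(y\bullet_q z)$; 6. $x\bullet_p(y\bullet_q z)=y\bullet_{|x|+q}(x\bullet_p z)$ for $1\le p<q<|z|$. Then $\mathcal Prim_{gr}(X)$ is the subspace of primitive elements of $K[T_\infty,X]$, that is $$\mathcal Prim_{gr}(X)=\{z\in K[T_\infty,X]\mid\Delta_\Theta(z)=0\}.$$ Moreover, with the grading and the operations $\{-,-\}$ and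 $\circ_p$ of $K[T_\infty,X]$, it is the free $\mathcal Prim_{gr}$ algebra on $X$: it is a $\mathcal Prim_{gr}$ algebra, $e(x)$ has degree $n$ for $x\in X_n$, and for every $\mathcal Prim_{gr}$ algebra $W$ and every degree-preserving map $f:X\to W$ there is a unique homomorphism of $\mathcal Prim_{gr}$ algebras $\varphi:\mathcal Prim_{gr}(X)\to W$ with $\varphi(e(x))=f(x)$ for all $x\in X$. -/

import Mathlib

open scoped TensorProduct

noncomputable section

/-- Planar rooted trees whose vertices are coloured by the graded set `X` (with degree function
`deg`): a vertex with `r + 1` inputs is coloured by an element of degree `r`. The constructor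
`leaf` is the tree `|` with one leaf and no vertex, and `node x c` is the tree
`⋁_x (c 0, …, c r)`, `r = deg x`. -/
inductive PTree {X : Type*} (deg : X → ℕ) : Type _
  | leaf : PTree deg
  | node (x : X) (c : Fin (deg x + 1) → PTree deg) : PTree deg

namespace PTree

variable {X : Type*} {deg : X → ℕ}

/-- The degree `|t|` of a tree: its number of leaves minus one. -/
def degree : PTree deg → ℕ
  | leaf => 0
  | node x c => deg x + ∑ k, degree (c k)

/-- `graftAt t i w` attaches the root of `t` to the leaf number `i` of `w`; the leaves of `w` are
numbered `0, …, |w|` from left to right. In `node x c`, the leaves of the subtree `c k` are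
numbered from `s` to `s + |c k|`, where `s` is the number of leaves of the subtrees to its left. -/
def graftAt (t : PTree deg) : ℕ → PTree deg → PTree deg
  | i, leaf => if i = 0 then t else leaf
  | i, node x c => node x fun k =>
      let s := ∑ j ∈ Finset.univ.filter (· < k), (degree (c j) + 1)
      if s ≤ i ∧ i ≤ s + degree (c k) then graftAt t (i - s) (c k) else c k

theorem graftAt_ne_leaf (t : PTree deg) (i : ℕ) {w : PTree deg} (hw : w ≠ leaf) :
    graftAt t i w ≠ leaf := by
  cases w with
  | leaf => exact absurd rfl hw
  | node x c => simp [graftAt]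

/-- The subtree number `j` of a family indexed by `0, …, r` (and `leaf` for `j > r`). -/
def childAt {r : ℕ} (c : Fin (r + 1) → PTree deg) (j : ℕ) : PTree deg :=
  if h : j < r + 1 then c ⟨j, h⟩ else leaf

/-- `⋁_y (c 0, …, c (k - 1), u)`, for `y` of degree `k`. -/
def leftPart {r : ℕ} (c : Fin (r + 1) → PTree deg) (k : ℕ) (u : PTree deg) (y : X) : PTree deg :=
  node y fun j => if (j : ℕ) < k then childAt c j else u

/-- `⋁_z (v, c (k + 1), …, c r)`, for `z` of degree `r - k`. -/
def rightPart {r : ℕ} (c : Fin (r + 1) → PTree deg) (k : ℕ) (v : PTree deg) (z : X) : PTree deg :=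
  node z fun j => if (j : ℕ) = 0 then v else childAt c (k + j)

variable (K : Type*) [Field K]

/-- The bilinear map sending `(u, y)` to `⋁_y (c 0, …, c (k - 1), u)` if `y` has degree `k`,
and to `0` otherwise. -/
def leftMap {r : ℕ} (c : Fin (r + 1) → PTree deg) (k : ℕ) :
    (PTree deg →₀ K) →ₗ[K] (X →₀ K) →ₗ[K] (PTree deg →₀ K) :=
  Finsupp.lift _ K _ fun u => Finsupp.lift _ K _ fun y =>
    if deg y = k then Finsupp.single (leftPart c k u y) 1 else 0

/-- The bilinear map sending `(v, z)` to `⋁_z (v, c (k + 1), …, c r)` if `z` has degree `r - k`,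
and to `0` otherwise. -/
def rightMap {r : ℕ} (c : Fin (r + 1) → PTree deg) (k : ℕ) :
    (PTree deg →₀ K) →ₗ[K] (X →₀ K) →ₗ[K] (PTree deg →₀ K) :=
  Finsupp.lift _ K _ fun v => Finsupp.lift _ K _ fun z =>
    if k + deg z = r then Finsupp.single (rightPart c k v z) 1 else 0

/-- The counital coproduct `Δ_+` on the space spanned by all trees, where `|` plays the role of the
unit `1`: `Δ_+ (|) = | ⊗ |` and, in Sweedler notation with `Δ_+ (t^k) = ∑ t^k_(1) ⊗ t^k_(2)`,
`Δ_+ (⋁_x (t^0, …, t^r))` is the sum of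
* `t^0_(1) ⊗ ⋁_x (t^0_(2), t^1, …, t^r)`,
* `⋁_x (t^0, …, t^(r-1), t^r_(1)) ⊗ t^r_(2)`,
* `⋁_(x_(1)) (t^0, …, t^(k-1), t^k_(1)) ⊗ ⋁_(x_(2)) (t^k_(2), t^(k+1), …, t^r)` over `0 < k < r`
  and over the part of `Θ x = ∑ x_(1) ⊗ x_(2)` with `|x_(1)| = k`, `|x_(2)| = r - k`. -/
def coprodPlus (Θ : (X →₀ K) →ₗ[K] (X →₀ K) ⊗[K] (X →₀ K)) :
    PTree deg → (PTree deg →₀ K) ⊗[K] (PTree deg →₀ K)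
  | leaf => Finsupp.single leaf 1 ⊗ₜ[K] Finsupp.single leaf 1
  | node x c =>
      LinearMap.lTensor (PTree deg →₀ K)
          (Finsupp.lmapDomain K K fun v => rightPart c 0 v x)
          (coprodPlus Θ (c 0)) +
      LinearMap.rTensor (PTree deg →₀ K)
          (Finsupp.lmapDomain K K fun u => leftPart c (deg x) u x)
          (coprodPlus Θ (c (Fin.last (deg x)))) +
      ∑ k : Fin (deg x + 1),
        if 0 < (k : ℕ) ∧ (k : ℕ) < deg x then
          TensorProduct.map (TensorProduct.lift (leftMap K c k)) (TensorProduct.lift (rightMap K c k))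
            (TensorProduct.tensorTensorTensorComm K (PTree deg →₀ K) (PTree deg →₀ K)
              (X →₀ K) (X →₀ K) (coprodPlus Θ (c k) ⊗ₜ[K] Θ (Finsupp.single x 1)))
        else 0

end PTree

/-- The coloured trees different from `|`. -/
abbrev NTree {X : Type*} (deg : X → ℕ) : Type _ := {t : PTree deg // t ≠ PTree.leaf}

/-- The vector space `K[T_∞, X]` with basis the coloured trees different from `|`. -/
abbrev TreeSpace (K : Type*) [Field K] {X : Type*} (deg : X → ℕ) : Type _ := NTree deg →₀ K

/-- `IsGradedCoproduct deg Θ`: `Θ` sends `K[X_n]` to `⨁_(i + j = n) K[X_i] ⊗ K[X_j]`. -/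
def IsGradedCoproduct {K : Type*} [Field K] {X : Type*} (deg : X → ℕ)
    (Θ : (X →₀ K) →ₗ[K] (X →₀ K) ⊗[K] (X →₀ K)) : Prop :=
  ∀ x, Θ (Finsupp.single x 1) ∈ Submodule.span K
    {w | ∃ y z, deg y + deg z = deg x ∧ w = Finsupp.single y (1 : K) ⊗ₜ[K] Finsupp.single z (1 : K)}

/-- Coassociativity of a coproduct: `(Δ ⊗ id) ∘ Δ = (id ⊗ Δ) ∘ Δ`. -/
def IsCoassociative {K C : Type*} [Field K] [AddCommGroup C] [Module K C]
    (Δ : C →ₗ[K] C ⊗[K] C) : Prop :=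
  (TensorProduct.assoc K C C C).toLinearMap ∘ₗ Δ.rTensor C ∘ₗ Δ = Δ.lTensor C ∘ₗ Δ

namespace TreeSpace

variable {K : Type*} [Field K] {X : Type*} {deg : X → ℕ}

/-- The homogeneous part of degree `n`. -/
def homog (K : Type*) [Field K] {X : Type*} (deg : X → ℕ) (n : ℕ) : Submodule K (TreeSpace K deg) :=
  Finsupp.supported K K {t | t.1.degree = n}

/-- The tree with a single vertex, coloured by `x`. -/
def corolla (K : Type*) [Field K] {X : Type*} (deg : X → ℕ) (x : X) : TreeSpace K deg :=
  Finsupp.single ⟨PTree.node x fun _ => PTree.leaf, by simp⟩ 1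

/-- The product `∘_i`, bilinear, with `t ∘_i w` the grafting of `t` on the leaf number `i` of `w`
for `i ≤ |w|`; it is extended by zero to the trees `w` with `|w| < i`. -/
def graft (K : Type*) [Field K] {X : Type*} (deg : X → ℕ) (i : ℕ) :
    TreeSpace K deg →ₗ[K] TreeSpace K deg →ₗ[K] TreeSpace K deg :=
  Finsupp.lift _ K _ fun t => Finsupp.lift _ K _ fun w =>
    if i ≤ w.1.degree then
      Finsupp.single ⟨PTree.graftAt t.1 i w.1, PTree.graftAt_ne_leaf t.1 i w.2⟩ 1
    else 0

/-- The operation `{x, y} = y ∘_|x| x - x ∘_0 y`, extended bilinearly. -/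
def bracket (K : Type*) [Field K] {X : Type*} (deg : X → ℕ) :
    TreeSpace K deg →ₗ[K] TreeSpace K deg →ₗ[K] TreeSpace K deg :=
  Finsupp.lift _ K _ fun t => Finsupp.lift _ K _ fun w =>
    graft K deg t.1.degree (Finsupp.single w 1) (Finsupp.single t 1) -
      graft K deg 0 (Finsupp.single t 1) (Finsupp.single w 1)

open Classical in
/-- The projection from the space spanned by all trees that kills the tree `|`. -/
def dropLeaf (K : Type*) [Field K] {X : Type*} (deg : X → ℕ) :
    (PTree deg →₀ K) →ₗ[K] TreeSpace K deg :=
  Finsupp.lift _ K _ fun t => if h : t ≠ PTree.leaf then Finsupp.single ⟨t, h⟩ 1 else 0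

/-- The coproduct `Δ_Θ` on `K[T_∞, X]` that extends `Θ`: one has
`Δ_+ (t) = t ⊗ | + | ⊗ t + Δ_Θ (t)`. -/
def coprod (Θ : (X →₀ K) →ₗ[K] (X →₀ K) ⊗[K] (X →₀ K)) :
    TreeSpace K deg →ₗ[K] TreeSpace K deg ⊗[K] TreeSpace K deg :=
  Finsupp.lift _ K _ fun t =>
    TensorProduct.map (dropLeaf K deg) (dropLeaf K deg) (PTree.coprodPlus K Θ t.1)

/-- The subspace of primitive elements for `Δ_Θ`. -/
def primitives (deg : X → ℕ) (Θ : (X →₀ K) →ₗ[K] (X →₀ K) ⊗[K] (X →₀ K)) :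
    Submodule K (TreeSpace K deg) :=
  LinearMap.ker (coprod (deg := deg) Θ)

/-- The map `z ↦ ∑ z_(1) ∘_0 z_(2) ∘_0 ⋯ ∘_0 z_(r+1)`. -/
def iterProd (Θ : (X →₀ K) →ₗ[K] (X →₀ K) ⊗[K] (X →₀ K)) :
    ℕ → TreeSpace K deg →ₗ[K] TreeSpace K deg
  | 0 => LinearMap.id
  | r + 1 => TensorProduct.lift (graft K deg 0) ∘ₗ (iterProd Θ r).rTensor _ ∘ₗ coprod Θ

/-- The linear map `e (z) = ∑_(r ≥ 0) (-1)^r ∑ z_(1) ∘_0 z_(2) ∘_0 ⋯ ∘_0 z_(r+1)`. On a tree `t`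
the terms with `r ≥ |t|` vanish, since `Δ_Θ` is graded and all trees have positive degree. -/
def eMap (Θ : (X →₀ K) →ₗ[K] (X →₀ K) ⊗[K] (X →₀ K)) :
    TreeSpace K deg →ₗ[K] TreeSpace K deg :=
  Finsupp.lift _ K _ fun t =>
    ∑ r ∈ Finset.range t.1.degree, (-1 : K) ^ r • iterProd Θ r (Finsupp.single t 1)

/-- `S` is closed under `{-, -}` and under the products `x ∘_p y`, for `y` homogeneous of
degree `n` and `1 ≤ p < n`. -/
structure IsPrimGrClosed (S : Submodule K (TreeSpace K deg)) : Prop where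
  bracket_mem : ∀ x ∈ S, ∀ y ∈ S, bracket K deg x y ∈ S
  graft_mem : ∀ (p n : ℕ), 1 ≤ p → p < n → ∀ x ∈ S, ∀ y ∈ S, y ∈ homog K deg n →
    graft K deg p x y ∈ S

/-- The subspace `Prim_gr(X)` of `K[T_∞, X]` generated by `e(X)` under the operations `{-, -}`
and `∘_p`. -/
def PrimGr (deg : X → ℕ) (Θ : (X →₀ K) →ₗ[K] (X →₀ K) ⊗[K] (X →₀ K)) :
    Submodule K (TreeSpace K deg) :=
  sInf {S | (∀ x, eMap Θ (corolla K deg x) ∈ S) ∧ IsPrimGrClosed S}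

theorem eMap_corolla_mem (deg : X → ℕ) (Θ : (X →₀ K) →ₗ[K] (X →₀ K) ⊗[K] (X →₀ K)) (x : X) :
    eMap Θ (corolla K deg x) ∈ PrimGr deg Θ :=
  Submodule.mem_sInf.2 fun _ hS => hS.1 x

end TreeSpace

/-- A `Prim_gr` algebra structure on the `K`-vector space `V`: a grading `V = ⨁ V_n`, a binary
operation `{-, -}` and operations `•_p : V ⊗ V_n → V` for `1 ≤ p < n`, all of them homogeneous of
degree zero and subject to six relations. The map `graft p` stands for `•_p`; its values
`graft p x y` matter, and are subject to conditions, only for `y` in `V_n` with `1 ≤ p < n`.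
Each relation is imposed for all homogeneous elements for which all the terms in it are defined. -/
structure PrimGrAlgebra (K V : Type*) [Field K] [AddCommGroup V] [Module K V] where
  comp : ℕ → Submodule K V
  isInternal : DirectSum.IsInternal comp
  bracket : V →ₗ[K] V →ₗ[K] V
  graft : ℕ → V →ₗ[K] V →ₗ[K] V
  bracket_mem : ∀ {m n : ℕ} {x y : V}, x ∈ comp m → y ∈ comp n → bracket x y ∈ comp (m + n)
  graft_mem : ∀ {p m n : ℕ} {x y : V}, 1 ≤ p → p < n → x ∈ comp m → y ∈ comp n →
    graft p x y ∈ comp (m + n)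
  bracket_bracket : ∀ {m n r : ℕ} {x y z : V}, x ∈ comp m → y ∈ comp n → z ∈ comp r →
    0 < m → 0 < r →
    bracket (bracket x y) z = bracket x (bracket y z) + graft m y (bracket x z)
  bracket_graft_left : ∀ {p m n r : ℕ} {x y z : V}, x ∈ comp m → y ∈ comp n → z ∈ comp r →
    1 ≤ p → p < n →
    bracket (graft p x y) z = graft p x (bracket y z)
  bracket_graft_right : ∀ {p m n r : ℕ} {x y z : V}, x ∈ comp m → y ∈ comp n → z ∈ comp r →
    1 ≤ p → p < r →
    bracket x (graft p y z) = graft (m + p) y (bracket x z)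
  graft_bracket_left : ∀ {p m n r : ℕ} {x y z : V}, x ∈ comp m → y ∈ comp n → z ∈ comp r →
    1 ≤ p → p < r →
    graft p (bracket x y) z = graft (m + p) y (graft p x z) - graft p x (graft p y z)
  graft_graft_left : ∀ {p q m n r : ℕ} {x y z : V}, x ∈ comp m → y ∈ comp n → z ∈ comp r →
    1 ≤ p → p < n → 1 ≤ q → q < r →
    graft q (graft p x y) z = graft (p + q) x (graft q y z)
  graft_graft_right : ∀ {p q m n r : ℕ} {x y z : V}, x ∈ comp m → y ∈ comp n → z ∈ comp r →
    1 ≤ p → p < q → q < r →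
    graft p x (graft q y z) = graft (m + q) y (graft p x z)

namespace PrimGrAlgebra

/-- Homomorphisms of `Prim_gr` algebras: linear maps that preserve degrees and operations. -/
structure IsHom {K V W : Type*} [Field K] [AddCommGroup V] [Module K V] [AddCommGroup W]
    [Module K W] (P : PrimGrAlgebra K V) (Q : PrimGrAlgebra K W) (φ : V →ₗ[K] W) : Prop where
  map_comp : ∀ (n : ℕ), ∀ x ∈ P.comp n, φ x ∈ Q.comp n
  map_bracket : ∀ x y : V, φ (P.bracket x y) = Q.bracket (φ x) (φ y)
  map_graft : ∀ (p n : ℕ), 1 ≤ p → p < n → ∀ x : V, ∀ y ∈ P.comp n,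
    φ (P.graft p x y) = Q.graft p (φ x) (φ y)

end PrimGrAlgebra

end

/-! The two assertions are proved by different means.

Primitive elements. The coproduct of a tree is a sum over the ways of cutting it in two along a path
from a leaf to the root. Hence, for `u` primitive, Δ(u ∘_i w) is the sum of (u ∘_i w₁) ⊗ w₂ and of
w₁ ⊗ (u ∘_{i-|w₁|} w₂), plus u ⊗ w if i = 0 and w ⊗ u if i = |w| (`coprod_graft_single`). So the
products ∘_p with 1 ≤ p < n preserve primitivity, and so does {x, y}, a difference of two elements
with the same coproduct x ⊗ y. The map `e` satisfies e = id - e ⋆ id, where ⋆ is the convolution for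
∘_0 (`eMap_eq`). It follows that `e` fixes the primitives, kills u ∘_0 z for `u` primitive, and, by
coassociativity, has primitive values on corollas. This gives one inclusion. For the other, every
element lies in P + P ∘_0 K[T_∞, X], where P = Prim_gr(X) (`homog_le_primIdeal`): a corolla is e(x)
modulo ∘_0-decomposables, and grafting preserves P + decomposables in the cases needed. Applying `e`
shows that its image lies in P, and a primitive z equals e(z).

Freeness. The six relations follow from the sequential and parallel associativity of grafting.
Uniqueness holds because e(X) generates. Existence uses no normal form and no dimension count. Given
W, words in a basis of its positive part receive operations ∘_i, where ∘_0 is concatenation and ∘_i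
inserts letters by means of • and {-, -}. The six relations of W are what makes these operations
satisfy the two associativity laws (`act_act_comm`, `act_act_graft`, `act_act_bracket`, then
`op_op_comm`, `op_op_assoc`). Trees can therefore be evaluated in words once the values g(x) of the
corollas are chosen. With g(x) = ∑ f(x_(1)) ⋯ f(x_(r)), which undoes `e`, the value of e(x) is the
single letter f(x) (`eval_eMap_corolla`). Words of length one are stable under {-, -} and ∘_p, which
induce on them the operations of W; the evaluation restricted to P is the required morphism. -/

noncomputable section

/-! ### Grafting of trees: numbering of the leaves and the two associativity laws -/

namespace PTree

variable {X : Type*} {deg : X → ℕ}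

/-- The tree `⋁_x (C 0, …, C r)`, `r = deg x`, for a sequence `C` of trees. -/
def nodeN (x : X) (C : ℕ → PTree deg) : PTree deg := node x fun j => C j

theorem nodeN_congr {x : X} {C D : ℕ → PTree deg} (h : ∀ j ≤ deg x, C j = D j) :
    nodeN x C = nodeN x D := by
  unfold nodeN
  congr 1
  funext j
  exact h j (by omega)

theorem childAt_coe {r : ℕ} (c : Fin (r + 1) → PTree deg) (j : Fin (r + 1)) :
    childAt c j = c j := by
  rw [childAt, dif_pos j.2]

theorem node_eq_nodeN (x : X) (c : Fin (deg x + 1) → PTree deg) :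
    node x c = nodeN x (childAt c) := by
  simp [nodeN, childAt_coe]

theorem nodeN_ne_leaf (x : X) (C : ℕ → PTree deg) : nodeN x C ≠ leaf := by
  simp [nodeN]

/-- Children are indexed by `ℕ` rather than by `Fin (deg x + 1)` so that they can be replaced with
`Function.update` and counted with `offset`. The entries beyond `deg x` play no role; `childAt`
fills them with leaves, for which the motive is known. -/
theorem induction_nodeN {motive : PTree deg → Prop} (t : PTree deg) (leaf : motive leaf)
    (node : ∀ x C, (∀ j, motive (C j)) → motive (nodeN x C)) : motive t := by
  induction t with
  | leaf => exact leaf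
  | node x c ih =>
    rw [node_eq_nodeN]
    refine node _ _ fun j => ?_
    unfold childAt
    split_ifs
    · exact ih _
    · exact leaf

/-- The number of leaves of the first `k` trees of a sequence. -/
def offset (C : ℕ → PTree deg) (k : ℕ) : ℕ := ∑ j ∈ Finset.range k, (degree (C j) + 1)

@[simp] theorem offset_zero (C : ℕ → PTree deg) : offset C 0 = 0 := rfl

theorem offset_succ (C : ℕ → PTree deg) (k : ℕ) :
    offset C (k + 1) = offset C k + (degree (C k) + 1) := Finset.sum_range_succ _ _

theorem offset_mono (C : ℕ → PTree deg) : Monotone (offset C) :=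
  monotone_nat_of_le_succ fun k => by rw [offset_succ]; omega

theorem offset_congr {C D : ℕ → PTree deg} {k : ℕ}
    (h : ∀ j < k, degree (C j) = degree (D j)) : offset C k = offset D k :=
  Finset.sum_congr rfl fun j hj => by rw [h j (Finset.mem_range.1 hj)]

theorem offset_update_of_le (C : ℕ → PTree deg) {k l : ℕ} (h : l ≤ k) (t : PTree deg) :
    offset (Function.update C k t) l = offset C l :=
  offset_congr fun j hj => by rw [Function.update_of_ne (by omega)]

theorem offset_update_of_lt (C : ℕ → PTree deg) {k l : ℕ} (h : k < l) (t : PTree deg) :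
    offset (Function.update C k t) l + degree (C k) = offset C l + degree t := by
  induction l with
  | zero => omega
  | succ l ih =>
    rw [offset_succ, offset_succ]
    rcases Nat.lt_succ_iff_lt_or_eq.1 h with h | rfl
    · have := ih h
      rw [Function.update_of_ne (by omega)]
      omega
    · rw [offset_update_of_le _ le_rfl, Function.update_self]
      omega

@[simp] theorem degree_leaf : degree (leaf : PTree deg) = 0 := rfl

theorem degree_nodeN_add_one (x : X) (C : ℕ → PTree deg) :
    degree (nodeN x C) + 1 = offset C (deg x + 1) := by
  rw [nodeN, degree, offset, Finset.sum_add_distrib, ← Fin.sum_univ_eq_sum_range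
    (fun j => degree (C j))]
  simp
  omega

theorem graftAt_leaf (t : PTree deg) : graftAt t 0 leaf = t := by simp [graftAt]

/-- The leaves of the `k`-th child occupy the interval from `offset C k` to `offset C k + |C k|`.
These intervals are consecutive and disjoint, which gives this lemma and the next one. -/
theorem exists_offset_le (C : ℕ → PTree deg) {i m : ℕ} (h : i < offset C m) :
    ∃ k < m, offset C k ≤ i ∧ i ≤ offset C k + degree (C k) := by
  induction m with
  | zero => simp at h
  | succ m ih =>
    by_cases h' : i < offset C m
    · obtain ⟨k, hk, h⟩ := ih h'
      exact ⟨k, by omega, h⟩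
    · rw [offset_succ] at h
      exact ⟨m, by omega, by omega, by omega⟩

theorem offset_index_unique (C : ℕ → PTree deg) {i k l : ℕ} (h1 : offset C k ≤ i)
    (h2 : i ≤ offset C k + degree (C k)) (h3 : offset C l ≤ i)
    (h4 : i ≤ offset C l + degree (C l)) : k = l := by
  by_contra h
  rcases lt_or_gt_of_ne h with h | h
  · have := offset_mono C (Nat.succ_le_of_lt h)
    rw [Nat.succ_eq_add_one, offset_succ] at this
    omega
  · have := offset_mono C (Nat.succ_le_of_lt h)
    rw [Nat.succ_eq_add_one, offset_succ] at this
    omega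

theorem graftAt_nodeN (t : PTree deg) {x : X} {C : ℕ → PTree deg} {i k : ℕ} (hk : k ≤ deg x)
    (h1 : offset C k ≤ i) (h2 : i ≤ offset C k + degree (C k)) :
    graftAt t i (nodeN x C) =
      nodeN x (Function.update C k (graftAt t (i - offset C k) (C k))) := by
  have hs : ∀ j : Fin (deg x + 1), ∑ l ∈ Finset.univ.filter (· < j), (degree (C l) + 1)
      = offset C j := by
    intro j
    rw [offset]
    refine Finset.sum_bij (fun a _ => (a : ℕ)) ?_ ?_ ?_ ?_
    · intro a ha
      simpa using ha
    · intro a _ b _ hab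
      exact Fin.ext hab
    · intro b hb
      refine ⟨⟨b, ?_⟩, ?_, rfl⟩
      · have := Finset.mem_range.1 hb
        omega
      · exact Finset.mem_filter.2 ⟨Finset.mem_univ _, Finset.mem_range.1 hb⟩
    · intros
      rfl
  rw [nodeN, graftAt, nodeN]
  congr 1
  funext j
  simp only [hs]
  split_ifs with h
  · have := offset_index_unique C h.1 h.2 h1 h2
    rw [this, Function.update_self]
  · rw [Function.update_of_ne]
    rintro rfl
    exact h ⟨h1, h2⟩

theorem exists_slot (x : X) (C : ℕ → PTree deg) {i : ℕ} (h : i ≤ degree (nodeN x C)) :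
    ∃ k ≤ deg x, offset C k ≤ i ∧ i ≤ offset C k + degree (C k) := by
  have := degree_nodeN_add_one x C
  obtain ⟨k, hk, h⟩ := exists_offset_le C (i := i) (m := deg x + 1) (by omega)
  exact ⟨k, by omega, h⟩

theorem degree_nodeN_update (x : X) (C : ℕ → PTree deg) {k : ℕ} (hk : k ≤ deg x)
    (t : PTree deg) :
    degree (nodeN x (Function.update C k t)) + degree (C k) = degree (nodeN x C) + degree t := by
  have h1 := degree_nodeN_add_one x C
  have h2 := degree_nodeN_add_one x (Function.update C k t)
  have h3 := offset_update_of_lt C (Nat.lt_succ_of_le hk) t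
  simp only [Nat.succ_eq_add_one] at h3
  omega

theorem degree_graftAt (t : PTree deg) {i : ℕ} {w : PTree deg} (h : i ≤ degree w) :
    degree (graftAt t i w) = degree t + degree w := by
  induction w using induction_nodeN generalizing i with
  | leaf =>
    obtain rfl : i = 0 := by simpa using h
    simp [graftAt_leaf]
  | node x C ih =>
    obtain ⟨k, hk, h1, h2⟩ := exists_slot x C h
    rw [graftAt_nodeN t hk h1 h2]
    have := degree_nodeN_update x C hk (graftAt t (i - offset C k) (C k))
    rw [ih k (by omega)] at this
    omega

/-- Sequential associativity: leaf `i` of `b` has number `i + j` once `b` sits on leaf `j` of `c`.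
-/
theorem graftAt_graftAt_left (a : PTree deg) {b c : PTree deg} {i j : ℕ} (hi : i ≤ degree b)
    (hj : j ≤ degree c) :
    graftAt (graftAt a i b) j c = graftAt a (i + j) (graftAt b j c) := by
  induction c using induction_nodeN generalizing j with
  | leaf =>
    obtain rfl : j = 0 := by simpa using hj
    simp [graftAt_leaf]
  | node x C ih =>
    obtain ⟨k, hk, h1, h2⟩ := exists_slot x C hj
    have hd := degree_graftAt b (w := C k) (i := j - offset C k) (by omega)
    have ho := offset_update_of_le C (le_refl k) (graftAt b (j - offset C k) (C k))
    rw [graftAt_nodeN _ hk h1 h2, graftAt_nodeN _ hk h1 h2, graftAt_nodeN a hk (by omega)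
      (by rw [ho, Function.update_self, hd]; omega), ho, Function.update_self,
      Function.update_idem, ih k (by omega)]
    congr 4
    omega

/-- Parallel associativity: grafting `a` to the left of leaf `j` shifts that leaf by `|a|`, whereas
grafting `b` on its right does not move leaf `i`. -/
theorem graftAt_comm (a b : PTree deg) {c : PTree deg} {i j : ℕ} (hi : i < j)
    (hj : j ≤ degree c) :
    graftAt a i (graftAt b j c) = graftAt b (j + degree a) (graftAt a i c) := by
  induction c using induction_nodeN generalizing i j with
  | leaf => simp at hj; omega
  | node x C ih =>
    obtain ⟨k, hk, h1, h2⟩ := exists_slot x C hj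
    obtain ⟨l, hl, h3, h4⟩ := exists_slot x C (i := i) (by omega)
    have hdb := degree_graftAt b (w := C k) (i := j - offset C k) (by omega)
    have hda := degree_graftAt a (w := C l) (i := i - offset C l) (by omega)
    rw [graftAt_nodeN _ hk h1 h2, graftAt_nodeN _ hl h3 h4]
    have hlk : l ≤ k := by
      by_contra h
      have := offset_mono C (show k + 1 ≤ l by omega)
      rw [offset_succ] at this
      omega
    -- Either both leaves belong to the same child, and induction applies inside it, or they belong
    -- to different children, and the two updates commute.
    rcases hlk.eq_or_lt with rfl | hlk
    · have ho := offset_update_of_le C (le_refl l) (graftAt b (j - offset C l) (C l))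
      have ho' := offset_update_of_le C (le_refl l) (graftAt a (i - offset C l) (C l))
      rw [graftAt_nodeN a hk (by omega) (by rw [ho, Function.update_self]; omega),
        graftAt_nodeN b hk (by omega) (by rw [ho', Function.update_self]; omega)]
      rw [ho, ho', Function.update_self, Function.update_self, Function.update_idem,
        Function.update_idem, ih l (by omega) (by omega)]
      congr 4
      omega
    · have ho := offset_update_of_le C hlk.le (graftAt b (j - offset C k) (C k))
      have ho' := offset_update_of_lt C hlk (graftAt a (i - offset C l) (C l))
      have e1 : Function.update C k (graftAt b (j - offset C k) (C k)) l = C l :=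
        Function.update_of_ne (by omega) _ _
      have e2 : Function.update C l (graftAt a (i - offset C l) (C l)) k = C k :=
        Function.update_of_ne (by omega) _ _
      rw [graftAt_nodeN a hl (by omega) (by rw [ho, e1]; omega),
        graftAt_nodeN b hk (by omega) (by rw [e2]; omega), ho, e1, e2,
        Function.update_comm (by omega : k ≠ l),
        show j + degree a - offset (Function.update C l (graftAt a (i - offset C l) (C l))) k
          = j - offset C k by omega]

theorem degree_pos (hdeg : ∀ x, 0 < deg x) {t : PTree deg} (ht : t ≠ leaf) : 0 < degree t := by
  cases t with
  | leaf => exact absurd rfl ht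
  | node x c =>
    rw [degree]
    have := hdeg x
    omega

end PTree

/-! ### Linear extension of the grafting operations -/

namespace TreeSpace

variable {K : Type*} [Field K] {X : Type*} {deg : X → ℕ}

theorem single_mem_homog {n : ℕ} {t : NTree deg} (h : t.1.degree = n) (a : K) :
    Finsupp.single t a ∈ homog K deg n :=
  Finsupp.single_mem_supported K a h

theorem eqOn_homog {M : Type*} [AddCommMonoid M] [Module K M] {n : ℕ}
    {f g : TreeSpace K deg →ₗ[K] M}
    (h : ∀ t : NTree deg, t.1.degree = n → f (Finsupp.single t 1) = g (Finsupp.single t 1))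
    {z : TreeSpace K deg} (hz : z ∈ homog K deg n) : f z = g z := by
  rw [homog, Finsupp.supported_eq_span_single] at hz
  refine LinearMap.eqOn_span (f := f) (g := g) ?_ hz
  rintro _ ⟨t, ht, rfl⟩
  exact h t ht

theorem map_homog_mem {M : Type*} [AddCommMonoid M] [Module K M] {n : ℕ}
    {f : TreeSpace K deg →ₗ[K] M} {S : Submodule K M}
    (h : ∀ t : NTree deg, t.1.degree = n → f (Finsupp.single t 1) ∈ S)
    {z : TreeSpace K deg} (hz : z ∈ homog K deg n) : f z ∈ S := by
  rw [homog, Finsupp.supported_eq_span_single] at hz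
  have : Submodule.span K ((fun i => Finsupp.single i (1 : K)) '' {t : NTree deg | t.1.degree = n})
      ≤ S.comap f := by
    rw [Submodule.span_le]
    rintro _ ⟨t, ht, rfl⟩
    exact h t ht
  exact this hz

/-- The tree `t ∘_i w`. -/
def graftTree (t : NTree deg) (i : ℕ) (w : NTree deg) : NTree deg :=
  ⟨PTree.graftAt t.1 i w.1, PTree.graftAt_ne_leaf t.1 i w.2⟩

theorem graft_single (i : ℕ) (t w : NTree deg) :
    graft K deg i (Finsupp.single t 1) (Finsupp.single w 1) =
      if i ≤ w.1.degree then Finsupp.single (graftTree t i w) 1 else 0 := by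
  simp [graft, graftTree]

theorem graft_single_of_le {i : ℕ} {t w : NTree deg} (h : i ≤ w.1.degree) :
    graft K deg i (Finsupp.single t 1) (Finsupp.single w 1) =
      Finsupp.single (graftTree t i w) 1 := by
  rw [graft_single, if_pos h]

theorem degree_graftTree {i : ℕ} {t w : NTree deg} (h : i ≤ w.1.degree) :
    (graftTree t i w).1.degree = t.1.degree + w.1.degree :=
  PTree.degree_graftAt t.1 h

theorem graft_mem_homog {i m n : ℕ} {x y : TreeSpace K deg} (hx : x ∈ homog K deg m)
    (hy : y ∈ homog K deg n) : graft K deg i x y ∈ homog K deg (m + n) := by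
  refine map_homog_mem (f := graft K deg i x) (fun w hw => ?_) hy
  refine map_homog_mem (f := (graft K deg i).flip (Finsupp.single w 1)) (fun t ht => ?_) hx
  rw [LinearMap.flip_apply, graft_single]
  split_ifs with h
  · exact single_mem_homog (by rw [degree_graftTree h, ht, hw]) _
  · exact zero_mem _

theorem graft_graft_left {i j n r : ℕ} (x : TreeSpace K deg) {y z : TreeSpace K deg}
    (hy : y ∈ homog K deg n) (hz : z ∈ homog K deg r) (hi : i ≤ n) (hj : j ≤ r) :
    graft K deg j (graft K deg i x y) z = graft K deg (i + j) x (graft K deg j y z) := by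
  refine eqOn_homog (f := graft K deg j (graft K deg i x y))
    (g := graft K deg (i + j) x ∘ₗ graft K deg j y) (fun c hc => ?_) hz
  refine eqOn_homog (f := (graft K deg j).flip (Finsupp.single c 1) ∘ₗ graft K deg i x)
    (g := graft K deg (i + j) x ∘ₗ (graft K deg j).flip (Finsupp.single c 1)) (fun b hb => ?_) hy
  refine LinearMap.congr_fun (f := (graft K deg j).flip (Finsupp.single c 1) ∘ₗ
      (graft K deg i).flip (Finsupp.single b 1))
    (g := (graft K deg (i + j)).flip (graft K deg j (Finsupp.single b 1) (Finsupp.single c 1)))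
    (Finsupp.lhom_ext' fun a => LinearMap.ext_ring ?_) x
  simp only [LinearMap.comp_apply, LinearMap.flip_apply, Finsupp.lsingle_apply]
  rw [graft_single_of_le (by omega), graft_single_of_le (by omega), graft_single_of_le (by omega),
    graft_single_of_le (by rw [degree_graftTree (by omega)]; omega)]
  congr 1
  exact Subtype.ext (PTree.graftAt_graftAt_left a.1 (by omega) (by omega))

/-- The degree of `x` enters as the shift of the index, and that of `z` bounds it; `y` is arbitrary.
-/
theorem graft_comm {i j m r : ℕ} {x : TreeSpace K deg} (y : TreeSpace K deg) {z : TreeSpace K deg}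
    (hx : x ∈ homog K deg m) (hz : z ∈ homog K deg r) (hi : i < j) (hj : j ≤ r) :
    graft K deg i x (graft K deg j y z) = graft K deg (j + m) y (graft K deg i x z) := by
  refine eqOn_homog (f := graft K deg i x ∘ₗ graft K deg j y)
    (g := graft K deg (j + m) y ∘ₗ graft K deg i x) (fun c hc => ?_) hz
  refine eqOn_homog (f := (graft K deg i).flip (graft K deg j y (Finsupp.single c 1)))
    (g := graft K deg (j + m) y ∘ₗ (graft K deg i).flip (Finsupp.single c 1)) (fun a ha => ?_) hx
  refine LinearMap.congr_fun (f := graft K deg i (Finsupp.single a 1) ∘ₗ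
      (graft K deg j).flip (Finsupp.single c 1))
    (g := (graft K deg (j + m)).flip (graft K deg i (Finsupp.single a 1) (Finsupp.single c 1)))
    (Finsupp.lhom_ext' fun b => LinearMap.ext_ring ?_) y
  simp only [LinearMap.comp_apply, LinearMap.flip_apply, Finsupp.lsingle_apply]
  have hib : i ≤ (graftTree b j c).1.degree := by rw [degree_graftTree (by omega)]; omega
  have hja : j + m ≤ (graftTree a i c).1.degree := by rw [degree_graftTree (by omega)]; omega
  rw [graft_single_of_le (by omega : j ≤ c.1.degree), graft_single_of_le hib,
    graft_single_of_le (by omega : i ≤ c.1.degree), graft_single_of_le hja]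
  congr 1
  refine Subtype.ext ?_
  simp only [graftTree]
  rw [PTree.graftAt_comm a.1 b.1 hi (by omega), ha]

theorem bracket_single (t w : NTree deg) :
    bracket K deg (Finsupp.single t 1) (Finsupp.single w 1) =
      graft K deg t.1.degree (Finsupp.single w 1) (Finsupp.single t 1) -
      graft K deg 0 (Finsupp.single t 1) (Finsupp.single w 1) := by
  simp [bracket]

theorem bracket_eq {m : ℕ} {x : TreeSpace K deg} (y : TreeSpace K deg) (hx : x ∈ homog K deg m) :
    bracket K deg x y = graft K deg m y x - graft K deg 0 x y := by
  refine eqOn_homog (f := (bracket K deg).flip y)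
    (g := graft K deg m y - (graft K deg 0).flip y) (fun t ht => ?_) hx
  refine LinearMap.congr_fun (f := bracket K deg (Finsupp.single t 1))
    (g := (graft K deg m).flip (Finsupp.single t 1) - graft K deg 0 (Finsupp.single t 1))
    (Finsupp.lhom_ext' fun w => LinearMap.ext_ring ?_) y
  simp only [LinearMap.comp_apply, LinearMap.sub_apply, LinearMap.flip_apply,
    Finsupp.lsingle_apply]
  rw [bracket_single, ht]

theorem bracket_mem_homog {m n : ℕ} {x y : TreeSpace K deg} (hx : x ∈ homog K deg m)
    (hy : y ∈ homog K deg n) : bracket K deg x y ∈ homog K deg (m + n) := by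
  rw [bracket_eq y hx]
  exact sub_mem (add_comm n m ▸ graft_mem_homog hy hx) (graft_mem_homog hx hy)

end TreeSpace

end

/-! ### Grafting on a tree that is cut along a path -/

noncomputable section

namespace PTree

variable {X : Type*} {deg : X → ℕ} {K : Type*} [Field K]

/-- The linear extension to linear combinations of trees of the substitution of a tree for the
`l`-th entry of the sequence `C`, in a function `F` of sequences of trees. -/
def subst (K : Type*) [Field K] {M : Type*} [AddCommMonoid M] [Module K M]
    (F : (ℕ → PTree deg) → M) (C : ℕ → PTree deg) (l : ℕ) : (PTree deg →₀ K) →ₗ[K] M :=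
  Finsupp.linearCombination K fun v => F (Function.update C l v)

section subst

variable {M N : Type*} [AddCommMonoid M] [Module K M] [AddCommMonoid N] [Module K N]

theorem subst_single (F : (ℕ → PTree deg) → M) (C : ℕ → PTree deg) (l : ℕ) (v : PTree deg) :
    subst K F C l (Finsupp.single v 1) = F (Function.update C l v) := by
  simp [subst]

theorem subst_add (F G : (ℕ → PTree deg) → M) (C : ℕ → PTree deg) (l : ℕ) :
    subst K (fun C => F C + G C) C l = subst K F C l + subst K G C l :=
  Finsupp.lhom_ext' fun v => LinearMap.ext_ring (by simp [subst])

theorem subst_smul (a : K) (F : (ℕ → PTree deg) → M) (C : ℕ → PTree deg) (l : ℕ) :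
    subst K (fun C => a • F C) C l = a • subst K F C l :=
  Finsupp.lhom_ext' fun v => LinearMap.ext_ring (by simp [subst])

theorem subst_zero (C : ℕ → PTree deg) (l : ℕ) :
    subst K (fun _ => (0 : M)) C l = 0 :=
  Finsupp.lhom_ext' fun v => LinearMap.ext_ring (by simp [subst])

theorem subst_map (f : M →ₗ[K] N) (F : (ℕ → PTree deg) → M) (C : ℕ → PTree deg) (l : ℕ)
    (z : PTree deg →₀ K) :
    f (subst K F C l z) = subst K (fun C => f (F C)) C l z :=
  LinearMap.congr_fun (f := f ∘ₗ subst K F C l)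
    (Finsupp.lhom_ext' fun v => LinearMap.ext_ring (by simp [subst])) z

end subst

/-- The grafting of the linear combination `u` of trees on the leaf number `i`; it is zero on the
trees that have no such leaf. -/
def graftLin (u : PTree deg →₀ K) (i : ℤ) : (PTree deg →₀ K) →ₗ[K] (PTree deg →₀ K) :=
  Finsupp.linearCombination K fun w =>
    if 0 ≤ i ∧ i ≤ degree w then
      Finsupp.linearCombination K (fun t => Finsupp.single (graftAt t i.toNat w) (1 : K)) u
    else 0

theorem graftLin_single_of_le (u : PTree deg →₀ K) {i : ℤ} {w : PTree deg} (h0 : 0 ≤ i)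
    (h : i ≤ degree w) :
    graftLin u i (Finsupp.single w 1) =
      Finsupp.linearCombination K (fun t => Finsupp.single (graftAt t i.toNat w) (1 : K)) u := by
  simp [graftLin, h0, h]

theorem graftLin_single_of_not (u : PTree deg →₀ K) {i : ℤ} {w : PTree deg}
    (h : ¬(0 ≤ i ∧ i ≤ degree w)) : graftLin u i (Finsupp.single w 1) = 0 := by
  simp only [graftLin, Finsupp.linearCombination_single, one_smul]
  rw [if_neg h]

theorem graftLin_leaf (u : PTree deg →₀ K) (i : ℤ) :
    graftLin u i (Finsupp.single leaf 1) = if i = 0 then u else 0 := by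
  split_ifs with h
  · subst h
    rw [graftLin_single_of_le u le_rfl (by simp)]
    refine LinearMap.congr_fun (g := LinearMap.id)
      (Finsupp.lhom_ext' fun v => LinearMap.ext_ring ?_) u
    simp [graftAt_leaf]
  · exact graftLin_single_of_not u (by simp; omega)

/-- At most one term is nonzero, the one whose child contains leaf `i`. Indices in `ℤ` make this sum
valid without case distinction: truncated subtraction in `ℕ` would turn the negative indices into
leaf `0`. -/
theorem graftLin_nodeN (u : PTree deg →₀ K) (i : ℤ) (x : X) (C : ℕ → PTree deg) :
    graftLin u i (Finsupp.single (nodeN x C) 1) =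
      ∑ l ∈ Finset.range (deg x + 1), subst K (fun C => Finsupp.single (nodeN x C) (1 : K)) C l
        (graftLin u (i - offset C l) (Finsupp.single (C l) 1)) := by
  by_cases h : 0 ≤ i ∧ i ≤ degree (nodeN x C)
  · obtain ⟨j, rfl⟩ := Int.eq_ofNat_of_zero_le h.1
    obtain ⟨k, hk, h1, h2⟩ := exists_slot x C (i := j) (by omega)
    rw [Finset.sum_eq_single k]
    · rw [graftLin_single_of_le u h.1 h.2, graftLin_single_of_le u (by omega) (by omega)]
      refine LinearMap.congr_fun
        (g := subst K (fun C => Finsupp.single (nodeN x C) (1 : K)) C k ∘ₗ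
          Finsupp.linearCombination K
            fun t => Finsupp.single (graftAt t ((j : ℤ) - offset C k).toNat (C k)) (1 : K))
        (Finsupp.lhom_ext' fun v => LinearMap.ext_ring ?_) u
      simp only [LinearMap.comp_apply, Finsupp.lsingle_apply, Finsupp.linearCombination_single,
        one_smul, subst_single]
      rw [show (j : ℤ).toNat = j by omega, show ((j : ℤ) - offset C k).toNat = j - offset C k by
        omega, graftAt_nodeN v hk h1 h2]
    · intro l _ hl
      rw [graftLin_single_of_not, map_zero]
      intro h'
      exact hl (offset_index_unique C (i := j) (by omega) (by omega) h1 h2)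
    · intro hk'
      simp at hk'
      omega
  · rw [graftLin_single_of_not u h, Finset.sum_eq_zero]
    intro l hl
    rw [graftLin_single_of_not, map_zero]
    intro h'
    have h1 := degree_nodeN_add_one x C
    have h2 := offset_mono C (show l + 1 ≤ deg x + 1 by have := Finset.mem_range.1 hl; omega)
    rw [offset_succ] at h2
    omega

/-- The operation `a ⊗ b ↦ u ∘_i a ⊗ b + a ⊗ u ∘_(i - |a|) b`. -/
def graftTensor (u : PTree deg →₀ K) (i : ℤ) :
    (PTree deg →₀ K) ⊗[K] (PTree deg →₀ K) →ₗ[K] (PTree deg →₀ K) ⊗[K] (PTree deg →₀ K) :=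
  LinearMap.rTensor _ (graftLin u i) +
    TensorProduct.lift (Finsupp.linearCombination K fun a =>
      TensorProduct.mk K _ _ (Finsupp.single a 1) ∘ₗ graftLin u (i - degree a))

theorem graftTensor_tmul (u : PTree deg →₀ K) (i : ℤ) (a : PTree deg) (b : PTree deg →₀ K) :
    graftTensor u i (Finsupp.single a 1 ⊗ₜ b) =
      graftLin u i (Finsupp.single a 1) ⊗ₜ b +
        Finsupp.single a 1 ⊗ₜ graftLin u (i - degree a) b := by
  simp [graftTensor]

/-- The subspace of degree `n` of the tensor square. -/
def tensorHomog (K : Type*) [Field K] {X : Type*} (deg : X → ℕ) (n : ℕ) :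
    Submodule K ((PTree deg →₀ K) ⊗[K] (PTree deg →₀ K)) :=
  Submodule.span K {w | ∃ a b, degree a + degree b = n ∧
    w = Finsupp.single a (1 : K) ⊗ₜ[K] Finsupp.single b (1 : K)}

/-- The left part of a node cut along a path through its `k`-th child: it depends on the first
`k` children and on a new last child. -/
structure IsLeftCut (K : Type*) [Field K] (k : ℕ)
    (L : (ℕ → PTree deg) → PTree deg → PTree deg) : Prop where
  update : ∀ C l v u, k ≤ l → L (Function.update C l v) u = L C u
  degree_eq : ∀ C u, degree (L C u) = offset C k + degree u
  graftLin_eq : ∀ (w : PTree deg →₀ K) (i : ℤ) C u, graftLin w i (Finsupp.single (L C u) 1) =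
    ∑ l ∈ Finset.range k, subst K (fun C => Finsupp.single (L C u) (1 : K)) C l
      (graftLin w (i - offset C l) (Finsupp.single (C l) 1)) +
    Finsupp.lmapDomain K K (L C) (graftLin w (i - offset C k) (Finsupp.single u 1))

/-- The right part of a node cut along a path through its `k`-th child: it depends on the
children after the `k`-th one and on a new first child. -/
structure IsRightCut (K : Type*) [Field K] (k r : ℕ)
    (R : (ℕ → PTree deg) → PTree deg → PTree deg) : Prop where
  le : k ≤ r
  update : ∀ C l v u, l ≤ k → R (Function.update C l v) u = R C u
  degree_eq : ∀ C v, degree (R C v) + offset C (k + 1) + 1 = offset C (r + 1) + degree v + 1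
  graftLin_eq : ∀ (w : PTree deg →₀ K) (i : ℤ) C v, graftLin w i (Finsupp.single (R C v) 1) =
    Finsupp.lmapDomain K K (R C) (graftLin w i (Finsupp.single v 1)) +
    ∑ l ∈ Finset.Ico (k + 1) (r + 1), subst K (fun C => Finsupp.single (R C v) (1 : K)) C l
      (graftLin w (i - (offset C l - offset C (k + 1) + degree v + 1)) (Finsupp.single (C l) 1))

/-- The tree `⋁_y (C 0, …, C (k - 1), u)`. -/
def leftN (k : ℕ) (y : X) (C : ℕ → PTree deg) (u : PTree deg) : PTree deg :=
  nodeN y fun j => if j < k then C j else u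

/-- The tree `⋁_z (v, C (k + 1), …)`. -/
def rightN (k : ℕ) (z : X) (C : ℕ → PTree deg) (v : PTree deg) : PTree deg :=
  nodeN z fun j => if j = 0 then v else C (k + j)

/-- The cut through the first child leaves no root on the left; this is the term t^0_(1) ⊗ ⋁_x
(t^0_(2), t^1, …). The identity right cut serves for the last child. -/
theorem isLeftCut_id : IsLeftCut K 0 fun (_ : ℕ → PTree deg) u => u where
  update _ _ _ _ _ := rfl
  degree_eq _ _ := by simp
  graftLin_eq w i C u := by
    have : Finsupp.lmapDomain K K (fun u : PTree deg => u) = LinearMap.id :=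
      Finsupp.lmapDomain_id K K
    simp [this]

theorem isLeftCut_leftN (y : X) : IsLeftCut K (deg y) (leftN (deg := deg) (deg y) y) where
  update C l v u h := by
    refine nodeN_congr fun j _ => ?_
    split_ifs with hj
    · rw [Function.update_of_ne (by omega)]
    · rfl
  degree_eq C u := by
    have h := degree_nodeN_add_one y fun j => if j < deg y then C j else u
    have h' : offset (fun j => if j < deg y then C j else u) (deg y) = offset C (deg y) :=
      offset_congr fun j hj => by simp [hj]
    rw [offset_succ, h'] at h
    simp only [lt_irrefl, if_false] at h
    unfold leftN
    omega
  graftLin_eq w i C u := by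
    have ho : ∀ l ≤ deg y, offset (fun j => if j < deg y then C j else u) l = offset C l :=
      fun l hl => offset_congr fun j hj => by simp [show j < deg y by omega]
    rw [leftN, graftLin_nodeN, Finset.sum_range_succ]
    congr 1
    · refine Finset.sum_congr rfl fun l hl => ?_
      have hl := Finset.mem_range.1 hl
      rw [ho l hl.le, if_pos hl]
      refine LinearMap.congr_fun (Finsupp.lhom_ext' fun v => LinearMap.ext_ring ?_) _
      simp only [LinearMap.comp_apply, Finsupp.lsingle_apply, subst_single]
      congr 1
      refine nodeN_congr fun j _ => ?_
      by_cases hj : j = l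
      · subst hj
        simp [hl]
      · simp [hj]
    · rw [ho _ le_rfl, if_neg (lt_irrefl _)]
      refine LinearMap.congr_fun (Finsupp.lhom_ext' fun v => LinearMap.ext_ring ?_) _
      simp only [LinearMap.comp_apply, Finsupp.lsingle_apply, subst_single,
        Finsupp.lmapDomain_apply, Finsupp.mapDomain_single]
      congr 1
      refine nodeN_congr fun j hj => ?_
      rcases hj.eq_or_lt with rfl | hj
      · simp
      · rw [Function.update_of_ne hj.ne, if_pos hj, if_pos hj]

theorem isRightCut_id (r : ℕ) : IsRightCut K r r fun (_ : ℕ → PTree deg) v => v where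
  le := le_rfl
  update _ _ _ _ _ := rfl
  degree_eq _ _ := by omega
  graftLin_eq w i C u := by
    have : Finsupp.lmapDomain K K (fun u : PTree deg => u) = LinearMap.id :=
      Finsupp.lmapDomain_id K K
    simp [this]

/-- In the right part, `v` replaces the first `k + 1` children, so offsets change by `|v| + 1 -
offset C (k + 1)`. -/
theorem offset_right (k : ℕ) (C : ℕ → PTree deg) (v : PTree deg) (j : ℕ) :
    offset (fun j => if j = 0 then v else C (k + j)) (j + 1) + offset C (k + 1) =
      offset C (k + 1 + j) + degree v + 1 := by
  induction j with
  | zero => rw [offset_succ]; simp; omega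
  | succ j ih =>
    rw [offset_succ, ← add_assoc (k + 1) j 1, offset_succ C (k + 1 + j)]
    simp only [Nat.add_eq_zero_iff, one_ne_zero, and_false, if_false,
      show k + (j + 1) = k + 1 + j by omega]
    omega

theorem isRightCut_rightN {k r : ℕ} (z : X) (h : k + deg z = r) :
    IsRightCut K k r (rightN (deg := deg) k z) where
  le := by omega
  update C l v u hl := by
    refine nodeN_congr fun j _ => ?_
    split_ifs with hj
    · rfl
    · rw [Function.update_of_ne (by omega)]
  degree_eq C v := by
    have h1 := degree_nodeN_add_one z fun j => if j = 0 then v else C (k + j)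
    have h2 := offset_right k C v (deg z)
    rw [show k + 1 + deg z = r + 1 by omega] at h2
    unfold rightN
    omega
  graftLin_eq w i C v := by
    rw [rightN, graftLin_nodeN, Finset.sum_range_succ', add_comm]
    congr 1
    · simp only [offset_zero, Nat.cast_zero, sub_zero, if_true]
      refine LinearMap.congr_fun (Finsupp.lhom_ext' fun v => LinearMap.ext_ring ?_) _
      simp only [LinearMap.comp_apply, Finsupp.lsingle_apply, subst_single,
        Finsupp.lmapDomain_apply, Finsupp.mapDomain_single]
      congr 1
      refine nodeN_congr fun j _ => ?_
      by_cases hj : j = 0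
      · subst hj
        simp
      · simp [hj]
    · rw [Finset.sum_Ico_eq_sum_range, show r + 1 - (k + 1) = deg z by omega]
      refine Finset.sum_congr rfl fun j _ => ?_
      have ho := offset_right k C v j
      rw [if_neg (by omega), show k + (j + 1) = k + 1 + j by omega,
        show i - (offset (fun j => if j = 0 then v else C (k + j)) (j + 1) : ℤ) =
          i - (offset C (k + 1 + j) - offset C (k + 1) + degree v + 1) by omega]
      refine LinearMap.congr_fun (Finsupp.lhom_ext' fun t => LinearMap.ext_ring ?_) _
      simp only [LinearMap.comp_apply, Finsupp.lsingle_apply, subst_single]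
      congr 1
      refine nodeN_congr fun m _ => ?_
      by_cases hm : m = j + 1
      · subst hm
        simp [show k + (j + 1) = k + 1 + j by omega]
      · rw [Function.update_of_ne hm]
        split_ifs
        · rfl
        · rw [Function.update_of_ne (by omega)]

/-- The contribution of a cut to the coproduct of a node. -/
def cut (K : Type*) [Field K] (L R : (ℕ → PTree deg) → PTree deg → PTree deg)
    (C : ℕ → PTree deg) :
    (PTree deg →₀ K) ⊗[K] (PTree deg →₀ K) →ₗ[K] (PTree deg →₀ K) ⊗[K] (PTree deg →₀ K) :=
  TensorProduct.map (Finsupp.lmapDomain K K (L C)) (Finsupp.lmapDomain K K (R C))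

theorem cut_single (L R : (ℕ → PTree deg) → PTree deg → PTree deg) (C : ℕ → PTree deg)
    (a b : PTree deg) :
    cut K L R C (Finsupp.single a 1 ⊗ₜ Finsupp.single b 1) =
      Finsupp.single (L C a) 1 ⊗ₜ Finsupp.single (R C b) 1 := by
  simp [cut]

/-- A graft on a child before the `k`-th changes the left factor only, a graft on a later child
changes the right factor only, and a graft on the `k`-th child acts on `τ`. The leaf at which the
path ends belongs to both factors of `τ`, and `graftTensor` grafts on each of them in turn. -/
theorem graftTensor_cut {k r : ℕ} {L R : (ℕ → PTree deg) → PTree deg → PTree deg}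
    (hL : IsLeftCut K k L) (hR : IsRightCut K k r R) (w : PTree deg →₀ K) (i : ℤ)
    (C : ℕ → PTree deg) {τ : (PTree deg →₀ K) ⊗[K] (PTree deg →₀ K)}
    (hτ : τ ∈ tensorHomog K deg (degree (C k))) :
    graftTensor w i (cut K L R C τ) =
      ∑ l ∈ Finset.range k, subst K (fun C => cut K L R C τ) C l
        (graftLin w (i - offset C l) (Finsupp.single (C l) 1)) +
      cut K L R C (graftTensor w (i - offset C k) τ) +
      ∑ l ∈ Finset.Ico (k + 1) (r + 1), subst K (fun C => cut K L R C τ) C l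
        (graftLin w (i - offset C l) (Finsupp.single (C l) 1)) := by
  induction hτ using Submodule.span_induction with
  | zero => simp [subst_zero]
  | add x y _ _ hx hy =>
    simp only [map_add, hx, hy, subst_add, LinearMap.add_apply, Finset.sum_add_distrib]
    abel
  | smul a x _ hx =>
    simp only [map_smul, hx, subst_smul, LinearMap.smul_apply, Finset.smul_sum, smul_add]
  | mem x hx =>
    obtain ⟨a, b, hab, rfl⟩ := hx
    simp only [cut_single, graftTensor_tmul, hL.graftLin_eq, hR.graftLin_eq, map_add]
    rw [TensorProduct.add_tmul, TensorProduct.tmul_add, TensorProduct.sum_tmul,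
      TensorProduct.tmul_sum]
    have e1 : ∀ z : PTree deg →₀ K, (cut K L R C) (z ⊗ₜ[K] Finsupp.single b 1) =
        Finsupp.lmapDomain K K (L C) z ⊗ₜ Finsupp.single (R C b) 1 := by
      intro z
      simp [cut]
    have e2 : ∀ z : PTree deg →₀ K, (cut K L R C) (Finsupp.single a 1 ⊗ₜ z) =
        Finsupp.single (L C a) 1 ⊗ₜ Finsupp.lmapDomain K K (R C) z := by
      intro z
      simp [cut]
    have e3 : ∀ l ∈ Finset.range k, subst K (fun C => Finsupp.single (L C a) (1 : K) ⊗ₜ[K]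
          Finsupp.single (R C b) (1 : K)) C l
          (graftLin w (i - offset C l) (Finsupp.single (C l) 1)) =
        subst K (fun C => Finsupp.single (L C a) (1 : K)) C l
          (graftLin w (i - offset C l) (Finsupp.single (C l) 1)) ⊗ₜ Finsupp.single (R C b) 1 := by
      intro l hl
      refine LinearMap.congr_fun (g := (TensorProduct.mk K _ _).flip (Finsupp.single (R C b) 1) ∘ₗ
        subst K (fun C => Finsupp.single (L C a) (1 : K)) C l)
        (Finsupp.lhom_ext' fun v => LinearMap.ext_ring ?_) _
      simp only [LinearMap.comp_apply, Finsupp.lsingle_apply, subst_single, LinearMap.flip_apply,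
        TensorProduct.mk_apply]
      rw [hR.update C l v b (Finset.mem_range.1 hl).le]
    have e4 : ∀ l ∈ Finset.Ico (k + 1) (r + 1), subst K (fun C => Finsupp.single (L C a) (1 : K)
          ⊗ₜ[K] Finsupp.single (R C b) (1 : K)) C l
          (graftLin w (i - offset C l) (Finsupp.single (C l) 1)) =
        Finsupp.single (L C a) 1 ⊗ₜ subst K (fun C => Finsupp.single (R C b) (1 : K)) C l
          (graftLin w (i - degree (L C a) - (offset C l - offset C (k + 1) + degree b + 1))
            (Finsupp.single (C l) 1)) := by
      intro l hl
      -- The left part has degree `offset C k + |a|`, and `|a| + |b| = |C k|` by homogeneity of `τ`;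
      -- the shifts therefore add up to the leaf number in the uncut tree.
      rw [show i - degree (L C a) - (offset C l - offset C (k + 1) + degree b + 1 : ℤ) =
        i - offset C l by rw [hL.degree_eq, offset_succ, ← hab]; push_cast; ring]
      refine LinearMap.congr_fun (g := (TensorProduct.mk K _ _) (Finsupp.single (L C a) 1) ∘ₗ
        subst K (fun C => Finsupp.single (R C b) (1 : K)) C l)
        (Finsupp.lhom_ext' fun v => LinearMap.ext_ring ?_) _
      simp only [LinearMap.comp_apply, Finsupp.lsingle_apply, subst_single,
        TensorProduct.mk_apply]
      rw [hL.update C l v a (by have := Finset.mem_Ico.1 hl; omega)]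
    rw [Finset.sum_congr rfl e3, Finset.sum_congr rfl e4, e1, e2,
      show i - (offset C k : ℤ) - degree a = i - degree (L C a) by
        rw [hL.degree_eq]; push_cast; ring]
    abel

/-- The linear extension of the coproduct `Δ_+`. -/
def coprodLin (Θ : (X →₀ K) →ₗ[K] (X →₀ K) ⊗[K] (X →₀ K)) :
    (PTree deg →₀ K) →ₗ[K] (PTree deg →₀ K) ⊗[K] (PTree deg →₀ K) :=
  Finsupp.linearCombination K (coprodPlus K Θ)

theorem coprodLin_single (Θ : (X →₀ K) →ₗ[K] (X →₀ K) ⊗[K] (X →₀ K)) (t : PTree deg) :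
    coprodLin Θ (Finsupp.single t 1) = coprodPlus K Θ t := by
  simp [coprodLin]

theorem graftTensor_cut_coprod {k r : ℕ} {L R : (ℕ → PTree deg) → PTree deg → PTree deg}
    (hL : IsLeftCut K k L) (hR : IsRightCut K k r R)
    {Θ : (X →₀ K) →ₗ[K] (X →₀ K) ⊗[K] (X →₀ K)}
    (w : PTree deg →₀ K) (i : ℤ) (C : ℕ → PTree deg)
    (hg : coprodPlus K Θ (C k) ∈ tensorHomog K deg (degree (C k)))
    (hC : ∀ i, coprodLin Θ (graftLin w i (Finsupp.single (C k) 1)) =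
      graftTensor w i (coprodPlus K Θ (C k))) :
    graftTensor w i (cut K L R C (coprodPlus K Θ (C k))) =
      ∑ l ∈ Finset.range (r + 1), subst K (fun C => cut K L R C (coprodPlus K Θ (C k))) C l
        (graftLin w (i - offset C l) (Finsupp.single (C l) 1)) := by
  have hkr := hR.le
  rw [graftTensor_cut hL hR w i C hg, ← Finset.sum_range_add_sum_Ico _ (show k + 1 ≤ r + 1 by omega),
    Finset.sum_range_succ]
  -- In `graftTensor_cut` the tensor `τ` is fixed, whereas here it is the coproduct of the `k`-th
  -- child of the varying sequence. Both agree for `l ≠ k`; for `l = k` the hypothesis `hC` on the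
  -- child takes over.
  have e : ∀ l, l ≠ k → subst K (fun D => cut K L R D (coprodPlus K Θ (C k))) C l =
      subst K (fun C => cut K L R C (coprodPlus K Θ (C k))) C l := by
    intro l hl
    refine Finsupp.lhom_ext' fun v => LinearMap.ext_ring ?_
    simp only [LinearMap.comp_apply, Finsupp.lsingle_apply, subst_single]
    rw [Function.update_of_ne hl.symm]
  congr 1
  · congr 1
    · refine Finset.sum_congr rfl fun l hl => ?_
      rw [e l (by have := Finset.mem_range.1 hl; omega)]
    · rw [← hC]
      refine LinearMap.congr_fun (f := cut K L R C ∘ₗ coprodLin Θ)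
        (Finsupp.lhom_ext' fun v => LinearMap.ext_ring ?_) _
      simp only [LinearMap.comp_apply, Finsupp.lsingle_apply, subst_single, coprodLin_single,
        Function.update_self, cut]
      rw [funext fun u => hL.update C k v u le_rfl, funext fun u => hR.update C k v u le_rfl]
  · refine Finset.sum_congr rfl fun l hl => ?_
    rw [e l (by have := Finset.mem_Ico.1 hl; omega)]

end PTree

end

/-! ### The coproduct of a node as a combination of cuts -/

noncomputable section

namespace PTree

variable {X : Type*} {deg : X → ℕ} {K : Type*} [Field K]

/-- The part of `Δ_+ (⋁_x (C 0, …, C r))` that depends on `Θ x`, as a function of `Θ x`. -/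
def middle (Θ : (X →₀ K) →ₗ[K] (X →₀ K) ⊗[K] (X →₀ K)) (x : X) (C : ℕ → PTree deg) :
    (X →₀ K) ⊗[K] (X →₀ K) →ₗ[K] (PTree deg →₀ K) ⊗[K] (PTree deg →₀ K) :=
  ∑ k : Fin (deg x + 1), if 0 < (k : ℕ) ∧ (k : ℕ) < deg x then
    TensorProduct.map
        (TensorProduct.lift (leftMap K (r := deg x) (fun j => C j) k))
        (TensorProduct.lift (rightMap K (r := deg x) (fun j => C j) k)) ∘ₗ
      (TensorProduct.tensorTensorTensorComm K (PTree deg →₀ K) (PTree deg →₀ K)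
        (X →₀ K) (X →₀ K)).toLinearMap ∘ₗ TensorProduct.mk K _ _ (coprodPlus K Θ (C k))
  else 0

theorem childAt_fin {r j : ℕ} (C : ℕ → PTree deg) (h : j ≤ r) :
    childAt (r := r) (fun j => C j) j = C j := by
  rw [childAt, dif_pos (by omega)]

theorem coprodPlus_nodeN (Θ : (X →₀ K) →ₗ[K] (X →₀ K) ⊗[K] (X →₀ K)) (x : X)
    (C : ℕ → PTree deg) :
    coprodPlus K Θ (nodeN x C) =
      cut K (fun _ u => u) (rightN 0 x) C (coprodPlus K Θ (C 0)) +
      cut K (leftN (deg x) x) (fun _ v => v) C (coprodPlus K Θ (C (deg x))) +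
      middle Θ x C (Θ (Finsupp.single x 1)) := by
  rw [nodeN, coprodPlus]
  have hid : Finsupp.lmapDomain K K (fun u : PTree deg => u) = LinearMap.id :=
    Finsupp.lmapDomain_id K K
  refine congrArg₂ _ (congrArg₂ _ ?_ ?_) ?_
  · rw [cut, hid, LinearMap.lTensor]
    congr 3
    funext v
    refine nodeN_congr (C := fun j => if j = 0 then v else childAt _ (0 + j)) fun j hj => ?_
    rw [childAt_fin C (by omega)]
  · rw [cut, hid, LinearMap.rTensor]
    congr 3
    funext v
    refine nodeN_congr (C := fun j => if j < deg x then childAt _ j else v) fun j hj => ?_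
    rw [childAt_fin C (by omega)]
  · rw [middle, LinearMap.sum_apply]
    refine Finset.sum_congr rfl fun k _ => ?_
    split_ifs <;> rfl

/-- `leftMap` vanishes on `y` unless `k = |y|`, so one value of `k` survives. -/
theorem middle_tmul (Θ : (X →₀ K) →ₗ[K] (X →₀ K) ⊗[K] (X →₀ K)) {x y z : X}
    (C : ℕ → PTree deg) (hyz : deg y + deg z = deg x) (hy : 0 < deg y) (hz : 0 < deg z) :
    middle Θ x C (Finsupp.single y 1 ⊗ₜ Finsupp.single z 1) =
      cut K (leftN (deg y) y) (rightN (deg y) z) C (coprodPlus K Θ (C (deg y))) := by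
  have key : ∀ (k : ℕ) (τ : (PTree deg →₀ K) ⊗[K] (PTree deg →₀ K)),
      TensorProduct.map
        (TensorProduct.lift (leftMap K (r := deg x) (fun j => C j) k))
        (TensorProduct.lift (rightMap K (r := deg x) (fun j => C j) k))
        (TensorProduct.tensorTensorTensorComm K (PTree deg →₀ K) (PTree deg →₀ K)
          (X →₀ K) (X →₀ K) (τ ⊗ₜ (Finsupp.single y 1 ⊗ₜ Finsupp.single z 1))) =
        if deg y = k then cut K (leftN (deg y) y) (rightN (deg y) z) C τ else 0 := by
    intro k τ
    induction τ using TensorProduct.induction_on with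
    | zero => simp
    | add a b ha hb =>
      rw [TensorProduct.add_tmul, map_add, map_add, ha, hb]
      split_ifs <;> simp
    | tmul a b =>
      rw [TensorProduct.tensorTensorTensorComm_tmul, TensorProduct.map_tmul,
        TensorProduct.lift.tmul, TensorProduct.lift.tmul]
      split_ifs with h
      · subst h
        rw [cut, TensorProduct.map_tmul]
        congr 1
        · refine LinearMap.congr_fun
            (f := (leftMap K (r := deg x) (fun j => C j) (deg y)).flip (Finsupp.single y 1))
            (Finsupp.lhom_ext' fun u => LinearMap.ext_ring ?_) a
          simp only [LinearMap.comp_apply, Finsupp.lsingle_apply, LinearMap.flip_apply, leftMap,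
            Finsupp.lmapDomain_apply, Finsupp.mapDomain_single, Finsupp.lift_apply,
            Finsupp.sum_single_index, zero_smul, one_smul, if_true]
          congr 1
          refine nodeN_congr (C := fun j => if j < deg y then childAt _ j else u) fun j hj => ?_
          rw [childAt_fin C (by omega)]
        · refine LinearMap.congr_fun
            (f := (rightMap K (r := deg x) (fun j => C j) (deg y)).flip (Finsupp.single z 1))
            (Finsupp.lhom_ext' fun u => LinearMap.ext_ring ?_) b
          simp only [LinearMap.comp_apply, Finsupp.lsingle_apply, LinearMap.flip_apply, rightMap,
            Finsupp.lmapDomain_apply, Finsupp.mapDomain_single, Finsupp.lift_apply,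
            Finsupp.sum_single_index, zero_smul, one_smul, hyz, if_true]
          congr 1
          refine nodeN_congr (C := fun j => if j = 0 then u else childAt _ (deg y + j))
            fun j hj => ?_
          rw [childAt_fin C (by omega)]
      · have : leftMap K (r := deg x) (fun j => C j) k a (Finsupp.single y 1) = 0 := by
          refine LinearMap.congr_fun (g := 0)
            (f := (leftMap K (r := deg x) (fun j => C j) k).flip (Finsupp.single y 1))
            (Finsupp.lhom_ext' fun u => LinearMap.ext_ring ?_) a
          simp [leftMap, h]
        rw [this, TensorProduct.zero_tmul]
  rw [middle, LinearMap.sum_apply, Finset.sum_eq_single ⟨deg y, by omega⟩]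
  · rw [if_pos ⟨hy, by simp only; omega⟩]
    simp only [LinearMap.comp_apply, TensorProduct.mk_apply, LinearEquiv.coe_coe]
    rw [key, if_pos rfl]
  · intro k _ hk
    split_ifs
    · simp only [LinearMap.comp_apply, TensorProduct.mk_apply, LinearEquiv.coe_coe]
      rw [key, if_neg]
      intro h
      exact hk (Fin.ext h.symm)
    · rfl
  · simp

section coproduct

variable (hdeg : ∀ x, 0 < deg x) {Θ : (X →₀ K) →ₗ[K] (X →₀ K) ⊗[K] (X →₀ K)}
  (hΘ : IsGradedCoproduct deg Θ)

include hdeg hΘ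

/-- Since `Θ` is graded, `Θ x` is a combination of y ⊗ z with |y| + |z| = |x|, and each such tensor
gives one cut. The property bears on functions of `C`, not on their values, because `subst` varies
the sequence. -/
theorem middle_induction {x : X} {p : ((ℕ → PTree deg) → (PTree deg →₀ K) ⊗[K] (PTree deg →₀ K)) → Prop}
    (zero : p fun _ => 0) (add : ∀ F G, p F → p G → p fun C => F C + G C)
    (smul : ∀ (a : K) F, p F → p fun C => a • F C)
    (cuts : ∀ y z, deg y + deg z = deg x → p fun C =>
      cut K (leftN (deg y) y) (rightN (deg y) z) C (coprodPlus K Θ (C (deg y)))) :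
    p fun C => middle Θ x C (Θ (Finsupp.single x 1)) := by
  have hx := hΘ x
  generalize Θ (Finsupp.single x 1) = θ at hx ⊢
  induction hx using Submodule.span_induction with
  | zero => simpa using zero
  | add a b _ _ ha hb => simpa using add _ _ ha hb
  | smul a b _ hb => simpa using smul a _ hb
  | mem w hw =>
    obtain ⟨y, z, hyz, rfl⟩ := hw
    convert cuts y z hyz using 2 with C
    exact middle_tmul Θ C hyz (hdeg y) (hdeg z)

theorem coprodPlus_nodeN_induction {x : X}
    {p : ((ℕ → PTree deg) → (PTree deg →₀ K) ⊗[K] (PTree deg →₀ K)) → Prop}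
    (zero : p fun _ => 0) (add : ∀ F G, p F → p G → p fun C => F C + G C)
    (smul : ∀ (a : K) F, p F → p fun C => a • F C)
    (cuts : ∀ k L R, IsLeftCut K k L → IsRightCut K k (deg x) R → p fun C =>
      cut K L R C (coprodPlus K Θ (C k))) :
    p fun C => coprodPlus K Θ (nodeN x C) := by
  simp only [coprodPlus_nodeN]
  refine add _ _ (add _ _ (cuts 0 _ _ isLeftCut_id (isRightCut_rightN x (zero_add _)))
    (cuts _ _ _ (isLeftCut_leftN x) (isRightCut_id _))) ?_
  exact middle_induction hdeg hΘ zero add smul fun y z hyz =>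
    cuts _ _ _ (isLeftCut_leftN y) (isRightCut_rightN z hyz)

theorem coprodPlus_mem (t : PTree deg) : coprodPlus K Θ t ∈ tensorHomog K deg (degree t) := by
  induction t using induction_nodeN with
  | leaf => exact Submodule.subset_span ⟨leaf, leaf, rfl, by rw [coprodPlus]⟩
  | node x C ih =>
    have h := coprodPlus_nodeN_induction hdeg hΘ (x := x)
      (p := fun F => ∀ C, (∀ j, coprodPlus K Θ (C j) ∈ tensorHomog K deg (degree (C j))) →
        F C ∈ tensorHomog K deg (degree (nodeN x C))) ?_ ?_ ?_ ?_
    · exact h C ih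
    · intro C _
      exact zero_mem _
    · intro F G hF hG C hC
      exact add_mem (hF C hC) (hG C hC)
    · intro a F hF C hC
      exact Submodule.smul_mem _ _ (hF C hC)
    intro k L R hL hR C hC
    have h : tensorHomog K deg (degree (C k)) ≤
        (tensorHomog K deg (degree (nodeN x C))).comap (cut K L R C) := by
      refine Submodule.span_le.2 ?_
      rintro _ ⟨a, b, hab, rfl⟩
      refine Submodule.subset_span ⟨L C a, R C b, ?_, cut_single L R C a b⟩
      have h1 := hL.degree_eq C a
      have h2 := hR.degree_eq C b
      have h3 := degree_nodeN_add_one x C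
      rw [offset_succ] at h2
      omega
    exact h (hC k)

/-- Primitivity of `u` is used only on the leaf, where the claim for `i = 0` is the formula for
Δ_+(u). It propagates to nodes cut by cut. -/
theorem coprodLin_graftLin {u : PTree deg →₀ K}
    (hu : coprodLin Θ u = u ⊗ₜ Finsupp.single leaf 1 + Finsupp.single leaf 1 ⊗ₜ u)
    (t : PTree deg) (i : ℤ) : coprodLin Θ (graftLin u i (Finsupp.single t 1)) =
      graftTensor u i (coprodPlus K Θ t) := by
  induction t using induction_nodeN generalizing i with
  | leaf =>
    rw [coprodPlus, graftTensor_tmul, graftLin_leaf, degree_leaf, Nat.cast_zero, sub_zero,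
      graftLin_leaf]
    split_ifs
    · exact hu
    · simp
  | node x C ih =>
    have h := coprodPlus_nodeN_induction hdeg hΘ (x := x)
      (p := fun F => graftTensor u i (F C) =
        ∑ l ∈ Finset.range (deg x + 1), subst K F C l
          (graftLin u (i - offset C l) (Finsupp.single (C l) 1)))
      (by simp [subst_zero])
      (fun F G hF hG => by simp [subst_add, hF, hG, Finset.sum_add_distrib])
      (fun a F hF => by simp [subst_smul, hF, Finset.smul_sum])
      (fun k L R hL hR => graftTensor_cut_coprod hL hR u i C (coprodPlus_mem hdeg hΘ _) (ih k))
    rw [h, graftLin_nodeN, map_sum]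
    refine Finset.sum_congr rfl fun l _ => ?_
    rw [subst_map (coprodLin Θ)]
    simp only [coprodLin_single]

/-- In every cut but the one through the first child, the left factor is a node and is killed by the
counit. The remaining cut is handled by induction; `counit_right` is the mirror image. -/
theorem counit_left (t : PTree deg) :
    TensorProduct.lid K _ ((Finsupp.lapply leaf : (PTree deg →₀ K) →ₗ[K] K).rTensor _
      (coprodPlus K Θ t)) = Finsupp.single t 1 := by
  have hz : ∀ k x R (C : ℕ → PTree deg) τ, (Finsupp.lapply leaf : (PTree deg →₀ K) →ₗ[K] K).rTensor
      (PTree deg →₀ K) (cut K (leftN k x) R C τ) = 0 := by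
    intro k x R C τ
    have : (Finsupp.lapply leaf : (PTree deg →₀ K) →ₗ[K] K) ∘ₗ
        Finsupp.lmapDomain K K (leftN k x C) = 0 := by
      refine Finsupp.lhom_ext' fun u => LinearMap.ext_ring ?_
      simp [leftN, nodeN_ne_leaf]
    rw [cut, ← LinearMap.comp_apply, LinearMap.rTensor_comp_map, this, TensorProduct.map_zero_left,
      LinearMap.zero_apply]
  have hr : ∀ x (C : ℕ → PTree deg) τ, TensorProduct.lid K _
      ((Finsupp.lapply leaf : (PTree deg →₀ K) →ₗ[K] K).rTensor
        (PTree deg →₀ K) (cut K (fun _ u => u) (rightN 0 x) C τ)) =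
      Finsupp.lmapDomain K K (rightN 0 x C) (TensorProduct.lid K _
      ((Finsupp.lapply leaf : (PTree deg →₀ K) →ₗ[K] K).rTensor (PTree deg →₀ K) τ)) := by
    intro x C τ
    have hid : Finsupp.lmapDomain K K (fun u : PTree deg => u) = LinearMap.id :=
      Finsupp.lmapDomain_id K K
    induction τ using TensorProduct.induction_on with
    | zero => simp
    | add a b ha hb => simp only [map_add, ha, hb]
    | tmul a b => simp [cut, hid]
  induction t using induction_nodeN with
  | leaf => simp [coprodPlus]
  | node x C ih =>
    have hm : (Finsupp.lapply leaf : (PTree deg →₀ K) →ₗ[K] K).rTensor (PTree deg →₀ K)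
        (middle Θ x C (Θ (Finsupp.single x 1))) = 0 :=
      middle_induction hdeg hΘ (x := x)
        (p := fun F => (Finsupp.lapply leaf : (PTree deg →₀ K) →ₗ[K] K).rTensor (PTree deg →₀ K)
          (F C) = 0) (by simp) (fun F G hF hG => by simp only [map_add, hF, hG, add_zero])
        (fun a F hF => by simp only [map_smul, hF, smul_zero]) (fun y z _ => hz _ _ _ _ _)
    rw [coprodPlus_nodeN]
    simp only [map_add]
    rw [hm, hz, map_zero, add_zero, add_zero, hr, ih, Finsupp.lmapDomain_apply, Finsupp.mapDomain_single]
    congr 1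
    refine nodeN_congr fun j _ => ?_
    by_cases hj : j = 0 <;> simp [hj]

theorem counit_right (t : PTree deg) :
    TensorProduct.rid K _ ((Finsupp.lapply leaf : (PTree deg →₀ K) →ₗ[K] K).lTensor _
      (coprodPlus K Θ t)) = Finsupp.single t 1 := by
  have hz : ∀ k x L (C : ℕ → PTree deg) τ, (Finsupp.lapply leaf : (PTree deg →₀ K) →ₗ[K] K).lTensor
      (PTree deg →₀ K) (cut K L (rightN k x) C τ) = 0 := by
    intro k x R C τ
    have : (Finsupp.lapply leaf : (PTree deg →₀ K) →ₗ[K] K) ∘ₗ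
        Finsupp.lmapDomain K K (rightN k x C) = 0 := by
      refine Finsupp.lhom_ext' fun u => LinearMap.ext_ring ?_
      simp [rightN, nodeN_ne_leaf]
    rw [cut, ← LinearMap.comp_apply, LinearMap.lTensor_comp_map, this, TensorProduct.map_zero_right,
      LinearMap.zero_apply]
  have hr : ∀ x (C : ℕ → PTree deg) τ, TensorProduct.rid K _
      ((Finsupp.lapply leaf : (PTree deg →₀ K) →ₗ[K] K).lTensor
        (PTree deg →₀ K) (cut K (leftN (deg x) x) (fun _ u => u) C τ)) =
      Finsupp.lmapDomain K K (leftN (deg x) x C) (TensorProduct.rid K _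
      ((Finsupp.lapply leaf : (PTree deg →₀ K) →ₗ[K] K).lTensor (PTree deg →₀ K) τ)) := by
    intro x C τ
    have hid : Finsupp.lmapDomain K K (fun u : PTree deg => u) = LinearMap.id :=
      Finsupp.lmapDomain_id K K
    induction τ using TensorProduct.induction_on with
    | zero => simp
    | add a b ha hb => simp only [map_add, ha, hb]
    | tmul a b => simp [cut, hid]
  induction t using induction_nodeN with
  | leaf => simp [coprodPlus]
  | node x C ih =>
    have hm : (Finsupp.lapply leaf : (PTree deg →₀ K) →ₗ[K] K).lTensor (PTree deg →₀ K)
        (middle Θ x C (Θ (Finsupp.single x 1))) = 0 :=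
      middle_induction hdeg hΘ (x := x)
        (p := fun F => (Finsupp.lapply leaf : (PTree deg →₀ K) →ₗ[K] K).lTensor (PTree deg →₀ K)
          (F C) = 0) (by simp) (fun F G hF hG => by simp only [map_add, hF, hG, add_zero])
        (fun a F hF => by simp only [map_smul, hF, smul_zero]) (fun y z _ => hz _ _ _ _ _)
    rw [coprodPlus_nodeN]
    simp only [map_add]
    rw [hm, hz, map_zero, zero_add, add_zero, hr, ih, Finsupp.lmapDomain_apply, Finsupp.mapDomain_single]
    congr 1
    refine nodeN_congr fun j hj => ?_
    split_ifs
    · rfl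
    · congr 1
      omega

end coproduct

end PTree

/-! ### Removal of the trivial tree: from Δ_+ to Δ_Θ -/

namespace TreeSpace

open PTree

variable {K : Type*} [Field K] {X : Type*} {deg : X → ℕ}

/-- The inclusion of `K[T_∞, X]` in the space spanned by all trees. -/
def incl (K : Type*) [Field K] {X : Type*} (deg : X → ℕ) :
    TreeSpace K deg →ₗ[K] (PTree deg →₀ K) :=
  Finsupp.lmapDomain K K Subtype.val

theorem incl_single (t : NTree deg) (a : K) :
    incl K deg (Finsupp.single t a) = Finsupp.single t.1 a := by
  simp [incl]

theorem dropLeaf_single (t : NTree deg) :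
    dropLeaf K deg (Finsupp.single t.1 1) = Finsupp.single t 1 := by
  simp [dropLeaf, t.2]

theorem dropLeaf_leaf : dropLeaf K deg (Finsupp.single leaf 1) = 0 := by
  simp [dropLeaf]

theorem dropLeaf_incl (z : TreeSpace K deg) : dropLeaf K deg (incl K deg z) = z :=
  LinearMap.congr_fun (f := dropLeaf K deg ∘ₗ incl K deg) (g := LinearMap.id)
    (Finsupp.lhom_ext' fun t => LinearMap.ext_ring
      (by simp only [LinearMap.comp_apply, Finsupp.lsingle_apply, incl_single, dropLeaf_single,
        LinearMap.id_apply])) z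

theorem incl_dropLeaf (a : PTree deg →₀ K) :
    incl K deg (dropLeaf K deg a) = a - a leaf • Finsupp.single leaf 1 := by
  refine LinearMap.congr_fun (f := incl K deg ∘ₗ dropLeaf K deg)
    (g := LinearMap.id - (Finsupp.lapply leaf : (PTree deg →₀ K) →ₗ[K] K).smulRight
      (Finsupp.single leaf 1))
    (Finsupp.lhom_ext' fun t => LinearMap.ext_ring ?_) a
  by_cases h : t = leaf
  · subst h
    simp [dropLeaf_leaf]
  · simp [dropLeaf_single (K := K) ⟨t, h⟩, incl_single, h]

theorem map_dropLeaf_incl (τ : TreeSpace K deg ⊗[K] TreeSpace K deg) :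
    TensorProduct.map (dropLeaf K deg) (dropLeaf K deg)
      (TensorProduct.map (incl K deg) (incl K deg) τ) = τ := by
  induction τ using TensorProduct.induction_on with
  | zero => simp
  | add a b ha hb => simp only [map_add, ha, hb]
  | tmul a b => simp only [TensorProduct.map_tmul, dropLeaf_incl]

/-- This expands both factors along the splitting into the line of `|` and the span of the other
trees; the last term corrects the double count of | ⊗ |. -/
theorem map_incl_dropLeaf (τ : (PTree deg →₀ K) ⊗[K] (PTree deg →₀ K)) :
    τ = TensorProduct.map (incl K deg) (incl K deg)
        (TensorProduct.map (dropLeaf K deg) (dropLeaf K deg) τ) +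
      Finsupp.single leaf 1 ⊗ₜ TensorProduct.lid K _
        ((Finsupp.lapply leaf : (PTree deg →₀ K) →ₗ[K] K).rTensor _ τ) +
      TensorProduct.rid K _ ((Finsupp.lapply leaf : (PTree deg →₀ K) →ₗ[K] K).lTensor _ τ) ⊗ₜ
        Finsupp.single leaf 1 -
      (TensorProduct.lid K _ ((Finsupp.lapply leaf : (PTree deg →₀ K) →ₗ[K] K).rTensor _ τ)) leaf •
        (Finsupp.single leaf 1 ⊗ₜ Finsupp.single leaf 1) := by
  induction τ using TensorProduct.induction_on with
  | zero => simp
  | add a b ha hb =>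
    conv_lhs => rw [ha, hb]
    simp only [map_add, TensorProduct.tmul_add, TensorProduct.add_tmul, Finsupp.add_apply, add_smul]
    abel
  | tmul a b =>
    simp only [TensorProduct.map_tmul, incl_dropLeaf, LinearMap.rTensor_tmul,
      LinearMap.lTensor_tmul, TensorProduct.lid_tmul, TensorProduct.rid_tmul,
      Finsupp.lapply_apply, TensorProduct.tmul_sub, TensorProduct.sub_tmul,
      TensorProduct.smul_tmul', TensorProduct.tmul_smul, Finsupp.smul_apply, smul_eq_mul,
      mul_smul, smul_sub]
    rw [smul_comm (b leaf) (a leaf)]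
    abel

theorem coprod_single (Θ : (X →₀ K) →ₗ[K] (X →₀ K) ⊗[K] (X →₀ K)) (t : NTree deg) :
    coprod Θ (Finsupp.single t 1) =
      TensorProduct.map (dropLeaf K deg) (dropLeaf K deg) (coprodPlus K Θ t.1) := by
  simp [coprod]

theorem coprod_eq (Θ : (X →₀ K) →ₗ[K] (X →₀ K) ⊗[K] (X →₀ K)) (z : TreeSpace K deg) :
    coprod Θ z =
      TensorProduct.map (dropLeaf K deg) (dropLeaf K deg) (coprodLin Θ (incl K deg z)) :=
  LinearMap.congr_fun (g := TensorProduct.map (dropLeaf K deg) (dropLeaf K deg) ∘ₗ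
      coprodLin Θ ∘ₗ incl K deg) (Finsupp.lhom_ext' fun t => LinearMap.ext_ring
    (by simp only [LinearMap.comp_apply, Finsupp.lsingle_apply, incl_single, coprod_single,
      coprodLin_single])) z

/-- The subspace of degree `n` of the tensor square of `K[T_∞, X]`. -/
def tensorHomog (K : Type*) [Field K] {X : Type*} (deg : X → ℕ) (n : ℕ) :
    Submodule K (TreeSpace K deg ⊗[K] TreeSpace K deg) :=
  Submodule.span K {w | ∃ a b : NTree deg, a.1.degree + b.1.degree = n ∧
    w = Finsupp.single a (1 : K) ⊗ₜ[K] Finsupp.single b (1 : K)}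

/-- The product `∘_i` with an index `i` in `ℤ`. -/
def graftInt (u : TreeSpace K deg) (i : ℤ) : TreeSpace K deg →ₗ[K] TreeSpace K deg :=
  if 0 ≤ i then graft K deg i.toNat u else 0

/-- The operation `a ⊗ b ↦ u ∘_i a ⊗ b + a ⊗ u ∘_(i - |a|) b`. -/
def graftTensor (u : TreeSpace K deg) (i : ℤ) :
    TreeSpace K deg ⊗[K] TreeSpace K deg →ₗ[K] TreeSpace K deg ⊗[K] TreeSpace K deg :=
  LinearMap.rTensor _ (graftInt u i) +
    TensorProduct.lift (Finsupp.linearCombination K fun a =>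
      TensorProduct.mk K _ _ (Finsupp.single a 1) ∘ₗ graftInt u (i - a.1.degree))

theorem graftTensor_tmul (u : TreeSpace K deg) (i : ℤ) (a : NTree deg) (b : TreeSpace K deg) :
    graftTensor u i (Finsupp.single a 1 ⊗ₜ b) =
      graftInt u i (Finsupp.single a 1) ⊗ₜ b +
        Finsupp.single a 1 ⊗ₜ graftInt u (i - a.1.degree) b := by
  simp [graftTensor]

theorem incl_graftInt (u : TreeSpace K deg) (i : ℤ) (w : TreeSpace K deg) :
    incl K deg (graftInt u i w) = graftLin (incl K deg u) i (incl K deg w) := by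
  refine LinearMap.congr_fun (f := incl K deg ∘ₗ graftInt u i)
    (g := graftLin (incl K deg u) i ∘ₗ incl K deg)
    (Finsupp.lhom_ext' fun w => LinearMap.ext_ring ?_) w
  simp only [LinearMap.comp_apply, Finsupp.lsingle_apply, incl_single]
  by_cases h : 0 ≤ i ∧ i ≤ w.1.degree
  · rw [graftLin_single_of_le _ h.1 h.2, graftInt, if_pos h.1]
    refine LinearMap.congr_fun (f := incl K deg ∘ₗ (graft K deg i.toNat).flip (Finsupp.single w 1))
      (g := (Finsupp.linearCombination K
        fun t => Finsupp.single (graftAt t i.toNat w.1) (1 : K)) ∘ₗ incl K deg)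
      (Finsupp.lhom_ext' fun t => LinearMap.ext_ring ?_) u
    simp only [LinearMap.comp_apply, Finsupp.lsingle_apply, incl_single, LinearMap.flip_apply,
      Finsupp.linearCombination_single, one_smul]
    rw [graft_single_of_le (by omega), incl_single, graftTree]
  · rw [graftLin_single_of_not _ h, graftInt]
    split_ifs with h'
    · have : graft K deg i.toNat u (Finsupp.single w 1) = 0 := by
        refine LinearMap.congr_fun (f := (graft K deg i.toNat).flip (Finsupp.single w 1)) (g := 0)
          (Finsupp.lhom_ext' fun t => LinearMap.ext_ring ?_) u
        simp only [LinearMap.comp_apply, Finsupp.lsingle_apply, LinearMap.flip_apply]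
        rw [graft_single, if_neg (by omega)]
        rfl
      rw [this, map_zero]
    · simp

theorem graftTensor_map_incl (u : TreeSpace K deg) (i : ℤ)
    (τ : TreeSpace K deg ⊗[K] TreeSpace K deg) :
    PTree.graftTensor (incl K deg u) i (TensorProduct.map (incl K deg) (incl K deg) τ) =
      TensorProduct.map (incl K deg) (incl K deg) (graftTensor u i τ) := by
  refine LinearMap.congr_fun
    (f := PTree.graftTensor (incl K deg u) i ∘ₗ TensorProduct.map (incl K deg) (incl K deg))
    (g := TensorProduct.map (incl K deg) (incl K deg) ∘ₗ graftTensor u i)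
    (TensorProduct.ext (Finsupp.lhom_ext' fun a => LinearMap.ext_ring (LinearMap.ext fun b => ?_))) τ
  simp only [LinearMap.compr₂ₛₗ_apply, LinearMap.comp_apply, Finsupp.lsingle_apply,
    TensorProduct.mk_apply, TensorProduct.map_tmul, incl_single, graftTensor_tmul, map_add,
    PTree.graftTensor_tmul, incl_graftInt]

section coproduct

variable (hdeg : ∀ x, 0 < deg x) {Θ : (X →₀ K) →ₗ[K] (X →₀ K) ⊗[K] (X →₀ K)}
  (hΘ : IsGradedCoproduct deg Θ)

include hdeg hΘ

theorem coprodPlus_eq (t : NTree deg) : coprodPlus K Θ t.1 =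
    TensorProduct.map (incl K deg) (incl K deg) (coprod Θ (Finsupp.single t 1)) +
      Finsupp.single leaf 1 ⊗ₜ Finsupp.single t.1 1 +
      Finsupp.single t.1 1 ⊗ₜ Finsupp.single leaf 1 := by
  rw [map_incl_dropLeaf (coprodPlus K Θ t.1), counit_left hdeg hΘ, counit_right hdeg hΘ,
    coprod_single, Finsupp.single_eq_of_ne' t.2, zero_smul]
  exact sub_zero (G := (PTree deg →₀ K) ⊗[K] (PTree deg →₀ K)) _

theorem coprodLin_incl (z : TreeSpace K deg) : coprodLin Θ (incl K deg z) =
    TensorProduct.map (incl K deg) (incl K deg) (coprod Θ z) +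
      Finsupp.single leaf 1 ⊗ₜ incl K deg z + incl K deg z ⊗ₜ Finsupp.single leaf 1 :=
  LinearMap.congr_fun (f := coprodLin Θ ∘ₗ incl K deg)
    (g := TensorProduct.map (incl K deg) (incl K deg) ∘ₗ coprod Θ +
      TensorProduct.mk K _ _ (Finsupp.single leaf 1) ∘ₗ incl K deg +
      (TensorProduct.mk K _ _).flip (Finsupp.single leaf 1) ∘ₗ incl K deg)
    (Finsupp.lhom_ext' fun t => LinearMap.ext_ring (by
      simp only [LinearMap.comp_apply, Finsupp.lsingle_apply, LinearMap.add_apply, incl_single,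
        LinearMap.flip_apply, TensorProduct.mk_apply, coprodLin_single]
      exact coprodPlus_eq hdeg hΘ t)) z

/-- The terms | ⊗ w and w ⊗ | of Δ_+(w) produce u ⊗ w and w ⊗ u, when the graft hits the leaf of
`|`, that is for i = 0 and i = |w| respectively. -/
theorem coprod_graft_single {u : TreeSpace K deg} (hu : u ∈ primitives deg Θ) (i : ℕ)
    (w : NTree deg) :
    coprod Θ (graft K deg i u (Finsupp.single w 1)) =
      (if i = w.1.degree then Finsupp.single w 1 ⊗ₜ u else 0) +
      (if i = 0 then u ⊗ₜ Finsupp.single w 1 else 0) +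
      graftTensor u i (coprod Θ (Finsupp.single w 1)) := by
  have hu : coprod Θ u = 0 := hu
  have hu' := coprodLin_incl hdeg hΘ u
  rw [hu, map_zero, zero_add, add_comm] at hu'
  have hg : graft K deg i u (Finsupp.single w 1) = graftInt u i (Finsupp.single w 1) := by
    simp [graftInt]
  rw [hg, coprod_eq, incl_graftInt, incl_single, coprodLin_graftLin hdeg hΘ hu',
    coprodPlus_eq hdeg hΘ]
  simp only [map_add, PTree.graftTensor_tmul, graftTensor_map_incl, map_dropLeaf_incl,
    graftLin_leaf, degree_leaf]
  have e1 : ((i : ℤ) = 0) = (i = 0) := by simp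
  have e2 : ((i : ℤ) - w.1.degree = 0) = (i = w.1.degree) := by
    rw [sub_eq_zero, Nat.cast_inj]
  simp only [← incl_single (K := K), ← incl_graftInt, dropLeaf_incl, apply_ite (dropLeaf K deg),
    map_zero, Nat.cast_zero, sub_zero, TensorProduct.map_tmul, dropLeaf_leaf, e1, e2,
    TensorProduct.zero_tmul, TensorProduct.tmul_zero, add_zero, zero_add]
  split_ifs <;>
    (try simp only [TensorProduct.tmul_zero, TensorProduct.zero_tmul, add_zero, zero_add]) <;> abel

theorem coprod_single_mem (t : NTree deg) :
    coprod Θ (Finsupp.single t 1) ∈ tensorHomog K deg t.1.degree := by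
  rw [coprod_single]
  have h : PTree.tensorHomog K deg t.1.degree ≤ (tensorHomog K deg t.1.degree).comap
      (TensorProduct.map (dropLeaf K deg) (dropLeaf K deg)) := by
    refine Submodule.span_le.2 ?_
    rintro _ ⟨a, b, hab, rfl⟩
    simp only [Submodule.comap_coe, Set.mem_preimage, TensorProduct.map_tmul, SetLike.mem_coe]
    by_cases ha : a = leaf
    · rw [ha, dropLeaf_leaf, TensorProduct.zero_tmul]
      exact zero_mem _
    by_cases hb : b = leaf
    · rw [hb, dropLeaf_leaf, TensorProduct.tmul_zero]
      exact zero_mem _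
    rw [dropLeaf_single ⟨a, ha⟩, dropLeaf_single ⟨b, hb⟩]
    exact Submodule.subset_span ⟨⟨a, ha⟩, ⟨b, hb⟩, hab, rfl⟩
  exact h (coprodPlus_mem hdeg hΘ t.1)

theorem coprod_mem {n : ℕ} {z : TreeSpace K deg} (hz : z ∈ homog K deg n) :
    coprod Θ z ∈ tensorHomog K deg n :=
  map_homog_mem (f := coprod Θ) (fun t ht => ht ▸ coprod_single_mem hdeg hΘ t) hz

end coproduct

end TreeSpace

end

/-! ### The map `e` and the primitivity of Prim_gr(X) -/

noncomputable section

namespace TreeSpace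

open PTree

variable {K : Type*} [Field K] {X : Type*} {deg : X → ℕ}

theorem eqOn_tensorHomog {M : Type*} [AddCommMonoid M] [Module K M] {n : ℕ}
    {f g : TreeSpace K deg ⊗[K] TreeSpace K deg →ₗ[K] M}
    (h : ∀ a b : NTree deg, a.1.degree + b.1.degree = n →
      f (Finsupp.single a 1 ⊗ₜ Finsupp.single b 1) = g (Finsupp.single a 1 ⊗ₜ Finsupp.single b 1))
    {τ : TreeSpace K deg ⊗[K] TreeSpace K deg} (hτ : τ ∈ tensorHomog K deg n) : f τ = g τ := by
  refine LinearMap.eqOn_span (f := f) (g := g) ?_ hτ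
  rintro _ ⟨a, b, hab, rfl⟩
  exact h a b hab

theorem map_tensorHomog_mem {M : Type*} [AddCommMonoid M] [Module K M] {n : ℕ}
    {f : TreeSpace K deg ⊗[K] TreeSpace K deg →ₗ[K] M} {S : Submodule K M}
    (h : ∀ a b : NTree deg, a.1.degree + b.1.degree = n →
      f (Finsupp.single a 1 ⊗ₜ Finsupp.single b 1) ∈ S)
    {τ : TreeSpace K deg ⊗[K] TreeSpace K deg} (hτ : τ ∈ tensorHomog K deg n) : f τ ∈ S := by
  have : tensorHomog K deg n ≤ S.comap f := by
    refine Submodule.span_le.2 ?_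
    rintro _ ⟨a, b, hab, rfl⟩
    exact h a b hab
  exact this hτ

theorem graft_eq_zero {i n : ℕ} (x : TreeSpace K deg) {y : TreeSpace K deg}
    (hy : y ∈ homog K deg n) (h : n < i) : graft K deg i x y = 0 := by
  refine eqOn_homog (f := graft K deg i x) (g := 0) (fun w hw => ?_) hy
  refine LinearMap.congr_fun (f := (graft K deg i).flip (Finsupp.single w 1)) (g := 0)
    (Finsupp.lhom_ext' fun t => LinearMap.ext_ring ?_) x
  simp only [LinearMap.comp_apply, Finsupp.lsingle_apply, LinearMap.flip_apply,
    LinearMap.zero_apply]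
  rw [graft_single, if_neg (by omega)]

/-- The product `∘_0` as a map on the tensor square. -/
def mul (K : Type*) [Field K] {X : Type*} (deg : X → ℕ) :
    TreeSpace K deg ⊗[K] TreeSpace K deg →ₗ[K] TreeSpace K deg :=
  TensorProduct.lift (graft K deg 0)

theorem mul_tmul (x y : TreeSpace K deg) : mul K deg (x ⊗ₜ y) = graft K deg 0 x y := by
  simp [mul]

/-- The linear map that sends `x` to the tree with a single vertex, coloured by `x`. -/
def corollaLin (K : Type*) [Field K] {X : Type*} (deg : X → ℕ) : (X →₀ K) →ₗ[K] TreeSpace K deg :=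
  Finsupp.linearCombination K (corolla K deg)

theorem corollaLin_single (x : X) : corollaLin K deg (Finsupp.single x 1) = corolla K deg x := by
  simp [corollaLin]

theorem corolla_mem_homog (x : X) : corolla K deg x ∈ homog K deg (deg x) :=
  single_mem_homog (by simp [degree]) 1

/-- The map `z ↦ ∑_t z_t • (u ∘_|t| t)`. -/
def graftLast (u : TreeSpace K deg) : TreeSpace K deg →ₗ[K] TreeSpace K deg :=
  Finsupp.linearCombination K fun t => graft K deg t.1.degree u (Finsupp.single t 1)

theorem graftLast_single (u : TreeSpace K deg) (t : NTree deg) :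
    graftLast u (Finsupp.single t 1) = graft K deg t.1.degree u (Finsupp.single t 1) := by
  simp [graftLast]

theorem bracket_eq_graftLast (x y : TreeSpace K deg) :
    bracket K deg x y = graftLast y x - graft K deg 0 x y := by
  refine LinearMap.congr_fun (f := (bracket K deg).flip y)
    (g := graftLast y - (graft K deg 0).flip y)
    (Finsupp.lhom_ext' fun t => LinearMap.ext_ring ?_) x
  simp only [LinearMap.comp_apply, Finsupp.lsingle_apply, LinearMap.flip_apply,
    LinearMap.sub_apply, graftLast_single]
  exact bracket_eq y (single_mem_homog rfl 1)

section coproduct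

variable (hdeg : ∀ x, 0 < deg x) {Θ : (X →₀ K) →ₗ[K] (X →₀ K) ⊗[K] (X →₀ K)}
  (hΘ : IsGradedCoproduct deg Θ)

include hdeg

theorem eq_zero_of_mem_homog_zero {z : TreeSpace K deg} (hz : z ∈ homog K deg 0) : z = 0 := by
  refine eqOn_homog (f := LinearMap.id) (g := 0) (fun t ht => ?_) hz
  have := degree_pos hdeg t.2
  omega

include hΘ

/-- Each coproduct strictly lowers the degree of the left factor, as all trees here have positive
degree. -/
theorem iterProd_eq_zero {r n : ℕ} (h : n ≤ r) {z : TreeSpace K deg} (hz : z ∈ homog K deg n) :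
    iterProd Θ r z = 0 := by
  induction r generalizing n z with
  | zero =>
    obtain rfl : n = 0 := by omega
    exact eq_zero_of_mem_homog_zero hdeg hz
  | succ r ih =>
    refine eqOn_tensorHomog (f := mul K deg ∘ₗ (iterProd Θ r).rTensor _) (g := 0)
      (fun a b hab => ?_) (coprod_mem hdeg hΘ hz)
    have := degree_pos hdeg b.2
    rw [LinearMap.comp_apply, LinearMap.rTensor_tmul, ih (n := a.1.degree) (by omega)
      (single_mem_homog rfl 1), TensorProduct.zero_tmul, map_zero, LinearMap.zero_apply]

theorem iterProd_mem_homog (r : ℕ) {n : ℕ} {z : TreeSpace K deg} (hz : z ∈ homog K deg n) :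
    iterProd Θ r z ∈ homog K deg n := by
  induction r generalizing n z with
  | zero => exact hz
  | succ r ih =>
    refine map_tensorHomog_mem (f := mul K deg ∘ₗ (iterProd Θ r).rTensor _)
      (fun a b hab => ?_) (coprod_mem hdeg hΘ hz)
    rw [LinearMap.comp_apply, LinearMap.rTensor_tmul, mul_tmul, ← hab]
    exact graft_mem_homog (ih (single_mem_homog rfl 1)) (single_mem_homog rfl 1)

theorem eMap_eq_sum {n N : ℕ} (h : n ≤ N) {z : TreeSpace K deg} (hz : z ∈ homog K deg n) :
    eMap Θ z = ∑ r ∈ Finset.range N, (-1 : K) ^ r • iterProd Θ r z := by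
  have : eMap Θ z = (∑ r ∈ Finset.range N, (-1 : K) ^ r • iterProd (deg := deg) Θ r) z := by
    refine eqOn_homog (fun t ht => ?_) hz
    rw [LinearMap.sum_apply, ← Finset.sum_range_add_sum_Ico _ h, Finset.sum_eq_zero (s := Finset.Ico n N)]
    · simp [eMap, ht]
    · intro r hr
      rw [LinearMap.smul_apply, iterProd_eq_zero hdeg hΘ (Finset.mem_Ico.1 hr).1
        (single_mem_homog ht 1), smul_zero]
  rw [this]
  simp

theorem eMap_mem_homog {n : ℕ} {z : TreeSpace K deg} (hz : z ∈ homog K deg n) :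
    eMap Θ z ∈ homog K deg n := by
  rw [eMap_eq_sum hdeg hΘ le_rfl hz]
  exact sum_mem fun r _ => Submodule.smul_mem _ _ (iterProd_mem_homog hdeg hΘ r hz)

/-- Splitting off the last factor of the iterated coproducts gives e = id - e ⋆ id for the
convolution defined by ∘_0. The action of `e` on primitives, on products u ∘_0 z and on corollas is
derived from this recursion. -/
theorem eMap_eq (z : TreeSpace K deg) :
    eMap Θ z = z - mul K deg ((eMap Θ).rTensor _ (coprod Θ z)) := by
  refine LinearMap.congr_fun
    (g := LinearMap.id - mul K deg ∘ₗ (eMap Θ).rTensor _ ∘ₗ coprod Θ)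
    (Finsupp.lhom_ext' fun t => LinearMap.ext_ring ?_) z
  simp only [LinearMap.comp_apply, Finsupp.lsingle_apply, LinearMap.sub_apply, LinearMap.id_apply]
  -- The left factors in the coproduct of `t` have degree at most `m = |t| - 1`, so `m` terms of the
  -- series suffice for them; they become the terms `1, …, m` of the series for `t`.
  obtain ⟨m, hm⟩ : ∃ m, t.1.degree = m + 1 :=
    ⟨t.1.degree - 1, by have := degree_pos hdeg t.2; omega⟩
  have h : mul K deg ((eMap Θ).rTensor _ (coprod Θ (Finsupp.single t 1))) =
      mul K deg ((∑ r ∈ Finset.range m, (-1 : K) ^ r • iterProd (deg := deg) Θ r).rTensor _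
        (coprod Θ (Finsupp.single t 1))) := by
    refine eqOn_tensorHomog (f := mul K deg ∘ₗ (eMap Θ).rTensor _)
      (g := mul K deg ∘ₗ (∑ r ∈ Finset.range m, (-1 : K) ^ r • iterProd (deg := deg) Θ r).rTensor _)
      (fun a b hab => ?_) (coprod_single_mem hdeg hΘ t)
    have := degree_pos hdeg b.2
    rw [LinearMap.comp_apply, LinearMap.comp_apply, LinearMap.rTensor_tmul,
      LinearMap.rTensor_tmul, eMap_eq_sum hdeg hΘ (n := a.1.degree) (N := m) (by omega)
        (single_mem_homog rfl 1), LinearMap.sum_apply]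
    simp only [LinearMap.smul_apply]
  rw [h, eMap_eq_sum hdeg hΘ (n := m + 1) le_rfl (single_mem_homog hm 1), Finset.sum_range_succ',
    ← LinearMap.comp_apply, ← LinearMap.comp_apply, sub_eq_add_neg, add_comm]
  congr 1
  · simp [iterProd]
  · rw [← LinearMap.coe_rTensorHom, map_sum]
    simp only [map_smul, LinearMap.comp_apply, LinearMap.sum_apply, map_sum, LinearMap.smul_apply,
      LinearMap.coe_rTensorHom]
    rw [← Finset.sum_neg_distrib]
    refine Finset.sum_congr rfl fun r _ => ?_
    rw [pow_succ, mul_neg_one, neg_smul]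
    rfl

theorem eMap_of_mem_primitives {z : TreeSpace K deg} (hz : z ∈ primitives deg Θ) :
    eMap Θ z = z := by
  have hz' : coprod Θ z = 0 := hz
  rw [eMap_eq hdeg hΘ, hz', map_zero, map_zero, sub_zero]

theorem coprod_graft_zero {u : TreeSpace K deg} (hu : u ∈ primitives deg Θ)
    (z : TreeSpace K deg) : coprod Θ (graft K deg 0 u z) =
      u ⊗ₜ z + (graft K deg 0 u).rTensor _ (coprod Θ z) := by
  refine LinearMap.congr_fun (f := coprod Θ ∘ₗ graft K deg 0 u)
    (g := TensorProduct.mk K _ _ u + (graft K deg 0 u).rTensor _ ∘ₗ coprod Θ)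
    (Finsupp.lhom_ext' fun t => LinearMap.ext_ring ?_) z
  simp only [LinearMap.comp_apply, Finsupp.lsingle_apply, LinearMap.add_apply,
    TensorProduct.mk_apply]
  have ht := degree_pos hdeg t.2
  rw [coprod_graft_single hdeg hΘ hu, if_neg (by omega), if_pos rfl, zero_add]
  congr 1
  -- The right factor would receive `u` at the negative index `-|a|`, hence contributes nothing.
  refine eqOn_tensorHomog (f := graftTensor u ((0 : ℕ) : ℤ)) (fun a b hab => ?_)
    (coprod_single_mem hdeg hΘ t)
  have ha := degree_pos hdeg a.2
  have h0 : graftInt u (((0 : ℕ) : ℤ) - a.1.degree) = 0 := by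
    rw [graftInt, if_neg (by omega)]
  rw [graftTensor_tmul, h0, LinearMap.zero_apply, TensorProduct.tmul_zero, add_zero,
    LinearMap.rTensor_tmul]
  simp [graftInt]

/-- In e(u ∘_0 z) = u ∘_0 z - e(u) ∘_0 z - ∑ e(u ∘_0 z_(1)) ∘_0 z_(2), the first two terms cancel
because e(u) = u, and the sum vanishes by induction on the degree. -/
theorem eMap_graft_zero {u : TreeSpace K deg} (hu : u ∈ primitives deg Θ)
    (z : TreeSpace K deg) : eMap Θ (graft K deg 0 u z) = 0 := by
  have key : ∀ n, ∀ z ∈ homog K deg n, eMap Θ (graft K deg 0 u z) = 0 := by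
    intro n
    induction n using Nat.strong_induction_on with
    | _ n ih =>
    intro z hz
    rw [eMap_eq hdeg hΘ, coprod_graft_zero hdeg hΘ hu, map_add, map_add, LinearMap.rTensor_tmul,
      mul_tmul, eMap_of_mem_primitives hdeg hΘ hu, sub_add_cancel_left, neg_eq_zero]
    refine eqOn_tensorHomog (f := mul K deg ∘ₗ (eMap Θ).rTensor _ ∘ₗ (graft K deg 0 u).rTensor _)
      (g := 0) (fun a b hab => ?_) (coprod_mem hdeg hΘ hz)
    have hb := degree_pos hdeg b.2
    rw [LinearMap.comp_apply, LinearMap.comp_apply, LinearMap.rTensor_tmul, LinearMap.rTensor_tmul,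
      ih a.1.degree (by omega) _ (single_mem_homog rfl 1), TensorProduct.zero_tmul, map_zero,
      LinearMap.zero_apply]
  refine LinearMap.congr_fun (f := eMap Θ ∘ₗ graft K deg 0 u) (g := 0)
    (Finsupp.lhom_ext' fun t => LinearMap.ext_ring ?_) z
  exact key _ _ (single_mem_homog rfl 1)

theorem coprod_graftLast {u : TreeSpace K deg} (hu : u ∈ primitives deg Θ)
    (z : TreeSpace K deg) : coprod Θ (graftLast u z) =
      z ⊗ₜ u + (graftLast u).lTensor _ (coprod Θ z) := by
  refine LinearMap.congr_fun (f := coprod Θ ∘ₗ graftLast u)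
    (g := (TensorProduct.mk K _ _).flip u + (graftLast u).lTensor _ ∘ₗ coprod Θ)
    (Finsupp.lhom_ext' fun t => LinearMap.ext_ring ?_) z
  simp only [LinearMap.comp_apply, Finsupp.lsingle_apply, LinearMap.add_apply,
    TensorProduct.mk_apply, LinearMap.flip_apply, graftLast_single]
  have ht := degree_pos hdeg t.2
  rw [coprod_graft_single hdeg hΘ hu, if_pos rfl, if_neg (by omega), add_zero]
  congr 1
  refine eqOn_tensorHomog (f := graftTensor u (t.1.degree : ℤ)) (fun a b hab => ?_)
    (coprod_single_mem hdeg hΘ t)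
  have hb := degree_pos hdeg b.2
  -- Here the index `|t|` exceeds `|a|`, so the left factor contributes nothing and `u` lands on the
  -- last leaf of `b`.
  rw [graftTensor_tmul, graftInt, if_pos (by omega), Int.toNat_natCast,
    graft_eq_zero u (single_mem_homog (rfl : a.1.degree = _) 1) (by omega), TensorProduct.zero_tmul, zero_add,
    LinearMap.lTensor_tmul, graftLast_single, graftInt, if_pos (by omega),
    show ((t.1.degree : ℤ) - a.1.degree).toNat = b.1.degree by omega]

/-- For primitive x and y, both y ∘_|x| x and x ∘_0 y have coproduct x ⊗ y. For 1 ≤ p < n the graft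
avoids the two extreme leaves and no boundary term appears. -/
theorem isPrimGrClosed_primitives : IsPrimGrClosed (primitives deg Θ) where
  bracket_mem x hx y hy := by
    have hx' : coprod Θ x = 0 := hx
    have hy' : coprod Θ y = 0 := hy
    change coprod Θ _ = 0
    rw [bracket_eq_graftLast, map_sub, coprod_graftLast hdeg hΘ hy, coprod_graft_zero hdeg hΘ hx,
      hx', hy', map_zero, map_zero, sub_self]
  graft_mem p n h1 hp x hx y hy hyn := by
    have hy' : coprod Θ y = 0 := hy
    change coprod Θ _ = 0
    have : coprod Θ (graft K deg p x y) = graftTensor x p (coprod Θ y) := by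
      refine eqOn_homog (f := coprod Θ ∘ₗ graft K deg p x)
        (g := graftTensor x p ∘ₗ coprod Θ) (fun w hw => ?_) hyn
      simp only [LinearMap.comp_apply]
      rw [coprod_graft_single hdeg hΘ hx, if_neg (by omega), if_neg (by omega), zero_add, zero_add]
    rw [this, hy', map_zero]

/-- The two extreme cuts of a corolla have a factor `|` and disappear; the others reproduce `Θ x`.
-/
theorem coprod_corolla (x : X) : coprod Θ (corolla K deg x) =
    TensorProduct.map (corollaLin K deg) (corollaLin K deg) (Θ (Finsupp.single x 1)) := by
  have e : PTree.node (deg := deg) x (fun _ => leaf) = nodeN x fun _ => leaf := rfl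
  have h : ∀ x : X, dropLeaf K deg (Finsupp.single (nodeN x fun _ => leaf) 1) =
      corolla K deg x :=
    fun x => dropLeaf_single (K := K) (⟨nodeN x fun _ => leaf, nodeN_ne_leaf x _⟩ : NTree deg)
  rw [corolla, coprod_single]
  simp only [e]
  rw [coprodPlus_nodeN]
  simp only [map_add, coprodPlus, cut_single, TensorProduct.map_tmul, dropLeaf_leaf,
    TensorProduct.zero_tmul, TensorProduct.tmul_zero, zero_add]
  refine LinearMap.eqOn_span (f := TensorProduct.map (dropLeaf K deg) (dropLeaf K deg) ∘ₗ
    middle Θ x fun _ => leaf) (g := TensorProduct.map (corollaLin K deg) (corollaLin K deg))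
    ?_ (hΘ x)
  rintro _ ⟨y, z, hyz, rfl⟩
  rw [LinearMap.comp_apply, middle_tmul Θ _ hyz (hdeg y) (hdeg z), coprodPlus, cut_single,
    TensorProduct.map_tmul, TensorProduct.map_tmul, corollaLin_single, corollaLin_single,
    leftN, rightN]
  simp only [ite_self, h]

theorem eMap_corollaLin : eMap Θ ∘ₗ corollaLin K deg =
    corollaLin K deg - mul K deg ∘ₗ
      TensorProduct.map (eMap Θ ∘ₗ corollaLin K deg) (corollaLin K deg) ∘ₗ Θ := by
  refine Finsupp.lhom_ext' fun x => LinearMap.ext_ring ?_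
  simp only [LinearMap.comp_apply, Finsupp.lsingle_apply, LinearMap.sub_apply, corollaLin_single]
  rw [eMap_eq hdeg hΘ, coprod_corolla hdeg hΘ, ← LinearMap.comp_apply (LinearMap.rTensor _ _),
    LinearMap.rTensor_comp_map]

/-- Write c for the corolla map and m for ∘_0, so that e = c - m(e ⊗ c)Θ on generators. By induction
e(x_(1)) is primitive, so Δ of ∑ e(x_(1)) ∘_0 c(x_(2)) is (e ⊗ c)Θ(x) plus the sum of (e(x_(1)) ∘_0
c(x_(2))) ⊗ c(x_(3)). By coassociativity this last sum is (m(e ⊗ c)Θ ⊗ c)Θ(x) = ((c - e) ⊗ c)Θ(x).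
The total is (c ⊗ c)Θ(x) = Δ(c(x)), and the difference is zero. -/
theorem eMap_corolla_mem_primitives (hΘ' : IsCoassociative Θ) (x : X) :
    eMap Θ (corolla K deg x) ∈ primitives deg Θ := by
  obtain ⟨n, hn⟩ : ∃ n, deg x = n := ⟨_, rfl⟩
  induction n using Nat.strong_induction_on generalizing x with
  | _ n ih =>
  set c := corollaLin K deg with hc
  set e := eMap Θ ∘ₗ c with he
  have hec := eMap_corollaLin hdeg hΘ
  rw [← hc, ← he] at hec
  have h1 : coprod Θ (mul K deg (TensorProduct.map e c (Θ (Finsupp.single x 1)))) =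
      TensorProduct.map e c (Θ (Finsupp.single x 1)) +
      (mul K deg).rTensor _ ((TensorProduct.assoc K _ _ _).symm (TensorProduct.map e
        (TensorProduct.map c c) (Θ.lTensor _ (Θ (Finsupp.single x 1))))) := by
    refine LinearMap.eqOn_span (f := coprod Θ ∘ₗ mul K deg ∘ₗ TensorProduct.map e c)
      (g := TensorProduct.map e c + (mul K deg).rTensor _ ∘ₗ
        (TensorProduct.assoc K _ _ _).symm.toLinearMap ∘ₗ TensorProduct.map e
        (TensorProduct.map c c) ∘ₗ Θ.lTensor _) ?_ (hΘ x)
    rintro _ ⟨y, z, hyz, rfl⟩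
    have hz := hdeg z
    have hy : e (Finsupp.single y 1) ∈ primitives deg Θ := by
      rw [he, LinearMap.comp_apply, hc, corollaLin_single]
      exact ih (deg y) (by omega) y rfl
    simp only [LinearMap.comp_apply, LinearMap.add_apply, TensorProduct.map_tmul, mul_tmul,
      LinearMap.lTensor_tmul, LinearEquiv.coe_coe]
    rw [coprod_graft_zero hdeg hΘ hy, hc, corollaLin_single, coprod_corolla hdeg hΘ, ← hc]
    congr 1
    generalize TensorProduct.map c c (Θ (Finsupp.single z 1)) = τ
    induction τ using TensorProduct.induction_on with
    | zero => simp
    | add a b ha hb => simp only [map_add, TensorProduct.tmul_add, ha, hb]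
    | tmul a b => simp [mul_tmul]
  have h2 : ∀ τ : ((X →₀ K) ⊗[K] (X →₀ K)) ⊗[K] (X →₀ K),
      (mul K deg).rTensor _ ((TensorProduct.assoc K _ _ _).symm (TensorProduct.map e
        (TensorProduct.map c c) (TensorProduct.assoc K _ _ _ τ))) =
      TensorProduct.map (mul K deg ∘ₗ TensorProduct.map e c) c τ := by
    intro τ
    refine LinearMap.congr_fun (f := (mul K deg).rTensor _ ∘ₗ
        (TensorProduct.assoc K _ _ _).symm.toLinearMap ∘ₗ TensorProduct.map e
        (TensorProduct.map c c) ∘ₗ (TensorProduct.assoc K _ _ _).toLinearMap)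
      (TensorProduct.ext_threefold fun a b d => ?_) τ
    simp
  have h3 : Θ.lTensor _ (Θ (Finsupp.single x 1)) =
      TensorProduct.assoc K _ _ _ (Θ.rTensor _ (Θ (Finsupp.single x 1))) :=
    (LinearMap.congr_fun hΘ' (Finsupp.single x 1)).symm
  have h4 : mul K deg ∘ₗ TensorProduct.map e c ∘ₗ Θ = c - e := by
    conv_rhs => rw [hec]
    exact (sub_sub_cancel c (mul K deg ∘ₗ TensorProduct.map e c ∘ₗ Θ)).symm
  have h5 : ∀ τ : (X →₀ K) ⊗[K] (X →₀ K),
      TensorProduct.map (mul K deg ∘ₗ TensorProduct.map e c) c (Θ.rTensor _ τ) =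
      TensorProduct.map c c τ - TensorProduct.map e c τ := by
    intro τ
    rw [← LinearMap.comp_apply, LinearMap.map_comp_rTensor, LinearMap.comp_assoc, h4]
    induction τ using TensorProduct.induction_on with
    | zero => simp
    | add a b ha hb =>
      simp only [map_add, ha, hb]
      abel
    | tmul a b => simp [TensorProduct.sub_tmul]
  change coprod Θ _ = 0
  rw [eMap_eq hdeg hΘ, coprod_corolla hdeg hΘ, ← LinearMap.comp_apply (LinearMap.rTensor _ _),
    LinearMap.rTensor_comp_map, ← hc, ← he, map_sub, h1, h3, h2, coprod_corolla hdeg hΘ, ← hc, h5]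
  abel

theorem primGr_le_primitives (hΘ' : IsCoassociative Θ) : PrimGr deg Θ ≤ primitives deg Θ :=
  sInf_le ⟨eMap_corolla_mem_primitives hdeg hΘ hΘ', isPrimGrClosed_primitives hdeg hΘ⟩

end coproduct

end TreeSpace

end

/-! ### Every primitive element lies in Prim_gr(X) -/

noncomputable section

namespace TreeSpace

open PTree

variable {K : Type*} [Field K] {X : Type*} {deg : X → ℕ}

theorem isPrimGrClosed_primGr (deg : X → ℕ) (Θ : (X →₀ K) →ₗ[K] (X →₀ K) ⊗[K] (X →₀ K)) :
    IsPrimGrClosed (PrimGr deg Θ) where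
  bracket_mem x hx y hy := Submodule.mem_sInf.2 fun S hS =>
    hS.2.bracket_mem x (Submodule.mem_sInf.1 hx S hS) y (Submodule.mem_sInf.1 hy S hS)
  graft_mem p n h1 hp x hx y hy hyn := Submodule.mem_sInf.2 fun S hS =>
    hS.2.graft_mem p n h1 hp x (Submodule.mem_sInf.1 hx S hS) y (Submodule.mem_sInf.1 hy S hS) hyn

/-- The decomposable elements of degree `n` for the product `∘_0`. -/
def decomposables (K : Type*) [Field K] {X : Type*} (deg : X → ℕ) (n : ℕ) :
    Submodule K (TreeSpace K deg) :=
  Submodule.span K {w | ∃ i j, i + j = n ∧ 0 < i ∧ 0 < j ∧ ∃ a ∈ homog K deg i,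
    ∃ b ∈ homog K deg j, w = graft K deg 0 a b}

/-- The sum of the component of degree `n` of `Prim_gr(X)` and of the decomposable elements of
degree `n`. -/
def primOrDecomposable (deg : X → ℕ) (Θ : (X →₀ K) →ₗ[K] (X →₀ K) ⊗[K] (X →₀ K)) (n : ℕ) :
    Submodule K (TreeSpace K deg) :=
  (PrimGr deg Θ ⊓ homog K deg n) ⊔ decomposables K deg n

/-- The component of degree `n` of the right ideal for `∘_0` generated by `Prim_gr(X)`. -/
def primIdeal (deg : X → ℕ) (Θ : (X →₀ K) →ₗ[K] (X →₀ K) ⊗[K] (X →₀ K)) (n : ℕ) :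
    Submodule K (TreeSpace K deg) :=
  (PrimGr deg Θ ⊓ homog K deg n) ⊔ Submodule.span K {w | ∃ i j, i + j = n ∧ 0 < i ∧ 0 < j ∧
    ∃ p ∈ PrimGr deg Θ ⊓ homog K deg i, ∃ a ∈ homog K deg j, w = graft K deg 0 p a}

/-- Since leaves `0, …, |a|` of a ∘_0 b carry the leaves of `a`, t ∘_k (a ∘_0 b) is (t ∘_k a) ∘_0 b
for k ≤ |a|, and a ∘_0 (t ∘_{k-|a|} b) otherwise. -/
theorem graft_decomposables {m n k : ℕ} {t d : TreeSpace K deg} (ht : t ∈ homog K deg m)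
    (hk : k ≤ n) (hd : d ∈ decomposables K deg n) :
    graft K deg k t d ∈ decomposables K deg (m + n) := by
  have : decomposables K deg n ≤ (decomposables K deg (m + n)).comap (graft K deg k t) := by
    refine Submodule.span_le.2 ?_
    rintro _ ⟨i, j, hij, hi, hj, a, ha, b, hb, rfl⟩
    rw [SetLike.mem_coe, Submodule.mem_comap]
    refine Submodule.subset_span ?_
    by_cases hki : k ≤ i
    · refine ⟨m + i, j, by omega, by omega, hj, _, graft_mem_homog (i := k) ht ha, b, hb, ?_⟩
      rw [graft_graft_left t ha hb hki (Nat.zero_le _), add_zero]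
    · refine ⟨i, m + j, by omega, hi, by omega, a, ha, _,
        graft_mem_homog (i := k - i) ht hb, ?_⟩
      rw [graft_comm t ha hb (by omega) (by omega), Nat.sub_add_cancel (by omega)]
  exact Submodule.mem_comap.1 (this hd)

section coproduct

variable (hdeg : ∀ x, 0 < deg x) {Θ : (X →₀ K) →ₗ[K] (X →₀ K) ⊗[K] (X →₀ K)}
  (hΘ : IsGradedCoproduct deg Θ)

include hdeg

/-- Only the last leaf k = n is not covered by closure, and there p ∘_n q = {q, p} + q ∘_0 p. -/
theorem graft_prim_mem {m n k : ℕ} {p z : TreeSpace K deg}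
    (hp : p ∈ PrimGr deg Θ ⊓ homog K deg m) (h1 : 1 ≤ k) (hk : k ≤ n)
    (hz : z ∈ primOrDecomposable deg Θ n) :
    graft K deg k p z ∈ primOrDecomposable deg Θ (m + n) := by
  obtain ⟨q, hq, d, hd, rfl⟩ := Submodule.mem_sup.1 hz
  rw [map_add]
  refine add_mem ?_ (Submodule.mem_sup_right (graft_decomposables hp.2 hk hd))
  rcases hk.lt_or_eq with hk | rfl
  · exact Submodule.mem_sup_left ⟨(isPrimGrClosed_primGr deg Θ).graft_mem k n h1 hk p hp.1 q hq.1
      hq.2, graft_mem_homog hp.2 hq.2⟩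
  · have h := bracket_eq p hq.2
    rw [eq_sub_iff_add_eq] at h
    rw [← h]
    rcases Nat.eq_zero_or_pos m with rfl | hm
    · rw [eq_zero_of_mem_homog_zero hdeg hp.2]
      simp
    have h1 : bracket K deg q p ∈ PrimGr deg Θ ⊓ homog K deg (m + k) := by
      rw [add_comm m k]
      exact ⟨(isPrimGrClosed_primGr deg Θ).bracket_mem q hq.1 p hp.1, bracket_mem_homog hq.2 hp.2⟩
    have h2 : graft K deg 0 q p ∈ decomposables K deg (m + k) :=
      Submodule.subset_span ⟨k, m, by omega, by omega, hm, q, hq.2, p, hp.2, rfl⟩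
    exact add_mem (Submodule.mem_sup_left h1) (Submodule.mem_sup_right h2)

/-- By hypothesis `t` is a combination of elements p and p ∘_0 a with p in Prim_gr(X); since (p ∘_0
a) ∘_k z = p ∘_k (a ∘_k z), induction on the degree of `t` reduces to `graft_prim_mem`. -/
theorem graft_mem_primOrDecomposable {N m n k : ℕ}
    (hN : ∀ m < N, homog K deg m ≤ primIdeal deg Θ m) (hm : m < N) {t z : TreeSpace K deg}
    (ht : t ∈ homog K deg m) (h1 : 1 ≤ k) (hk : k ≤ n) (hzn : z ∈ homog K deg n)
    (hz : z ∈ primOrDecomposable deg Θ n) :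
    graft K deg k t z ∈ primOrDecomposable deg Θ (m + n) := by
  induction m using Nat.strong_induction_on generalizing t with
  | _ m ih =>
  have : primIdeal deg Θ m ≤
      (primOrDecomposable deg Θ (m + n)).comap ((graft K deg k).flip z) := by
    refine sup_le (fun p hp => ?_) (Submodule.span_le.2 ?_)
    · rw [Submodule.mem_comap, LinearMap.flip_apply]
      exact graft_prim_mem hdeg hp h1 hk hz
    rintro _ ⟨i, j, rfl, hi, hj, p, hp, a, ha, rfl⟩
    rw [SetLike.mem_coe, Submodule.mem_comap, LinearMap.flip_apply, graft_graft_left p ha hzn (Nat.zero_le _) hk, zero_add, add_assoc]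
    exact graft_prim_mem hdeg hp h1 (by omega) (ih j (by omega) (by omega) ha)
  have h := this (hN m hm ht)
  rwa [Submodule.mem_comap, LinearMap.flip_apply] at h

include hΘ

theorem corolla_mem_primOrDecomposable (x : X) :
    corolla K deg x ∈ primOrDecomposable deg Θ (deg x) := by
  have h := eMap_eq hdeg hΘ (corolla K deg x)
  rw [eq_sub_iff_add_eq] at h
  rw [← h]
  refine add_mem (Submodule.mem_sup_left ⟨eMap_corolla_mem deg Θ x,
    eMap_mem_homog hdeg hΘ (corolla_mem_homog x)⟩) (Submodule.mem_sup_right ?_)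
  refine map_tensorHomog_mem (f := mul K deg ∘ₗ (eMap Θ).rTensor _) (fun a b hab => ?_)
    (coprod_mem hdeg hΘ (corolla_mem_homog x))
  rw [LinearMap.comp_apply, LinearMap.rTensor_tmul, mul_tmul]
  exact Submodule.subset_span ⟨_, _, hab, degree_pos hdeg a.2, degree_pos hdeg b.2, _,
    eMap_mem_homog hdeg hΘ (single_mem_homog rfl 1), _, single_mem_homog rfl 1, rfl⟩

/-- The tree is built from its corolla by grafting the children from right to left. When `C m` is
grafted, all children to its left are still leaves, so it goes on leaf number `m ≥ 1`. -/
theorem nodeN_mem_primOrDecomposable {N : ℕ}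
    (hN : ∀ m < N, homog K deg m ≤ primIdeal deg Θ m) (x : X) (C : ℕ → PTree deg)
    (hC : ∀ j ≤ deg x, degree (C j) < N) (h0 : C 0 = leaf) :
    Finsupp.single (⟨nodeN x C, nodeN_ne_leaf x C⟩ : NTree deg) (1 : K) ∈
      primOrDecomposable deg Θ (degree (nodeN x C)) := by
  have key : ∀ m, 1 ≤ m → m ≤ deg x + 1 →
      Finsupp.single (⟨nodeN x fun j => if m ≤ j then C j else leaf, nodeN_ne_leaf x _⟩ : NTree deg)
        (1 : K) ∈ primOrDecomposable deg Θ
          (degree (nodeN x fun j => if m ≤ j then C j else leaf)) := by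
    intro m h1 hm
    revert h1
    induction hm using Nat.decreasingInduction with
    | self =>
      intro _
      have e : (nodeN x fun j => if deg x + 1 ≤ j then C j else leaf) =
          PTree.node (deg := deg) x fun _ => leaf :=
        nodeN_congr (D := fun _ => leaf) fun j hj => if_neg (by omega)
      simp only [e]
      have := corolla_mem_primOrDecomposable hdeg hΘ x
      rwa [show deg x = degree (PTree.node (deg := deg) x fun _ => leaf) by simp [degree]] at this
    | of_succ m hm ih =>
      intro h1
      by_cases hl : C m = leaf
      · have e : (nodeN x fun j => if m ≤ j then C j else leaf) =
            nodeN x fun j => if m + 1 ≤ j then C j else leaf := by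
          refine nodeN_congr fun j hj => ?_
          rcases eq_or_ne j m with rfl | hjm
          · simp [hl]
          · simp [show m ≤ j ↔ m + 1 ≤ j by omega]
        simp only [e]
        exact ih (by omega)
      · have ho : offset (fun j => if m + 1 ≤ j then C j else leaf) m = m := by
          rw [offset, Finset.sum_congr rfl (g := fun _ => 1)]
          · simp
          · intro j hj
            have := Finset.mem_range.1 hj
            rw [if_neg (by omega), degree_leaf]
        have e : (nodeN x fun j => if m ≤ j then C j else leaf) =
            graftAt (C m) m (nodeN x fun j => if m + 1 ≤ j then C j else leaf) := by
          rw [graftAt_nodeN (k := m) _ (by omega) (by rw [ho]) (by rw [ho]; omega), ho,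
            Nat.sub_self, if_neg (by omega), graftAt_leaf]
          refine nodeN_congr fun j hj => ?_
          rcases eq_or_ne j m with rfl | hjm
          · simp
          · rw [Function.update_of_ne hjm]
            simp [show m ≤ j ↔ m + 1 ≤ j by omega]
        have hd : m ≤ degree (nodeN x fun j => if m + 1 ≤ j then C j else leaf) := by
          rw [nodeN, degree]
          omega
        have h := graft_mem_primOrDecomposable hdeg hN (hC m (by omega))
          (single_mem_homog (t := (⟨C m, hl⟩ : NTree deg)) rfl (1 : K)) h1 hd
          (single_mem_homog rfl 1) (ih (by omega))
        rw [graft_single_of_le hd, ← degree_graftAt _ hd] at h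
        simp only [graftTree] at h
        simp only [e]
        exact h
  have e : (nodeN x fun j => if 1 ≤ j then C j else leaf) = nodeN x C := by
    refine nodeN_congr fun j _ => ?_
    split_ifs with hj
    · rfl
    · rw [show j = 0 by omega, h0]
  have := key 1 le_rfl (by omega)
  simpa only [e] using this

theorem homog_le_primIdeal (n : ℕ) : homog K deg n ≤ primIdeal deg Θ n := by
  induction n using Nat.strong_induction_on with
  | _ n ih =>
  -- In a ∘_0 b the factor `a` has smaller degree, hence lies in the right ideal by induction, and
  -- associativity of ∘_0 concludes.
  have hd : decomposables K deg n ≤ primIdeal deg Θ n := by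
    refine Submodule.span_le.2 ?_
    rintro _ ⟨i, j, hij, hi, hj, a, ha, b, hb, rfl⟩
    have : primIdeal deg Θ i ≤ (primIdeal deg Θ n).comap ((graft K deg 0).flip b) := by
      refine sup_le (fun p hp => ?_) (Submodule.span_le.2 ?_)
      · rw [Submodule.mem_comap, LinearMap.flip_apply]
        exact Submodule.mem_sup_right (Submodule.subset_span
          ⟨i, j, hij, hi, hj, p, hp, b, hb, rfl⟩)
      rintro _ ⟨i', j', hij', hi', hj', p, hp, a', ha', rfl⟩
      rw [SetLike.mem_coe, Submodule.mem_comap, LinearMap.flip_apply]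
      refine Submodule.mem_sup_right (Submodule.subset_span ⟨i', j' + j, by omega, hi', by omega,
        p, hp, _, graft_mem_homog (i := 0) ha' hb, ?_⟩)
      rw [graft_graft_left p ha' hb (Nat.zero_le _) (Nat.zero_le _)]
    have h := this (ih i (by omega) ha)
    rwa [Submodule.mem_comap, LinearMap.flip_apply] at h
  have hq : primOrDecomposable deg Θ n ≤ primIdeal deg Θ n := sup_le le_sup_left hd
  have key : ∀ (x : X) (C : ℕ → PTree deg), degree (nodeN x C) = n →
      Finsupp.single (⟨nodeN x C, nodeN_ne_leaf x C⟩ : NTree deg) (1 : K) ∈ primIdeal deg Θ n := by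
    intro x C ht
    have hx := hdeg x
    have hC : ∀ j ≤ deg x, degree (C j) < n := by
      intro j hj
      have h1 := degree_nodeN_add_one x C
      rw [offset, Finset.sum_add_distrib] at h1
      have h2 := Finset.single_le_sum (f := fun j => degree (C j)) (fun _ _ => Nat.zero_le _)
        (Finset.mem_range.2 (Nat.lt_succ_of_le hj))
      simp at h1 h2
      omega
    by_cases h0 : C 0 = leaf
    · refine hq ?_
      have := nodeN_mem_primOrDecomposable hdeg hΘ ih x C hC h0
      rwa [ht] at this
    -- A tree whose first child is not a leaf is decomposable: that child is grafted on leaf `0` of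
    -- the rest.
    · have e : nodeN x C = graftAt (C 0) 0 (nodeN x (Function.update C 0 leaf)) := by
        rw [graftAt_nodeN (k := 0) _ (Nat.zero_le _) (by simp) (by simp)]
        refine nodeN_congr fun j _ => ?_
        rcases eq_or_ne j 0 with rfl | hj
        · simp [graftAt_leaf]
        · simp [hj]
      have hd0 := degree_graftAt (C 0) (Nat.zero_le (degree (nodeN x (Function.update C 0 leaf))))
      rw [← e, ht] at hd0
      refine hd (Submodule.subset_span ⟨degree (C 0), degree (nodeN x (Function.update C 0 leaf)),
        hd0.symm, degree_pos hdeg h0, degree_pos hdeg (nodeN_ne_leaf _ _),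
        Finsupp.single ⟨C 0, h0⟩ 1, single_mem_homog rfl 1,
        Finsupp.single ⟨nodeN x (Function.update C 0 leaf), nodeN_ne_leaf _ _⟩ 1,
        single_mem_homog rfl 1, ?_⟩)
      rw [graft_single_of_le (Nat.zero_le _)]
      simp only [graftTree, ← e]
  intro z hz
  refine map_homog_mem (f := LinearMap.id) (S := primIdeal deg Θ n) (fun t ht => ?_) hz
  obtain ⟨t, hl⟩ := t
  cases t with
  | leaf => exact absurd rfl hl
  | node x c =>
    rw [LinearMap.id_apply]
    simp only [node_eq_nodeN] at ht ⊢
    exact key x _ ht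

/-- On P + P ∘_0 K[T_∞, X], which is everything, `e` is the identity on P and zero on the second
summand. Its image thus lies in P, and it contains every primitive z = e(z). -/
theorem primGr_eq_primitives (hΘ' : IsCoassociative Θ) : PrimGr deg Θ = primitives deg Θ := by
  have hle := primGr_le_primitives hdeg hΘ hΘ'
  have h : ∀ n, primIdeal deg Θ n ≤ (PrimGr deg Θ).comap (eMap Θ) := by
    intro n
    refine sup_le (fun p hp => ?_) (Submodule.span_le.2 ?_)
    · rw [Submodule.mem_comap, eMap_of_mem_primitives hdeg hΘ (hle hp.1)]
      exact hp.1
    · rintro _ ⟨i, j, -, -, -, p, hp, a, -, rfl⟩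
      rw [SetLike.mem_coe, Submodule.mem_comap, eMap_graft_zero hdeg hΘ (hle hp.1)]
      exact zero_mem _
  have h' : ∀ z : TreeSpace K deg, eMap Θ z ∈ PrimGr deg Θ := by
    intro z
    induction z using Finsupp.induction_linear with
    | zero => simp
    | add a b ha hb => exact map_add (eMap Θ) a b ▸ add_mem ha hb
    | single t a => exact h _ (homog_le_primIdeal hdeg hΘ _ (single_mem_homog rfl a))
  refine le_antisymm hle fun z hz => ?_
  rw [← eMap_of_mem_primitives hdeg hΘ hz]
  exact h' z

end coproduct

end TreeSpace

end

/-! ### The `Prim_gr` algebra structure of Prim_gr(X) -/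

noncomputable section

theorem isInternal_of_projections {K V : Type*} [Field K] [AddCommGroup V] [Module K V]
    (comp : ℕ → Submodule K V) (π : ℕ → V →ₗ[K] V) (hπ : ∀ n z, π n z ∈ comp n)
    (h : ∀ m n, ∀ z ∈ comp m, π n z = if m = n then z else 0)
    (hs : ∀ z, ∃ N, ∑ n ∈ Finset.range N, π n z = z) : DirectSum.IsInternal comp := by
  refine DirectSum.isInternal_submodule_of_iSupIndep_of_iSup_eq_top ?_ ?_
  · intro n
    rw [Submodule.disjoint_def]
    intro z hz hz'
    have hle : (⨆ j, ⨆ (_ : j ≠ n), comp j) ≤ LinearMap.ker (π n) := by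
      refine iSup₂_le fun j hj w hw => ?_
      rw [LinearMap.mem_ker, h j n w hw, if_neg hj]
    have h' := hle hz'
    rwa [LinearMap.mem_ker, h n n z hz, if_pos rfl] at h'
  · rw [eq_top_iff]
    intro z _
    obtain ⟨N, hN⟩ := hs z
    rw [← hN]
    exact sum_mem fun n _ => Submodule.mem_iSup_of_mem n (hπ n z)

theorem isInternal_comap_of_projections {K V : Type*} [Field K] [AddCommGroup V] [Module K V]
    (comp : ℕ → Submodule K V) (π : ℕ → V →ₗ[K] V) (hπ : ∀ n z, π n z ∈ comp n)
    (h : ∀ m n, ∀ z ∈ comp m, π n z = if m = n then z else 0)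
    (hs : ∀ z, ∃ N, ∑ n ∈ Finset.range N, π n z = z) (S : Submodule K V)
    (hS : ∀ n, ∀ z ∈ S, π n z ∈ S) : DirectSum.IsInternal fun n => (comp n).comap S.subtype := by
  refine isInternal_of_projections (fun n => (comp n).comap S.subtype)
    (fun n => (π n).restrict (hS n)) (fun n z => hπ n z) (fun m n z hz => Subtype.ext ?_)
    fun z => ?_
  · rw [LinearMap.coe_restrict_apply, h m n z hz]
    split_ifs <;> rfl
  · obtain ⟨N, hN⟩ := hs z
    refine ⟨N, Subtype.ext ?_⟩
    rw [AddSubmonoidClass.coe_finsetSum]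
    exact hN

namespace TreeSpace

open PTree

variable {K : Type*} [Field K] {X : Type*} {deg : X → ℕ}

section identities

variable {m n r p q : ℕ} {x y z : TreeSpace K deg}

theorem bracket_bracket (hdeg : ∀ x, 0 < deg x) (hx : x ∈ homog K deg m) (hy : y ∈ homog K deg n)
    (hz : z ∈ homog K deg r) :
    bracket K deg (bracket K deg x y) z =
      bracket K deg x (bracket K deg y z) + graft K deg m y (bracket K deg x z) := by
  -- The parallel law is applied below to leaves `0` and `n` of `y`, which must be distinct.
  rcases Nat.eq_zero_or_pos n with rfl | hn
  · rw [eq_zero_of_mem_homog_zero hdeg hy]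
    simp
  rw [bracket_eq z (bracket_mem_homog hx hy), bracket_eq _ hx, bracket_eq _ hx, bracket_eq _ hx,
    bracket_eq _ hy]
  simp only [map_sub, LinearMap.sub_apply]
  rw [graft_graft_left z hy hx le_rfl le_rfl, graft_graft_left y hz hx (Nat.zero_le _) le_rfl,
    graft_graft_left y hx hz le_rfl (Nat.zero_le _),
    graft_graft_left x hy hz (Nat.zero_le _) (Nat.zero_le _),
    graft_comm z hx hy hn le_rfl, add_comm n m]
  simp only [zero_add, add_zero]
  abel

theorem bracket_graft_left (hx : x ∈ homog K deg m) (hy : y ∈ homog K deg n)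
    (hz : z ∈ homog K deg r) (hp : p < n) :
    bracket K deg (graft K deg p x y) z = graft K deg p x (bracket K deg y z) := by
  rw [bracket_eq z (graft_mem_homog hx hy), bracket_eq z hy, map_sub,
    graft_graft_left x hy hz hp.le (Nat.zero_le _), graft_comm z hx hy hp le_rfl, add_comm n m,
    add_zero]

theorem bracket_graft_right (hx : x ∈ homog K deg m) (hz : z ∈ homog K deg r) (h1 : 1 ≤ p)
    (hp : p < r) :
    bracket K deg x (graft K deg p y z) = graft K deg (m + p) y (bracket K deg x z) := by
  rw [bracket_eq _ hx, bracket_eq _ hx, map_sub, graft_graft_left y hz hx hp.le le_rfl,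
    graft_comm y hx hz h1 hp.le, add_comm p m]

theorem graft_bracket_left (hx : x ∈ homog K deg m) (hy : y ∈ homog K deg n)
    (hz : z ∈ homog K deg r) (hp : p < r) :
    graft K deg p (bracket K deg x y) z =
      graft K deg (m + p) y (graft K deg p x z) - graft K deg p x (graft K deg p y z) := by
  rw [bracket_eq _ hx, map_sub, LinearMap.sub_apply, graft_graft_left y hx hz le_rfl hp.le,
    graft_graft_left x hy hz (Nat.zero_le _) hp.le, zero_add]

end identities

/-- The projection on the components whose degree satisfies `q`. -/
def degreeFilter (K : Type*) [Field K] {X : Type*} (deg : X → ℕ) (q : ℕ → Prop)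
    [DecidablePred q] : TreeSpace K deg →ₗ[K] TreeSpace K deg :=
  Finsupp.linearCombination K fun t => if q t.1.degree then Finsupp.single t 1 else 0

section degreeFilter

variable (q : ℕ → Prop) [DecidablePred q]

theorem degreeFilter_single (t : NTree deg) : degreeFilter K deg q (Finsupp.single t 1) =
    if q t.1.degree then Finsupp.single t 1 else 0 := by
  simp [degreeFilter]

theorem degreeFilter_of_mem {n : ℕ} {z : TreeSpace K deg} (hz : z ∈ homog K deg n) :
    degreeFilter K deg q z = if q n then z else 0 := by
  have : degreeFilter K deg q z = (if q n then LinearMap.id else 0 :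
      TreeSpace K deg →ₗ[K] TreeSpace K deg) z := by
    refine eqOn_homog (fun t ht => ?_) hz
    rw [degreeFilter_single, ht]
    split_ifs <;> simp
  rw [this]
  split_ifs <;> simp

theorem degreeFilter_mem_homog (n : ℕ) (z : TreeSpace K deg) :
    degreeFilter K deg (· = n) z ∈ homog K deg n := by
  induction z using Finsupp.induction_linear with
  | zero => simp
  | add a b ha hb => exact map_add (degreeFilter K deg (· = n)) a b ▸ add_mem ha hb
  | single t a =>
    rw [degreeFilter_of_mem _ (single_mem_homog rfl a)]
    split_ifs with h
    · exact single_mem_homog h a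
    · exact zero_mem _

theorem sum_degreeFilter (z : TreeSpace K deg) :
    ∃ N, ∑ n ∈ Finset.range N, degreeFilter K deg (· = n) z = z := by
  suffices ∃ N, ∀ M ≥ N, ∑ n ∈ Finset.range M, degreeFilter K deg (· = n) z = z from
    this.imp fun N h => h N le_rfl
  induction z using Finsupp.induction_linear with
  | zero => exact ⟨0, by simp⟩
  | add a b ha hb =>
    obtain ⟨N, hN⟩ := ha
    obtain ⟨N', hN'⟩ := hb
    refine ⟨max N N', fun M hM => ?_⟩
    simp only [map_add, Finset.sum_add_distrib]
    rw [hN M (le_trans (le_max_left _ _) hM), hN' M (le_trans (le_max_right _ _) hM)]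
  | single t a =>
    refine ⟨t.1.degree + 1, fun M hM => ?_⟩
    simp only [degreeFilter_of_mem _ (single_mem_homog (rfl : t.1.degree = _) a)]
    rw [Finset.sum_ite_eq, if_pos (Finset.mem_range.2 (by omega))]

/-- The coproduct is graded, so it intertwines the filter with the filter `Q` by total degree on the
tensor square. -/
theorem degreeFilter_mem_primitives (hdeg : ∀ x, 0 < deg x)
    {Θ : (X →₀ K) →ₗ[K] (X →₀ K) ⊗[K] (X →₀ K)} (hΘ : IsGradedCoproduct deg Θ)
    {z : TreeSpace K deg} (hz : z ∈ primitives deg Θ) :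
    degreeFilter K deg q z ∈ primitives deg Θ := by
  set Q : TreeSpace K deg ⊗[K] TreeSpace K deg →ₗ[K] TreeSpace K deg ⊗[K] TreeSpace K deg :=
    TensorProduct.lift (Finsupp.linearCombination K fun a => Finsupp.linearCombination K fun b =>
      if q (a.1.degree + b.1.degree) then Finsupp.single a (1 : K) ⊗ₜ[K] Finsupp.single b (1 : K)
      else 0) with hQ
  have h : coprod Θ ∘ₗ degreeFilter K deg q = Q ∘ₗ coprod Θ := by
    refine Finsupp.lhom_ext' fun t => LinearMap.ext_ring ?_
    simp only [LinearMap.comp_apply, Finsupp.lsingle_apply]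
    have e : Q (coprod Θ (Finsupp.single t 1)) =
        (if q t.1.degree then LinearMap.id else 0 : TreeSpace K deg ⊗[K] TreeSpace K deg →ₗ[K]
          TreeSpace K deg ⊗[K] TreeSpace K deg) (coprod Θ (Finsupp.single t 1)) := by
      refine eqOn_tensorHomog (fun a b hab => ?_) (coprod_single_mem hdeg hΘ t)
      rw [← hab, hQ, TensorProduct.lift.tmul]
      simp only [Finsupp.linearCombination_single, one_smul]
      split_ifs <;> simp
    rw [e, degreeFilter_single]
    split_ifs <;> simp
  have hz' : coprod Θ z = 0 := hz
  have := LinearMap.congr_fun h z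
  rw [LinearMap.comp_apply, LinearMap.comp_apply, hz', map_zero] at this
  exact this

theorem isInternal_comap_homog (S : Submodule K (TreeSpace K deg))
    (hS : ∀ n, ∀ z ∈ S, degreeFilter K deg (· = n) z ∈ S) :
    DirectSum.IsInternal fun n => (homog K deg n).comap S.subtype :=
  isInternal_comap_of_projections (homog K deg) (fun n => degreeFilter K deg (· = n))
    degreeFilter_mem_homog (fun _ n _ hz => degreeFilter_of_mem (· = n) hz) sum_degreeFilter S hS

end degreeFilter

section algebra

variable (hdeg : ∀ x, 0 < deg x) {Θ : (X →₀ K) →ₗ[K] (X →₀ K) ⊗[K] (X →₀ K)}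
  (hΘ : IsGradedCoproduct deg Θ) (hΘ' : IsCoassociative Θ)

include hdeg hΘ hΘ'

/-- Homogeneity of Prim_gr(X) is read off its description as the kernel of a graded map. -/
theorem degreeFilter_mem_primGr (q : ℕ → Prop) [DecidablePred q] {z : TreeSpace K deg}
    (hz : z ∈ PrimGr deg Θ) : degreeFilter K deg q z ∈ PrimGr deg Θ := by
  rw [primGr_eq_primitives hdeg hΘ hΘ'] at hz ⊢
  exact degreeFilter_mem_primitives q hdeg hΘ hz

/-- The product x ∘_p y may leave Prim_gr(X) for p = 0 or p = |y|. Truncating `y` to the admissible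
degrees turns ∘_p into an operation defined on all of Prim_gr(X). -/
theorem graft_degreeFilter_mem (p : ℕ) {x y : TreeSpace K deg} (hx : x ∈ PrimGr deg Θ)
    (hy : y ∈ PrimGr deg Θ) :
    graft K deg p x (degreeFilter K deg (fun n => 1 ≤ p ∧ p < n) y) ∈ PrimGr deg Θ := by
  obtain ⟨N, hN⟩ := sum_degreeFilter y
  rw [← hN, map_sum, map_sum]
  refine sum_mem fun n _ => ?_
  rw [degreeFilter_of_mem _ (degreeFilter_mem_homog n y)]
  split_ifs with h
  · exact (isPrimGrClosed_primGr deg Θ).graft_mem p n h.1 h.2 x hx _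
      (degreeFilter_mem_primGr hdeg hΘ hΘ' _ hy) (degreeFilter_mem_homog n y)
  · rw [map_zero]
    exact zero_mem _

theorem isInternal_primGr : DirectSum.IsInternal fun n =>
    (homog K deg n).comap (PrimGr deg Θ).subtype :=
  isInternal_comap_homog (PrimGr deg Θ) fun _ _ hz => degreeFilter_mem_primGr hdeg hΘ hΘ' _ hz

omit hdeg hΘ hΘ' in
/-- The bracket of `Prim_gr(X)`. -/
def primGrBracket : PrimGr deg Θ →ₗ[K] PrimGr deg Θ →ₗ[K] PrimGr deg Θ :=
  LinearMap.mk₂ K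
    (fun x y => ⟨bracket K deg x y, (isPrimGrClosed_primGr deg Θ).bracket_mem x x.2 y y.2⟩)
    (fun x x' y => Subtype.ext (by simp)) (fun a x y => Subtype.ext (by simp))
    (fun x y y' => Subtype.ext (by simp)) (fun a x y => Subtype.ext (by simp))

/-- The products `∘_p` of `Prim_gr(X)`, extended by zero to the elements of degree at most `p`. -/
def primGrGraft (p : ℕ) : PrimGr deg Θ →ₗ[K] PrimGr deg Θ →ₗ[K] PrimGr deg Θ :=
  LinearMap.mk₂ K
    (fun x y => ⟨graft K deg p x (degreeFilter K deg (fun n => 1 ≤ p ∧ p < n) y),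
      graft_degreeFilter_mem hdeg hΘ hΘ' p x.2 y.2⟩)
    (fun x x' y => Subtype.ext (by simp)) (fun a x y => Subtype.ext (by simp))
    (fun x y y' => Subtype.ext (by simp)) (fun a x y => Subtype.ext (by simp))

omit hdeg hΘ hΘ' in
theorem coe_primGrBracket (x y : PrimGr deg Θ) :
    (primGrBracket x y : TreeSpace K deg) = bracket K deg x y := rfl

theorem coe_primGrGraft {p n : ℕ} (h1 : 1 ≤ p) (hp : p < n) (x : PrimGr deg Θ)
    {y : PrimGr deg Θ} (hy : (y : TreeSpace K deg) ∈ homog K deg n) :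
    (primGrGraft hdeg hΘ hΘ' p x y : TreeSpace K deg) = graft K deg p x y := by
  change graft K deg p x (degreeFilter K deg (fun n => 1 ≤ p ∧ p < n) y) = _
  rw [degreeFilter_of_mem _ hy, if_pos ⟨h1, hp⟩]

/-- The structure of `Prim_gr` algebra on `Prim_gr(X)`. -/
def primGrAlgebra : PrimGrAlgebra K (PrimGr deg Θ) where
  comp n := (homog K deg n).comap (PrimGr deg Θ).subtype
  isInternal := isInternal_primGr hdeg hΘ hΘ'
  bracket := primGrBracket
  graft := primGrGraft hdeg hΘ hΘ'
  bracket_mem hx hy := bracket_mem_homog (K := K) hx hy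
  graft_mem {p m n x y} h1 hp hx hy := by
    change (primGrGraft hdeg hΘ hΘ' p x y : TreeSpace K deg) ∈ homog K deg (m + n)
    rw [coe_primGrGraft hdeg hΘ hΘ' h1 hp x hy]
    exact graft_mem_homog hx hy
  bracket_bracket {m n r x y z} hx hy hz hm hr := by
    refine Subtype.ext ?_
    rw [Submodule.coe_add, coe_primGrGraft hdeg hΘ hΘ' hm (by omega : m < m + r) y
      (bracket_mem_homog hx hz)]
    exact bracket_bracket hdeg hx hy hz
  bracket_graft_left {p m n r x y z} hx hy hz h1 hp := by
    refine Subtype.ext ?_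
    rw [coe_primGrBracket, coe_primGrGraft hdeg hΘ hΘ' h1 hp x hy,
      coe_primGrGraft hdeg hΘ hΘ' h1 (by omega : p < n + r) x (bracket_mem_homog hy hz)]
    exact bracket_graft_left hx hy hz hp
  bracket_graft_right {p m n r x y z} hx hy hz h1 hp := by
    refine Subtype.ext ?_
    rw [coe_primGrBracket, coe_primGrGraft hdeg hΘ hΘ' h1 hp y hz,
      coe_primGrGraft hdeg hΘ hΘ' (by omega) (by omega : m + p < m + r) y
        (bracket_mem_homog hx hz)]
    exact bracket_graft_right hx hz h1 hp
  graft_bracket_left {p m n r x y z} hx hy hz h1 hp := by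
    have hxz := graft_mem_homog (i := p) hx hz
    have hyz := graft_mem_homog (i := p) hy hz
    rw [Submodule.subtype_apply, Submodule.subtype_apply] at hxz hyz
    rw [← coe_primGrGraft hdeg hΘ hΘ' h1 hp _ hz] at hxz hyz
    refine Subtype.ext ?_
    rw [Submodule.coe_sub, coe_primGrGraft hdeg hΘ hΘ' h1 hp _ hz,
      coe_primGrGraft hdeg hΘ hΘ' (by omega) (by omega : m + p < m + r) y hxz,
      coe_primGrGraft hdeg hΘ hΘ' h1 (by omega : p < n + r) x hyz,
      coe_primGrGraft hdeg hΘ hΘ' h1 hp _ hz, coe_primGrGraft hdeg hΘ hΘ' h1 hp _ hz]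
    exact graft_bracket_left hx hy hz hp
  graft_graft_left {p q m n r x y z} hx hy hz h1 hp h1' hq := by
    have hyz := graft_mem_homog (i := q) hy hz
    rw [Submodule.subtype_apply, Submodule.subtype_apply] at hyz
    rw [← coe_primGrGraft hdeg hΘ hΘ' h1' hq _ hz] at hyz
    refine Subtype.ext ?_
    rw [coe_primGrGraft hdeg hΘ hΘ' h1' hq _ hz, coe_primGrGraft hdeg hΘ hΘ' h1 hp _ hy,
      coe_primGrGraft hdeg hΘ hΘ' (by omega) (by omega : p + q < n + r) _ hyz,
      coe_primGrGraft hdeg hΘ hΘ' h1' hq _ hz]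
    exact graft_graft_left x.1 hy hz hp.le hq.le
  graft_graft_right {p q m n r x y z} hx hy hz h1 hp hq := by
    have hxz := graft_mem_homog (i := p) hx hz
    have hyz := graft_mem_homog (i := q) hy hz
    rw [Submodule.subtype_apply, Submodule.subtype_apply] at hxz hyz
    rw [← coe_primGrGraft hdeg hΘ hΘ' h1 (by omega) _ hz] at hxz
    rw [← coe_primGrGraft hdeg hΘ hΘ' (by omega) hq _ hz] at hyz
    refine Subtype.ext ?_
    rw [coe_primGrGraft hdeg hΘ hΘ' h1 (by omega : p < n + r) _ hyz,
      coe_primGrGraft hdeg hΘ hΘ' (by omega) hq _ hz,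
      coe_primGrGraft hdeg hΘ hΘ' (by omega) (by omega : m + q < m + r) _ hxz,
      coe_primGrGraft hdeg hΘ hΘ' h1 (by omega) _ hz, add_comm m q]
    exact graft_comm y.1 hx hz hp hq.le

end algebra

end TreeSpace

end

/-! ### Words in a `Prim_gr` algebra and their insertion operations -/

noncomputable section

namespace PrimGrAlgebra

/-- A basis of the part of positive degree of a `Prim_gr` algebra by homogeneous elements. -/
structure PositiveBasis {K W : Type*} [Field K] [AddCommGroup W] [Module K W]
    (Q : PrimGrAlgebra K W) (B : Type*) where
  deg : B → ℕ
  vec : B → W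
  coord : W →ₗ[K] B →₀ K
  deg_pos : ∀ b, 0 < deg b
  vec_mem : ∀ b, vec b ∈ Q.comp (deg b)
  coord_vec : ∀ b, coord (vec b) = Finsupp.single b 1
  comp_le : ∀ n, 0 < n → Q.comp n ≤ Submodule.span K (vec '' {b | deg b = n})

/-- The component of degree `0` is discarded: the generators have positive degree, so the morphism
to be built never meets it. -/
theorem exists_positiveBasis.{u, v} {K : Type u} {W : Type v} [Field K] [AddCommGroup W]
    [Module K W] (Q : PrimGrAlgebra K W) : ∃ (B : Type v), Nonempty (PositiveBasis Q B) := by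
  classical
  set v := fun n => Module.Basis.ofVectorSpace K (Q.comp n)
  set C := Q.isInternal.collectedBasis v with hC
  refine ⟨{s : Σ n, Module.Basis.ofVectorSpaceIndex K (Q.comp n) // 0 < s.1}, ⟨{
    deg := fun b => b.1.1
    vec := fun b => C b.1
    coord := Finsupp.lcomapDomain Subtype.val Subtype.val_injective ∘ₗ C.repr.toLinearMap
    deg_pos := fun b => b.2
    vec_mem := fun b => Q.isInternal.collectedBasis_mem v b.1
    coord_vec := fun b => ?_
    comp_le := fun n hn w hw => ?_ }⟩⟩
  · ext a
    simp [Finsupp.lcomapDomain, Finsupp.single_apply, Subtype.ext_iff]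
  · have h := (v n).mem_span ⟨w, hw⟩
    have h' := Submodule.mem_map_of_mem (f := (Q.comp n).subtype) h
    rw [Submodule.map_span] at h'
    refine Submodule.span_mono ?_ h'
    rintro _ ⟨_, ⟨i, rfl⟩, rfl⟩
    refine ⟨⟨⟨n, i⟩, hn⟩, rfl, ?_⟩
    simp [hC]

namespace PositiveBasis

variable {K W B : Type*} [Field K] [AddCommGroup W] [Module K W] {Q : PrimGrAlgebra K W}
  (b : PositiveBasis Q B)

theorem eqOn_comp {M : Type*} [AddCommMonoid M] [Module K M] {n : ℕ} (hn : 0 < n)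
    {f g : W →ₗ[K] M} (h : ∀ c, b.deg c = n → f (b.vec c) = g (b.vec c)) {w : W}
    (hw : w ∈ Q.comp n) : f w = g w := by
  refine LinearMap.eqOn_span (f := f) (g := g) ?_ (b.comp_le n hn hw)
  rintro _ ⟨c, hc, rfl⟩
  exact h c hc

/-- The left multiplication by the elements of `W` on the space spanned by the words in the
basis. -/
def consW : W →ₗ[K] (List B →₀ K) →ₗ[K] (List B →₀ K) :=
  Finsupp.linearCombination K (fun c => Finsupp.lmapDomain K K (List.cons c)) ∘ₗ b.coord

theorem consW_vec (c : B) : b.consW (b.vec c) = Finsupp.lmapDomain K K (List.cons c) := by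
  simp [consW, b.coord_vec]

theorem consW_vec_single (c : B) (l : List B) :
    b.consW (b.vec c) (Finsupp.single l 1) = Finsupp.single (c :: l) 1 := by
  simp [consW_vec]

/-- The action of `W` on words: `insert l i u` is the insertion of `u` in the word `l` in
position `i`. -/
def insert : List B → ℕ → W →ₗ[K] (List B →₀ K)
  | [], i => if i = 0 then b.consW.flip (Finsupp.single [] 1) else 0
  | c :: l, i =>
    if i = 0 then b.consW.flip (Finsupp.single (c :: l) 1)
    else if i < b.deg c then b.consW.flip (Finsupp.single l 1) ∘ₗ (Q.graft i).flip (b.vec c)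
    -- At the end of the first letter the rule imitates u ∘_|c| c = {c, u} + c ∘_0 u: the bracket
    -- replaces `c`, and `u` is also inserted in position `0` of the remaining word.
    else (if i = b.deg c then b.consW.flip (Finsupp.single l 1) ∘ₗ Q.bracket (b.vec c) else 0) +
      Finsupp.lmapDomain K K (List.cons c) ∘ₗ insert l (i - b.deg c)

/-- The insertion of `u` in position `i`, extended linearly to combinations of words. -/
def act (i : ℕ) (u : W) : (List B →₀ K) →ₗ[K] (List B →₀ K) :=
  Finsupp.linearCombination K fun l => b.insert l i u

theorem act_single (i : ℕ) (u : W) (l : List B) :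
    b.act i u (Finsupp.single l 1) = b.insert l i u := by
  simp [act]

theorem act_add (i : ℕ) (u v : W) : b.act i (u + v) = b.act i u + b.act i v :=
  Finsupp.lhom_ext' fun l => LinearMap.ext_ring (by simp [act])

theorem act_smul (i : ℕ) (a : K) (u : W) : b.act i (a • u) = a • b.act i u :=
  Finsupp.lhom_ext' fun l => LinearMap.ext_ring (by simp [act])

/-- The insertion in position `i` as a bilinear map. -/
def actLin (i : ℕ) : W →ₗ[K] (List B →₀ K) →ₗ[K] (List B →₀ K) where
  toFun := b.act i
  map_add' := b.act_add i
  map_smul' := b.act_smul i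

theorem act_zero (u : W) (L : List B →₀ K) : b.act 0 u L = b.consW u L := by
  refine LinearMap.congr_fun (Finsupp.lhom_ext' fun l => LinearMap.ext_ring ?_) L
  simp only [LinearMap.comp_apply, Finsupp.lsingle_apply, act_single]
  cases l <;> simp [insert]

theorem act_nil {i : ℕ} (hi : 0 < i) (u : W) : b.act i u (Finsupp.single [] 1) = 0 := by
  rw [act_single, insert, if_neg hi.ne', LinearMap.zero_apply]

theorem act_consW_of_lt {i n : ℕ} (hi : 0 < i) (hin : i < n) (u : W) {w : W}
    (hw : w ∈ Q.comp n) (L : List B →₀ K) :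
    b.act i u (b.consW w L) = b.consW (Q.graft i u w) L := by
  refine b.eqOn_comp (by omega) (f := b.act i u ∘ₗ b.consW.flip L)
    (g := b.consW.flip L ∘ₗ Q.graft i u) (fun c hc => ?_) hw
  refine LinearMap.congr_fun (f := b.act i u ∘ₗ b.consW (b.vec c))
    (g := b.consW (Q.graft i u (b.vec c))) (Finsupp.lhom_ext' fun l => LinearMap.ext_ring ?_) L
  simp only [LinearMap.comp_apply, Finsupp.lsingle_apply]
  rw [consW_vec_single, act_single, insert, if_neg hi.ne', if_pos (by omega)]
  rfl

theorem act_consW_of_le {i n : ℕ} (hn : 0 < n) (hin : n ≤ i) (u : W) {w : W}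
    (hw : w ∈ Q.comp n) (L : List B →₀ K) :
    b.act i u (b.consW w L) =
      (if i = n then b.consW (Q.bracket w u) L else 0) + b.consW w (b.act (i - n) u L) := by
  have key : b.act i u (b.consW w L) = ((if i = n then b.consW.flip L ∘ₗ Q.bracket.flip u else 0) +
      b.consW.flip (b.act (i - n) u L) : W →ₗ[K] (List B →₀ K)) w := by
    refine b.eqOn_comp hn (f := b.act i u ∘ₗ b.consW.flip L) (fun c hc => ?_) hw
    refine LinearMap.congr_fun (f := b.act i u ∘ₗ b.consW (b.vec c))
      (g := (if i = n then b.consW (Q.bracket (b.vec c) u) else 0) +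
        b.consW (b.vec c) ∘ₗ b.act (i - n) u)
      (Finsupp.lhom_ext' fun l => LinearMap.ext_ring ?_) L |>.trans ?_
    · simp only [LinearMap.comp_apply, Finsupp.lsingle_apply, LinearMap.add_apply]
      rw [consW_vec_single, act_single, insert, if_neg (by omega), if_neg (by omega),
        LinearMap.add_apply, hc, LinearMap.comp_apply, consW_vec, act_single]
      congr 1
      split_ifs <;> rfl
    · rw [LinearMap.add_apply, LinearMap.add_apply]
      congr 1
      split_ifs <;> rfl
  rw [key, LinearMap.add_apply]
  congr 1
  split_ifs <;> rfl

theorem act_consW_of_gt {i n : ℕ} (hn : 0 < n) (hin : n < i) (u : W) {w : W}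
    (hw : w ∈ Q.comp n) (L : List B →₀ K) :
    b.act i u (b.consW w L) = b.consW w (b.act (i - n) u L) := by
  rw [b.act_consW_of_le hn hin.le u hw, if_neg hin.ne', zero_add]

theorem act_consW_self {n : ℕ} (hn : 0 < n) (u : W) {w : W}
    (hw : w ∈ Q.comp n) (L : List B →₀ K) :
    b.act n u (b.consW w L) = b.consW (Q.bracket w u) L + b.consW w (b.act 0 u L) := by
  rw [b.act_consW_of_le hn le_rfl u hw, if_pos rfl, Nat.sub_self]

section relations

variable {m n : ℕ} {u v : W}

/-- Parallel law, `u` falling beyond the inserted `v`. Induction on the word, with first letter `c`: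
relation 6 applies when both positions lie inside `c`, relation 2 when `u` falls at the end of `v
•_j c`, and the other cases reduce to the remaining word. -/
theorem act_act_comm (hu : u ∈ Q.comp m) (hm : 0 < m) (hv : v ∈ Q.comp n) (hn : 0 < n)
    {i j : ℕ} (hij : j + n < i) (L : List B →₀ K) :
    b.act i u (b.act j v L) = b.act j v (b.act (i - n) u L) := by
  rcases Nat.eq_zero_or_pos j with rfl | hj
  · rw [act_zero, act_zero, b.act_consW_of_gt hn (by omega) u hv]
  have key : ∀ l : List B, ∀ i j, 0 < j → j + n < i →
      b.act i u (b.act j v (Finsupp.single l 1)) =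
        b.act j v (b.act (i - n) u (Finsupp.single l 1)) := by
    intro l
    induction l with
    | nil =>
      intro i j hj hij
      rw [b.act_nil hj, b.act_nil (by omega), map_zero, map_zero]
    | cons c l ih =>
      intro i j hj hij
      have hc := b.vec_mem c
      have hk := b.deg_pos c
      have hcu := Q.bracket_mem hc hu
      have hcv := Q.bracket_mem hc hv
      rw [← b.consW_vec_single]
      rcases lt_or_ge j (b.deg c) with hjc | hjc
      · have hvc := Q.graft_mem hj hjc hv hc
        rw [b.act_consW_of_lt hj hjc v hc]
        rcases lt_or_ge i (n + b.deg c) with hi | hi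
        · rw [b.act_consW_of_lt (by omega) hi u hvc,
            b.act_consW_of_lt (by omega) (by omega) u hc, b.act_consW_of_lt hj (by omega) v
              (Q.graft_mem (by omega) (by omega) hu hc),
            Q.graft_graft_right hv hu hc hj (by omega) (by omega),
            Nat.add_sub_cancel' (by omega)]
        · rw [b.act_consW_of_le (by omega) hi u hvc,
            b.act_consW_of_le hk (by omega) u hc, map_add, b.act_consW_of_lt hj hjc v hc,
            ← Nat.sub_sub]
          congr 1
          rcases eq_or_ne i (n + b.deg c) with h | h
          · rw [if_pos h, if_pos (by omega), b.act_consW_of_lt hj (by omega) v hcu,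
              Q.bracket_graft_left hv hc hu hj hjc]
          · rw [if_neg h, if_neg (by omega), map_zero]
      · have ih' : b.act (i - b.deg c) u (b.act (j - b.deg c) v (Finsupp.single l 1)) =
            b.act (j - b.deg c) v (b.act (i - n - b.deg c) u (Finsupp.single l 1)) := by
          rcases Nat.eq_zero_or_pos (j - b.deg c) with h0 | h0
          · rw [h0, act_zero, act_zero, b.act_consW_of_gt hn (by omega) u hv]
            congr 3
            omega
          · rw [ih _ _ h0 (by omega)]
            congr 3
            omega
        rw [b.act_consW_of_gt hk (by omega : b.deg c < i - n) u hc,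
          b.act_consW_of_le hk hjc v hc, b.act_consW_of_le hk hjc v hc, map_add,
          b.act_consW_of_gt hk (by omega) u hc, ih']
        congr 1
        split_ifs
        · rw [b.act_consW_of_gt (by omega) (by omega) u hcv]
          congr 3
          omega
        · rw [map_zero]
  refine LinearMap.congr_fun (f := b.act i u ∘ₗ b.act j v) (g := b.act j v ∘ₗ b.act (i - n) u)
    (Finsupp.lhom_ext' fun l => LinearMap.ext_ring ?_) L
  exact key l i j hj hij

/-- Sequential law, `u` falling strictly inside `v`. Relation 5 applies when `v` is inserted inside
the first letter, relation 3 when it is inserted at its end. -/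
theorem act_act_graft (hu : u ∈ Q.comp m) (hv : v ∈ Q.comp n) {j : ℕ} (hj : 0 < j) (hjn : j < n)
    (q : ℕ) (L : List B →₀ K) :
    b.act (j + q) u (b.act q v L) = b.act q (Q.graft j u v) L := by
  have huv := Q.graft_mem hj hjn hu hv
  have key : ∀ l : List B, ∀ q, b.act (j + q) u (b.act q v (Finsupp.single l 1)) =
      b.act q (Q.graft j u v) (Finsupp.single l 1) := by
    intro l
    induction l with
    | nil =>
      intro q
      rcases Nat.eq_zero_or_pos q with rfl | hq
      · rw [act_zero, act_zero, add_zero, b.act_consW_of_lt hj hjn u hv]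
      · rw [b.act_nil hq, b.act_nil hq, map_zero]
    | cons c l ih =>
      intro q
      have hc := b.vec_mem c
      have hk := b.deg_pos c
      have hcv := Q.bracket_mem hc hv
      rw [← b.consW_vec_single]
      rcases Nat.eq_zero_or_pos q with rfl | hq
      · rw [act_zero, act_zero, add_zero, b.act_consW_of_lt hj hjn u hv]
      rcases lt_or_ge q (b.deg c) with hqc | hqc
      · rw [b.act_consW_of_lt hq hqc v hc, b.act_consW_of_lt hq hqc _ hc,
          b.act_consW_of_lt (by omega) (by omega : j + q < n + b.deg c) u
            (Q.graft_mem hq hqc hv hc), Q.graft_graft_left hu hv hc hj hjn hq hqc]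
      · rw [b.act_consW_of_le hk hqc v hc, b.act_consW_of_le hk hqc _ hc, map_add,
          b.act_consW_of_gt hk (by omega) u hc, ← ih (q - b.deg c),
          show j + (q - b.deg c) = j + q - b.deg c by omega]
        congr 1
        split_ifs with h
        · rw [b.act_consW_of_lt (by omega) (by omega : j + q < b.deg c + n) u hcv,
            Q.bracket_graft_right hc hu hv hj hjn, h, add_comm j]
        · rw [map_zero]
  refine LinearMap.congr_fun (f := b.act (j + q) u ∘ₗ b.act q v) (g := b.act q (Q.graft j u v))
    (Finsupp.lhom_ext' fun l => LinearMap.ext_ring ?_) L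
  exact key l q

/-- Sequential law, `u` falling at the end of `v`. Relation 4 applies when `v` is inserted inside
the first letter, relation 1 when it is inserted at its end. -/
theorem act_act_bracket (hu : u ∈ Q.comp m) (hm : 0 < m) (hv : v ∈ Q.comp n) (hn : 0 < n)
    (q : ℕ) (L : List B →₀ K) :
    b.act (n + q) u (b.act q v L) = b.act q (Q.bracket v u) L + b.act q v (b.act q u L) := by
  have key : ∀ l : List B, ∀ q, b.act (n + q) u (b.act q v (Finsupp.single l 1)) =
      b.act q (Q.bracket v u) (Finsupp.single l 1) +
        b.act q v (b.act q u (Finsupp.single l 1)) := by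
    intro l
    induction l with
    | nil =>
      intro q
      rcases Nat.eq_zero_or_pos q with rfl | hq
      · rw [b.act_zero v, b.act_zero v, add_zero, b.act_consW_self hn u hv, b.act_zero,
          b.act_zero]
      · rw [b.act_nil hq, b.act_nil hq, b.act_nil hq, map_zero, map_zero, add_zero]
    | cons c l ih =>
      intro q
      have hc := b.vec_mem c
      have hk := b.deg_pos c
      have hcu := Q.bracket_mem hc hu
      have hcv := Q.bracket_mem hc hv
      rw [← b.consW_vec_single]
      rcases Nat.eq_zero_or_pos q with rfl | hq
      · rw [b.act_zero v, b.act_zero v, add_zero, b.act_consW_self hn u hv, b.act_zero,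
          b.act_zero]
      rcases lt_trichotomy q (b.deg c) with hqc | hqc | hqc
      · rw [b.act_consW_of_lt hq hqc v hc, b.act_consW_of_lt hq hqc _ hc,
          b.act_consW_of_lt hq hqc u hc,
          b.act_consW_of_lt (by omega) (by omega : n + q < n + b.deg c) u
            (Q.graft_mem hq hqc hv hc),
          b.act_consW_of_lt (by omega) (by omega : q < m + b.deg c) v
            (Q.graft_mem hq hqc hu hc), Q.graft_bracket_left hv hu hc hq hqc, map_sub,
          LinearMap.sub_apply, sub_add_cancel]
      · rw [hqc, b.act_consW_self hk v hc, b.act_consW_self hk _ hc, b.act_consW_self hk u hc,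
          map_add, map_add, b.act_consW_of_gt hk (by omega) u hc, Nat.add_sub_cancel,
          add_comm n (b.deg c), b.act_consW_self (by omega) u hcv, b.act_consW_self hk v hc,
          b.act_consW_of_lt hk (by omega : b.deg c < b.deg c + m) v hcu,
          Q.bracket_bracket hc hv hu hk hm, map_add, LinearMap.add_apply]
        have h := ih 0
        rw [add_zero] at h
        rw [h, map_add]
        abel
      · rw [b.act_consW_of_gt hk hqc v hc, b.act_consW_of_gt hk hqc _ hc,
          b.act_consW_of_gt hk hqc u hc, b.act_consW_of_gt hk (by omega) u hc,
          b.act_consW_of_gt hk hqc v hc, ← map_add, ← ih,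
          show n + (q - b.deg c) = n + q - b.deg c by omega]
  refine LinearMap.congr_fun (f := b.act (n + q) u ∘ₗ b.act q v)
    (g := b.act q (Q.bracket v u) + b.act q v ∘ₗ b.act q u)
    (Finsupp.lhom_ext' fun l => LinearMap.ext_ring ?_) L
  exact key l q

end relations

/-- The degree of a word. -/
def wordDeg (l : List B) : ℕ := (l.map b.deg).sum

/-- The space spanned by the words of degree `n`. -/
def words (n : ℕ) : Submodule K (List B →₀ K) := Finsupp.supported K K {l | b.wordDeg l = n}

theorem single_mem_words {n : ℕ} {l : List B} (h : b.wordDeg l = n) :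
    Finsupp.single l (1 : K) ∈ b.words n :=
  Finsupp.single_mem_supported K 1 h

theorem eqOn_words {M : Type*} [AddCommMonoid M] [Module K M] {n : ℕ}
    {f g : (List B →₀ K) →ₗ[K] M}
    (h : ∀ l, b.wordDeg l = n → f (Finsupp.single l 1) = g (Finsupp.single l 1))
    {L : List B →₀ K} (hL : L ∈ b.words n) : f L = g L := by
  rw [words, Finsupp.supported_eq_span_single] at hL
  refine LinearMap.eqOn_span (f := f) (g := g) ?_ hL
  rintro _ ⟨l, hl, rfl⟩
  exact h l hl

theorem map_words_mem {M : Type*} [AddCommMonoid M] [Module K M] {n : ℕ}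
    {f : (List B →₀ K) →ₗ[K] M} {S : Submodule K M}
    (h : ∀ l, b.wordDeg l = n → f (Finsupp.single l 1) ∈ S)
    {L : List B →₀ K} (hL : L ∈ b.words n) : f L ∈ S := by
  rw [words, Finsupp.supported_eq_span_single] at hL
  have : Submodule.span K ((fun l => Finsupp.single l (1 : K)) '' {l | b.wordDeg l = n}) ≤
      S.comap f := by
    refine Submodule.span_le.2 ?_
    rintro _ ⟨l, hl, rfl⟩
    exact h l hl
  exact this hL

theorem consW_mem {m n : ℕ} (hm : 0 < m) {w : W} (hw : w ∈ Q.comp m) {L : List B →₀ K}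
    (hL : L ∈ b.words n) : b.consW w L ∈ b.words (m + n) := by
  have h : Submodule.span K (b.vec '' {c | b.deg c = m}) ≤
      (b.words (m + n)).comap (b.consW.flip L) := by
    refine Submodule.span_le.2 ?_
    rintro _ ⟨c, hc, rfl⟩
    rw [SetLike.mem_coe, Submodule.mem_comap, LinearMap.flip_apply]
    refine b.map_words_mem (f := b.consW (b.vec c)) (fun l hl => ?_) hL
    rw [consW_vec_single]
    refine b.single_mem_words ?_
    rw [← hl, ← show b.deg c = m from hc]
    simp [wordDeg]
  exact Submodule.mem_comap.1 (h (b.comp_le m hm hw))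

theorem act_mem {i m n : ℕ} (hm : 0 < m) {u : W} (hu : u ∈ Q.comp m) {L : List B →₀ K}
    (hL : L ∈ b.words n) : b.act i u L ∈ b.words (m + n) := by
  refine b.map_words_mem (f := b.act i u) (fun l hl => ?_) hL
  clear hL
  induction l generalizing i n with
  | nil =>
    rcases Nat.eq_zero_or_pos i with rfl | hi
    · rw [act_zero]
      exact b.consW_mem hm hu (b.single_mem_words hl)
    · rw [b.act_nil hi]
      exact zero_mem _
  | cons c l ih =>
    rcases Nat.eq_zero_or_pos i with rfl | hi
    · rw [act_zero]
      exact b.consW_mem hm hu (b.single_mem_words hl)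
    have hn : n = b.deg c + b.wordDeg l := by
      rw [← hl]
      simp [wordDeg]
    have hl' := b.single_mem_words (rfl : b.wordDeg l = _)
    have hk := b.deg_pos c
    rw [← b.consW_vec_single]
    rcases lt_or_ge i (b.deg c) with hic | hic
    · rw [b.act_consW_of_lt hi hic u (b.vec_mem c), hn, ← add_assoc]
      exact b.consW_mem (by omega) (Q.graft_mem hi hic hu (b.vec_mem c)) hl'
    · rw [b.act_consW_of_le hk hic u (b.vec_mem c)]
      refine add_mem ?_ ?_
      · split_ifs
        · rw [hn, ← add_assoc, add_comm m]
          exact b.consW_mem (by omega) (Q.bracket_mem (b.vec_mem c) hu) hl'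
        · exact zero_mem _
      · rw [hn, add_left_comm]
        exact b.consW_mem hk (b.vec_mem c) (ih rfl)

/-- The product `∘_i` by a word: the successive insertion of its letters. -/
def wordAct (i : ℕ) : List B → (List B →₀ K) →ₗ[K] (List B →₀ K)
  | [] => LinearMap.id
  | c :: l => b.act i (b.vec c) ∘ₗ wordAct i l

/-- The product `∘_i` on the space spanned by the words. -/
def op (i : ℕ) : (List B →₀ K) →ₗ[K] (List B →₀ K) →ₗ[K] (List B →₀ K) :=
  Finsupp.linearCombination K (b.wordAct i)

theorem op_nil (i : ℕ) (L : List B →₀ K) : b.op i (Finsupp.single [] 1) L = L := by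
  simp [op, wordAct]

theorem op_cons (i : ℕ) (c : B) (l : List B) (L : List B →₀ K) :
    b.op i (Finsupp.single (c :: l) 1) L =
      b.act i (b.vec c) (b.op i (Finsupp.single l 1) L) := by
  simp [op, wordAct]

theorem op_consW (i : ℕ) {n : ℕ} (hn : 0 < n) {w : W} (hw : w ∈ Q.comp n) (U L : List B →₀ K) :
    b.op i (b.consW w U) L = b.act i w (b.op i U L) := by
  refine b.eqOn_comp hn (f := (b.op i).flip L ∘ₗ b.consW.flip U)
    (g := (b.actLin i).flip (b.op i U L)) (fun c hc => ?_) hw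
  refine LinearMap.congr_fun (f := (b.op i).flip L ∘ₗ b.consW (b.vec c))
    (g := b.act i (b.vec c) ∘ₗ (b.op i).flip L) (Finsupp.lhom_ext' fun l => LinearMap.ext_ring ?_) U
  simp only [LinearMap.comp_apply, Finsupp.lsingle_apply, LinearMap.flip_apply]
  rw [consW_vec_single, op_cons]

theorem op_mem {i m n : ℕ} {U L : List B →₀ K} (hU : U ∈ b.words m) (hL : L ∈ b.words n) :
    b.op i U L ∈ b.words (m + n) := by
  refine b.map_words_mem (f := (b.op i).flip L) (fun l hl => ?_) hU
  rw [LinearMap.flip_apply]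
  clear hU
  induction l generalizing m with
  | nil =>
    rw [op_nil, ← hl]
    simpa [wordDeg] using hL
  | cons c l ih =>
    rw [op_cons, ← hl]
    have := b.act_mem (i := i) (b.deg_pos c) (b.vec_mem c) (ih rfl)
    rw [← add_assoc] at this
    simpa [wordDeg] using this

theorem act_op_comm {m n : ℕ} {u : W} (hu : u ∈ Q.comp m) (hm : 0 < m) {i j : ℕ}
    (hij : j + n < i) {V : List B →₀ K} (hV : V ∈ b.words n) (L : List B →₀ K) :
    b.act i u (b.op j V L) = b.op j V (b.act (i - n) u L) := by
  refine b.eqOn_words (f := b.act i u ∘ₗ (b.op j).flip L)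
    (g := (b.op j).flip (b.act (i - n) u L)) (fun l hl => ?_) hV
  simp only [LinearMap.comp_apply, LinearMap.flip_apply]
  clear hV
  induction l generalizing i n with
  | nil =>
    obtain rfl : n = 0 := by rw [← hl]; simp [wordDeg]
    rw [op_nil, op_nil, Nat.sub_zero]
  | cons c l ih =>
    have hn : n = b.deg c + b.wordDeg l := by
      rw [← hl]
      simp [wordDeg]
    rw [op_cons, op_cons, b.act_act_comm hu hm (b.vec_mem c) (b.deg_pos c) (by omega),
      ih (n := b.wordDeg l) (by omega) rfl, hn, Nat.sub_sub]

theorem op_op_comm {n i j : ℕ} (hij : j + n < i) (U : List B →₀ K) {V : List B →₀ K}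
    (hV : V ∈ b.words n) (L : List B →₀ K) :
    b.op i U (b.op j V L) = b.op j V (b.op (i - n) U L) := by
  refine LinearMap.congr_fun (f := (b.op i).flip (b.op j V L))
    (g := b.op j V ∘ₗ (b.op (i - n)).flip L) (Finsupp.lhom_ext' fun l => LinearMap.ext_ring ?_) U
  simp only [LinearMap.comp_apply, Finsupp.lsingle_apply, LinearMap.flip_apply]
  induction l with
  | nil => rw [op_nil, op_nil]
  | cons c l ih => rw [op_cons, op_cons, ih, b.act_op_comm (b.vec_mem c) (b.deg_pos c) hij hV]

/-- Induction on the word `V`: the position `j` is inside, at the end of, or beyond its first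
letter, which calls for `act_act_graft`, `act_act_bracket` or `act_act_comm`. -/
theorem act_op_assoc {m n : ℕ} {u : W} (hu : u ∈ Q.comp m) (hm : 0 < m) {j : ℕ} (q : ℕ)
    (hj : j ≤ n) {V : List B →₀ K} (hV : V ∈ b.words n) (L : List B →₀ K) :
    b.act (j + q) u (b.op q V L) = b.op q (b.act j u V) L := by
  refine b.eqOn_words (f := b.act (j + q) u ∘ₗ (b.op q).flip L)
    (g := (b.op q).flip L ∘ₗ b.act j u) (fun l hl => ?_) hV
  simp only [LinearMap.comp_apply, LinearMap.flip_apply]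
  clear hV
  rcases Nat.eq_zero_or_pos j with rfl | hj0
  · rw [b.act_zero, zero_add, b.op_consW q hm hu]
  induction l generalizing j n with
  | nil =>
    have : n = 0 := by rw [← hl]; simp [wordDeg]
    omega
  | cons c l ih =>
    have hn : n = b.deg c + b.wordDeg l := by
      rw [← hl]
      simp [wordDeg]
    have hc := b.vec_mem c
    have hk := b.deg_pos c
    rw [b.op_cons, ← b.consW_vec_single]
    rcases lt_trichotomy j (b.deg c) with hjc | hjc | hjc
    · rw [b.act_act_graft hu hc hj0 hjc, b.act_consW_of_lt hj0 hjc u hc,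
        b.op_consW q (by omega) (Q.graft_mem hj0 hjc hu hc)]
    · rw [hjc, b.act_act_bracket hu hm hc hk, b.act_consW_self hk u hc, map_add,
        LinearMap.add_apply, b.op_consW q (by omega) (Q.bracket_mem hc hu),
        b.op_consW q hk hc, b.act_zero, b.op_consW q hm hu]
    · rw [b.act_act_comm hu hm hc hk (by omega), b.act_consW_of_gt hk hjc u hc,
        b.op_consW q hk hc, ← ih (n := b.wordDeg l) (by omega) rfl (by omega),
        show j - b.deg c + q = j + q - b.deg c by omega]

theorem op_op_assoc {n j : ℕ} (q : ℕ) (hj : j ≤ n) (U : List B →₀ K) {V : List B →₀ K}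
    (hV : V ∈ b.words n) (L : List B →₀ K) :
    b.op (j + q) U (b.op q V L) = b.op q (b.op j U V) L := by
  refine LinearMap.congr_fun (f := (b.op (j + q)).flip (b.op q V L))
    (g := (b.op q).flip L ∘ₗ (b.op j).flip V) (Finsupp.lhom_ext' fun l => LinearMap.ext_ring ?_) U
  simp only [LinearMap.comp_apply, Finsupp.lsingle_apply, LinearMap.flip_apply]
  induction l with
  | nil => rw [op_nil, op_nil]
  | cons c l ih =>
    rw [op_cons, op_cons, ih, b.act_op_assoc (b.vec_mem c) (b.deg_pos c) q
      (n := b.wordDeg l + n) (by omega) (b.op_mem (b.single_mem_words rfl) hV)]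

end PositiveBasis

end PrimGrAlgebra

end

/-! ### Evaluation of trees in words -/

noncomputable section

namespace PrimGrAlgebra.PositiveBasis

variable {K W B : Type*} [Field K] [AddCommGroup W] [Module K W] {Q : PrimGrAlgebra K W}
  (b : PositiveBasis Q B)

/-- The simultaneous insertion of `V 0, …, V (k - 1)` in `g`. -/
def chain (V : ℕ → List B →₀ K) : ℕ → (List B →₀ K) → List B →₀ K
  | 0, g => g
  -- Insertions proceed from right to left, so that position `k` is not shifted by those already
  -- made.
  | k + 1, g => chain V k (b.op k (V k) g)

theorem chain_congr {V V' : ℕ → List B →₀ K} {k : ℕ} (h : ∀ j < k, V j = V' j)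
    (g : List B →₀ K) : b.chain V k g = b.chain V' k g := by
  induction k generalizing g with
  | zero => rfl
  | succ k ih => rw [chain, chain, h k (by omega), ih fun j hj => h j (by omega)]

theorem chain_nil (k : ℕ) (g : List B →₀ K) :
    b.chain (fun _ => Finsupp.single [] 1) k g = g := by
  induction k generalizing g with
  | zero => rfl
  | succ k ih => rw [chain, b.op_nil, ih]

theorem chain_mem {V : ℕ → List B →₀ K} {d : ℕ → ℕ} (hV : ∀ j, V j ∈ b.words (d j)) (k : ℕ)
    {n : ℕ} {g : List B →₀ K} (hg : g ∈ b.words n) :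
    b.chain V k g ∈ b.words (n + ∑ j ∈ Finset.range k, d j) := by
  induction k generalizing g n with
  | zero => exact hg
  | succ k ih =>
    rw [chain, Finset.sum_range_succ, ← add_assoc, add_right_comm, add_comm n]
    exact ih (b.op_mem (hV k) hg)

theorem op_chain {V : ℕ → List B →₀ K} {d : ℕ → ℕ} (hV : ∀ j, V j ∈ b.words (d j)) (U : List B →₀ K)
    {k i : ℕ} (hi : ∑ j ∈ Finset.range k, (d j + 1) ≤ i) (g : List B →₀ K) :
    b.op i U (b.chain V k g) = b.chain V k (b.op (i - ∑ j ∈ Finset.range k, d j) U g) := by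
  induction k generalizing g with
  | zero => rfl
  | succ k ih =>
    have h : ∑ j ∈ Finset.range k, (d j + 1) = ∑ j ∈ Finset.range k, d j + k := by
      simp [Finset.sum_add_distrib]
    rw [Finset.sum_range_succ] at hi ⊢
    rw [chain, chain, ih (by omega), b.op_op_comm (by omega) U (hV k), Nat.sub_sub]

/-- This is the analogue of `graftAt_nodeN`: an insertion in the range of the `k`-th inserted
element passes through the earlier positions by the parallel law and enters `V k` by the sequential
law. -/
theorem op_chain_update {V : ℕ → List B →₀ K} {d : ℕ → ℕ} (hV : ∀ j, V j ∈ b.words (d j))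
    (U : List B →₀ K) {k m i : ℕ} (hk : k < m) (h1 : ∑ j ∈ Finset.range k, (d j + 1) ≤ i)
    (h2 : i ≤ ∑ j ∈ Finset.range k, (d j + 1) + d k) (g : List B →₀ K) :
    b.op i U (b.chain V m g) = b.chain
      (Function.update V k (b.op (i - ∑ j ∈ Finset.range k, (d j + 1)) U (V k))) m g := by
  induction m generalizing g with
  | zero => omega
  | succ m ih =>
    rw [chain, chain]
    rcases Nat.lt_succ_iff_lt_or_eq.1 hk with h | rfl
    · rw [ih h, Function.update_of_ne h.ne']
    · have h : ∑ j ∈ Finset.range k, (d j + 1) = ∑ j ∈ Finset.range k, d j + k := by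
        simp [Finset.sum_add_distrib]
      rw [Function.update_self, b.op_chain hV U h1,
        -- The leaf offset exceeds the sum of the degrees by `k`, which is the position where `V k`
        -- is inserted.
        show i - ∑ j ∈ Finset.range k, d j = i - ∑ j ∈ Finset.range k, (d j + 1) + k by omega,
        b.op_op_assoc k (by omega) U (hV k)]
      exact b.chain_congr (fun j hj => (Function.update_of_ne hj.ne _ _).symm) _

theorem op_zero_nil (U : List B →₀ K) : b.op 0 U (Finsupp.single [] 1) = U := by
  refine LinearMap.congr_fun (f := (b.op 0).flip (Finsupp.single [] 1)) (g := LinearMap.id)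
    (Finsupp.lhom_ext' fun l => LinearMap.ext_ring ?_) U
  simp only [LinearMap.comp_apply, Finsupp.lsingle_apply, LinearMap.flip_apply, LinearMap.id_apply]
  induction l with
  | nil => rw [b.op_nil]
  | cons c l ih => rw [b.op_cons, ih, b.act_zero, b.consW_vec_single]

section trees

variable {X : Type*} {deg : X → ℕ} (G : X → List B →₀ K)

/-- The combination of words obtained from a tree when its vertices are replaced by the values
of `G`. -/
def evalTree : PTree deg → List B →₀ K
  | .leaf => Finsupp.single [] 1
  | .node x c => b.chain (fun j => if h : j < deg x + 1 then evalTree (c ⟨j, h⟩) else 0)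
      (deg x + 1) (G x)

theorem evalTree_leaf : b.evalTree G (.leaf : PTree deg) = Finsupp.single [] 1 := by
  rw [evalTree]

theorem evalTree_nodeN (x : X) (C : ℕ → PTree deg) :
    b.evalTree G (PTree.nodeN x C) = b.chain (fun j => b.evalTree G (C j)) (deg x + 1) (G x) := by
  rw [PTree.nodeN, evalTree]
  refine b.chain_congr (fun j hj => ?_) _
  exact dif_pos hj

theorem evalTree_mem {G : X → List B →₀ K} (hG : ∀ x, G x ∈ b.words (deg x)) (t : PTree deg) :
    b.evalTree G t ∈ b.words t.degree := by
  induction t using PTree.induction_nodeN with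
  | leaf =>
    rw [evalTree_leaf]
    exact b.single_mem_words rfl
  | node x C ih =>
    have h := PTree.degree_nodeN_add_one x C
    rw [PTree.offset, Finset.sum_add_distrib] at h
    simp only [Finset.sum_const, Finset.card_range, smul_eq_mul, mul_one] at h
    rw [evalTree_nodeN, show (PTree.nodeN x C).degree =
      deg x + ∑ j ∈ Finset.range (deg x + 1), (C j).degree by omega]
    exact b.chain_mem ih _ (hG x)

theorem evalTree_graftAt {G : X → List B →₀ K} (hG : ∀ x, G x ∈ b.words (deg x)) (t w : PTree deg)
    {i : ℕ} (hi : i ≤ w.degree) :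
    b.evalTree G (PTree.graftAt t i w) = b.op i (b.evalTree G t) (b.evalTree G w) := by
  induction w using PTree.induction_nodeN generalizing i with
  | leaf =>
    obtain rfl : i = 0 := by simpa using hi
    rw [PTree.graftAt_leaf, evalTree_leaf, op_zero_nil]
  | node x C ih =>
    obtain ⟨k, hk, h1, h2⟩ := PTree.exists_slot x C hi
    rw [PTree.graftAt_nodeN t hk h1 h2, evalTree_nodeN, evalTree_nodeN,
      b.op_chain_update (fun j => b.evalTree_mem hG (C j)) _ (Nat.lt_succ_of_le hk) h1 h2]
    refine b.chain_congr (fun j _ => ?_) _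
    rcases eq_or_ne j k with rfl | hj
    · rw [Function.update_self, Function.update_self]
      exact ih j (Nat.sub_le_iff_le_add'.2 h2)
    · rw [Function.update_of_ne hj, Function.update_of_ne hj]

/-- The linear extension of `evalTree`. -/
def eval : TreeSpace K deg →ₗ[K] List B →₀ K :=
  Finsupp.linearCombination K fun t => b.evalTree G t.1

theorem eval_single (t : NTree deg) : b.eval G (Finsupp.single t 1) = b.evalTree G t.1 := by
  simp [eval]

theorem eval_corolla (x : X) : b.eval G (TreeSpace.corolla K deg x) = G x := by
  rw [TreeSpace.corolla, eval_single]
  refine (b.evalTree_nodeN G x fun _ => PTree.leaf).trans ?_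
  simp only [evalTree_leaf]
  exact b.chain_nil _ _

variable {G} (hG : ∀ x, G x ∈ b.words (deg x))
include hG

theorem eval_mem {n : ℕ} {z : TreeSpace K deg} (hz : z ∈ TreeSpace.homog K deg n) :
    b.eval G z ∈ b.words n := by
  refine TreeSpace.map_homog_mem (f := b.eval G) (fun t ht => ?_) hz
  rw [eval_single, ← ht]
  exact b.evalTree_mem hG t.1

theorem eval_graft {i n : ℕ} (hi : i ≤ n) (y : TreeSpace K deg) {z : TreeSpace K deg}
    (hz : z ∈ TreeSpace.homog K deg n) :
    b.eval G (TreeSpace.graft K deg i y z) = b.op i (b.eval G y) (b.eval G z) := by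
  refine TreeSpace.eqOn_homog (f := b.eval G ∘ₗ TreeSpace.graft K deg i y)
    (g := b.op i (b.eval G y) ∘ₗ b.eval G) (fun w hw => ?_) hz
  refine LinearMap.congr_fun (f := b.eval G ∘ₗ (TreeSpace.graft K deg i).flip (Finsupp.single w 1))
    (g := (b.op i).flip (b.eval G (Finsupp.single w 1)) ∘ₗ b.eval G)
    (Finsupp.lhom_ext' fun t => LinearMap.ext_ring ?_) y
  simp only [LinearMap.comp_apply, Finsupp.lsingle_apply, LinearMap.flip_apply]
  rw [TreeSpace.graft_single_of_le (by omega), eval_single, eval_single, eval_single]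
  exact b.evalTree_graftAt hG t.1 w.1 (by omega)

theorem eval_graft_zero (y z : TreeSpace K deg) :
    b.eval G (TreeSpace.graft K deg 0 y z) = b.op 0 (b.eval G y) (b.eval G z) := by
  refine LinearMap.congr_fun (f := b.eval G ∘ₗ TreeSpace.graft K deg 0 y)
    (g := b.op 0 (b.eval G y) ∘ₗ b.eval G) (Finsupp.lhom_ext' fun w => LinearMap.ext_ring ?_) z
  exact b.eval_graft hG (Nat.zero_le _) y (TreeSpace.single_mem_homog rfl 1)

end trees

end PrimGrAlgebra.PositiveBasis

end

/-! ### Words of length one and the images of the generators -/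

noncomputable section

theorem LinearMap.eqOn_span₂ {K M N P : Type*} [Field K] [AddCommGroup M] [Module K M]
    [AddCommGroup N] [Module K N] [AddCommGroup P] [Module K P] {f g : M →ₗ[K] N →ₗ[K] P}
    {s : Set M} {t : Set N} (h : ∀ x ∈ s, ∀ y ∈ t, f x y = g x y) {x : M}
    (hx : x ∈ Submodule.span K s) {y : N} (hy : y ∈ Submodule.span K t) : f x y = g x y := by
  refine LinearMap.eqOn_span (f := f.flip y) (g := g.flip y) (fun x hx => ?_) hx
  exact LinearMap.eqOn_span (f := f x) (g := g x) (h x hx) hy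

namespace PrimGrAlgebra.PositiveBasis

variable {K W B : Type*} [Field K] [AddCommGroup W] [Module K W] {Q : PrimGrAlgebra K W}
  (b : PositiveBasis Q B)

/-- The element of `W` seen as a combination of words of length one. -/
def letterOf : W →ₗ[K] List B →₀ K := b.consW.flip (Finsupp.single [] 1)

theorem letterOf_apply (w : W) : b.letterOf w = b.consW w (Finsupp.single [] 1) := rfl

theorem letterOf_vec (c : B) : b.letterOf (b.vec c) = Finsupp.single [c] 1 :=
  b.consW_vec_single c []

/-- The space spanned by the words of length one. -/
def letters (_b : PositiveBasis Q B) : Submodule K (List B →₀ K) :=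
  Submodule.span K (Set.range fun c => Finsupp.single [c] 1)

theorem letterOf_mem (w : W) : b.letterOf w ∈ b.letters := by
  have h : ∀ F : B →₀ K, Finsupp.linearCombination K
      (fun c => Finsupp.lmapDomain K K (List.cons c)) F (Finsupp.single [] 1) ∈ b.letters := by
    intro F
    rw [Finsupp.linearCombination_apply, Finsupp.sum, LinearMap.sum_apply]
    refine sum_mem fun c _ => ?_
    rw [LinearMap.smul_apply]
    refine Submodule.smul_mem _ _ (Submodule.subset_span ⟨c, ?_⟩)
    simp
  exact h (b.coord w)

/-- The projection on `W` of the words of length one. -/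
def ofLetters : (List B →₀ K) →ₗ[K] W :=
  Finsupp.linearCombination K fun
    | [c] => b.vec c
    | _ => 0

theorem ofLetters_single (c : B) : b.ofLetters (Finsupp.single [c] 1) = b.vec c := by
  simp [ofLetters]

theorem ofLetters_letterOf {n : ℕ} (hn : 0 < n) {w : W} (hw : w ∈ Q.comp n) :
    b.ofLetters (b.letterOf w) = w := by
  refine b.eqOn_comp hn (f := b.ofLetters ∘ₗ b.letterOf) (g := LinearMap.id) (fun c _ => ?_) hw
  rw [LinearMap.comp_apply, letterOf_vec, ofLetters_single, LinearMap.id_apply]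

/-- Both subspaces are spanned by words, so their intersection is spanned by the common ones. -/
theorem letters_inf_words (n : ℕ) : b.letters ⊓ b.words n =
    Submodule.span K ((fun c => Finsupp.single [c] 1) '' {c | b.deg c = n}) := by
  have h : b.letters = Finsupp.supported K K (Set.range fun c : B => [c]) := by
    rw [Finsupp.supported_eq_span_single, ← Set.range_comp]
    rfl
  rw [h, words, ← Finsupp.supported_inter, Finsupp.supported_eq_span_single]
  congr 1
  ext L
  simp only [Set.mem_image, Set.mem_inter_iff, Set.mem_range, Set.mem_ofPred_eq]
  constructor
  · rintro ⟨_, ⟨⟨c, rfl⟩, hc⟩, rfl⟩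
    exact ⟨c, by simpa [wordDeg] using hc, rfl⟩
  · rintro ⟨c, hc, rfl⟩
    exact ⟨[c], ⟨⟨c, rfl⟩, by simpa [wordDeg] using hc⟩, rfl⟩

theorem ofLetters_mem {n : ℕ} {Z : List B →₀ K} (hZ : Z ∈ b.letters) (hn : Z ∈ b.words n) :
    b.ofLetters Z ∈ Q.comp n := by
  have h := b.letters_inf_words n ▸ Submodule.mem_inf.2 ⟨hZ, hn⟩
  have h' : Submodule.span K ((fun c => Finsupp.single [c] 1) '' {c | b.deg c = n}) ≤
      (Q.comp n).comap b.ofLetters := by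
    refine Submodule.span_le.2 ?_
    rintro _ ⟨c, hc, rfl⟩
    rw [SetLike.mem_coe, Submodule.mem_comap, ofLetters_single, ← show b.deg c = n from hc]
    exact b.vec_mem c
  exact h' h

/-- The operation `{-, -}` on the space spanned by the words. -/
def wordBracket : (List B →₀ K) →ₗ[K] (List B →₀ K) →ₗ[K] (List B →₀ K) :=
  Finsupp.linearCombination K (fun l => (b.op (b.wordDeg l)).flip (Finsupp.single l 1)) +
    (-1 : K) • b.op 0

theorem wordBracket_eq {n : ℕ} {Z : List B →₀ K} (hZ : Z ∈ b.words n) (Z' : List B →₀ K) :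
    b.wordBracket Z Z' = b.op n Z' Z - b.op 0 Z Z' := by
  refine b.eqOn_words (f := b.wordBracket.flip Z') (g := b.op n Z' - (b.op 0).flip Z')
    (fun l hl => ?_) hZ
  simp [wordBracket, hl, sub_eq_add_neg]

theorem op_letter (i : ℕ) (c : B) (L : List B →₀ K) :
    b.op i (Finsupp.single [c] 1) L = b.act i (b.vec c) L := by
  rw [b.op_cons, b.op_nil]

/-- For letters, inserting d at the end of c gives {c, d} plus the word cd, and subtracting c ∘_0 d
= cd leaves the letter {c, d}. -/
theorem wordBracket_letters {Z Z' : List B →₀ K} (hZ : Z ∈ b.letters) (hZ' : Z' ∈ b.letters) :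
    b.wordBracket Z Z' ∈ b.letters ∧
      b.ofLetters (b.wordBracket Z Z') = Q.bracket (b.ofLetters Z) (b.ofLetters Z') := by
  have h1 : b.wordBracket Z Z' = b.letterOf (Q.bracket (b.ofLetters Z) (b.ofLetters Z')) := by
    refine LinearMap.eqOn_span₂ (f := b.wordBracket)
      (g := (Q.bracket.compl₁₂ b.ofLetters b.ofLetters).compr₂ b.letterOf) ?_ hZ hZ'
    rintro _ ⟨c, rfl⟩ _ ⟨d, rfl⟩
    simp only [LinearMap.compr₂_apply, LinearMap.compl₁₂_apply, ofLetters_single]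
    rw [b.wordBracket_eq (n := b.deg c) (b.single_mem_words (by simp [wordDeg])), op_letter,
      op_letter, b.act_zero, ← b.consW_vec_single c [],
      b.act_consW_self (b.deg_pos c) _ (b.vec_mem c), b.act_zero, b.consW_vec_single d [],
      add_sub_cancel_right, letterOf_apply]
  -- `ofLetters` is known to invert `letterOf` only on homogeneous elements of positive degree,
  -- hence the check on basis vectors.
  have h2 : b.ofLetters (b.letterOf (Q.bracket (b.ofLetters Z) (b.ofLetters Z'))) =
      Q.bracket (b.ofLetters Z) (b.ofLetters Z') := by
    refine LinearMap.eqOn_span₂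
      (f := (Q.bracket.compl₁₂ b.ofLetters b.ofLetters).compr₂ (b.ofLetters ∘ₗ b.letterOf))
      (g := Q.bracket.compl₁₂ b.ofLetters b.ofLetters) ?_ hZ hZ'
    rintro _ ⟨c, rfl⟩ _ ⟨d, rfl⟩
    simp only [LinearMap.compr₂_apply, LinearMap.compl₁₂_apply, ofLetters_single]
    have := b.deg_pos c
    exact b.ofLetters_letterOf (by omega) (Q.bracket_mem (b.vec_mem c) (b.vec_mem d))
  rw [h1]
  exact ⟨b.letterOf_mem _, h2⟩

theorem op_letters {p n : ℕ} (hp : 1 ≤ p) (hpn : p < n) {Z Z' : List B →₀ K} (hZ : Z ∈ b.letters)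
    (hZ' : Z' ∈ b.letters) (hn : Z' ∈ b.words n) :
    b.op p Z Z' ∈ b.letters ∧
      b.ofLetters (b.op p Z Z') = Q.graft p (b.ofLetters Z) (b.ofLetters Z') := by
  have hn' := b.letters_inf_words n ▸ Submodule.mem_inf.2 ⟨hZ', hn⟩
  have h1 : b.op p Z Z' = b.letterOf (Q.graft p (b.ofLetters Z) (b.ofLetters Z')) := by
    refine LinearMap.eqOn_span₂ (f := b.op p)
      (g := ((Q.graft p).compl₁₂ b.ofLetters b.ofLetters).compr₂ b.letterOf) ?_ hZ hn'
    rintro _ ⟨c, rfl⟩ _ ⟨d, hd, rfl⟩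
    simp only [LinearMap.compr₂_apply, LinearMap.compl₁₂_apply, ofLetters_single]
    obtain rfl : b.deg d = n := hd
    rw [op_letter, ← b.consW_vec_single d [], b.act_consW_of_lt hp hpn _ (b.vec_mem d),
      letterOf_apply]
  have h2 : b.ofLetters (b.letterOf (Q.graft p (b.ofLetters Z) (b.ofLetters Z'))) =
      Q.graft p (b.ofLetters Z) (b.ofLetters Z') := by
    refine LinearMap.eqOn_span₂
      (f := ((Q.graft p).compl₁₂ b.ofLetters b.ofLetters).compr₂ (b.ofLetters ∘ₗ b.letterOf))
      (g := (Q.graft p).compl₁₂ b.ofLetters b.ofLetters) ?_ hZ hn'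
    rintro _ ⟨c, rfl⟩ _ ⟨d, hd, rfl⟩
    simp only [LinearMap.compr₂_apply, LinearMap.compl₁₂_apply, ofLetters_single]
    obtain rfl : b.deg d = n := hd
    have := b.deg_pos c
    exact b.ofLetters_letterOf (by omega) (Q.graft_mem hp hpn (b.vec_mem c) (b.vec_mem d))
  rw [h1]
  exact ⟨b.letterOf_mem _, h2⟩

variable {X : Type*} {deg : X → ℕ}

theorem eval_bracket {G : X → List B →₀ K} (hG : ∀ x, G x ∈ b.words (deg x))
    (y z : TreeSpace K deg) :
    b.eval G (TreeSpace.bracket K deg y z) = b.wordBracket (b.eval G y) (b.eval G z) := by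
  refine LinearMap.congr_fun (f := b.eval G ∘ₗ (TreeSpace.bracket K deg).flip z)
    (g := b.wordBracket.flip (b.eval G z) ∘ₗ b.eval G)
    (Finsupp.lhom_ext' fun t => LinearMap.ext_ring ?_) y
  have ht : (Finsupp.single t 1 : TreeSpace K deg) ∈ TreeSpace.homog K deg t.1.degree :=
    TreeSpace.single_mem_homog rfl 1
  simp only [LinearMap.comp_apply, Finsupp.lsingle_apply, LinearMap.flip_apply]
  rw [TreeSpace.bracket_eq z ht, map_sub, b.eval_graft hG le_rfl z ht, b.eval_graft_zero hG,
    b.wordBracket_eq (b.eval_mem hG ht)]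

section generators

variable (hdeg : ∀ x, 0 < deg x) {Θ : (X →₀ K) →ₗ[K] (X →₀ K) ⊗[K] (X →₀ K)}
  (hΘ : IsGradedCoproduct deg Θ)

/-- The approximations of the combination of words `g x` with
`g x = f x + ∑ f (x_(1)) g (x_(2))`. -/
def generatorAux (Θ : (X →₀ K) →ₗ[K] (X →₀ K) ⊗[K] (X →₀ K)) (f : (X →₀ K) →ₗ[K] W) :
    ℕ → (X →₀ K) →ₗ[K] List B →₀ K
  | 0 => 0
  | N + 1 => b.letterOf ∘ₗ f +
      TensorProduct.lift b.consW ∘ₗ TensorProduct.map f (generatorAux Θ f N) ∘ₗ Θ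

include hdeg hΘ

theorem eq_of_graded {M : Type*} [AddCommMonoid M] [Module K M]
    {F F' : (X →₀ K) ⊗[K] (X →₀ K) →ₗ[K] M} (x : X)
    (h : ∀ y z, 0 < deg y → deg y + deg z = deg x →
      F (Finsupp.single y 1 ⊗ₜ Finsupp.single z 1) = F' (Finsupp.single y 1 ⊗ₜ Finsupp.single z 1)) :
    F (Θ (Finsupp.single x 1)) = F' (Θ (Finsupp.single x 1)) := by
  refine LinearMap.eqOn_span (f := F) (g := F') ?_ (hΘ x)
  rintro _ ⟨y, z, hyz, rfl⟩
  exact h y z (hdeg y) hyz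

/-- In the recursive term the second factor of `Θ x` has degree less than `|x|`, so the
approximations are constant on `x` from stage `|x|` on. -/
theorem generatorAux_stable (f : (X →₀ K) →ₗ[K] W) {N M : ℕ} {x : X} (hN : deg x ≤ N)
    (hM : deg x ≤ M) : b.generatorAux Θ f N (Finsupp.single x 1) =
      b.generatorAux Θ f M (Finsupp.single x 1) := by
  have hx := hdeg x
  induction N generalizing M x with
  | zero => omega
  | succ N ih =>
    obtain ⟨M, rfl⟩ := Nat.exists_eq_succ_of_ne_zero (show M ≠ 0 by omega)
    simp only [generatorAux, LinearMap.add_apply, LinearMap.comp_apply]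
    congr 1
    refine eq_of_graded hdeg hΘ
      (F := TensorProduct.lift b.consW ∘ₗ TensorProduct.map f (b.generatorAux Θ f N))
      (F' := TensorProduct.lift b.consW ∘ₗ TensorProduct.map f (b.generatorAux Θ f M)) x
      fun y z hy hyz => ?_
    simp only [LinearMap.comp_apply, TensorProduct.map_tmul]
    rw [ih (M := M) (by omega) (by omega) (hdeg z)]

theorem exists_generator (f : (X →₀ K) →ₗ[K] W) : ∃ g : (X →₀ K) →ₗ[K] List B →₀ K,
    g = b.letterOf ∘ₗ f + TensorProduct.lift b.consW ∘ₗ TensorProduct.map f g ∘ₗ Θ := by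
  refine ⟨Finsupp.linearCombination K fun x => b.generatorAux Θ f (deg x) (Finsupp.single x 1), ?_⟩
  refine Finsupp.lhom_ext' fun x => LinearMap.ext_ring ?_
  simp only [LinearMap.comp_apply, Finsupp.lsingle_apply, LinearMap.add_apply,
    Finsupp.linearCombination_single, one_smul]
  rw [b.generatorAux_stable hdeg hΘ f le_rfl (Nat.le_succ (deg x))]
  simp only [generatorAux, LinearMap.add_apply, LinearMap.comp_apply]
  congr 1
  refine eq_of_graded hdeg hΘ
    (F := TensorProduct.lift b.consW ∘ₗ TensorProduct.map f (b.generatorAux Θ f (deg x)))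
    (F' := TensorProduct.lift b.consW ∘ₗ TensorProduct.map f (Finsupp.linearCombination K
      fun x => b.generatorAux Θ f (deg x) (Finsupp.single x 1))) x fun y z hy hyz => ?_
  simp only [LinearMap.comp_apply, TensorProduct.map_tmul, Finsupp.linearCombination_single,
    one_smul]
  rw [b.generatorAux_stable hdeg hΘ f le_rfl (by omega : deg z ≤ deg x)]

variable {f : (X →₀ K) →ₗ[K] W} (hf : ∀ x, f (Finsupp.single x 1) ∈ Q.comp (deg x))
  {g : (X →₀ K) →ₗ[K] List B →₀ K}
  (hg : g = b.letterOf ∘ₗ f + TensorProduct.lift b.consW ∘ₗ TensorProduct.map f g ∘ₗ Θ)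
include hf hg

theorem generator_mem (x : X) : g (Finsupp.single x 1) ∈ b.words (deg x) := by
  induction h : deg x using Nat.strong_induction_on generalizing x with
  | _ n ih =>
    subst h
    rw [hg]
    simp only [LinearMap.add_apply, LinearMap.comp_apply]
    refine add_mem ?_ ?_
    · exact b.consW_mem (hdeg x) (hf x) (b.single_mem_words (n := 0) rfl)
    · have h : Submodule.span K {w | ∃ y z, deg y + deg z = deg x ∧
          w = Finsupp.single y (1 : K) ⊗ₜ[K] Finsupp.single z (1 : K)} ≤
          (b.words (deg x)).comap (TensorProduct.lift b.consW ∘ₗ TensorProduct.map f g) := by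
        refine Submodule.span_le.2 ?_
        rintro _ ⟨y, z, hyz, rfl⟩
        rw [SetLike.mem_coe, Submodule.mem_comap, LinearMap.comp_apply, TensorProduct.map_tmul,
          TensorProduct.lift.tmul, ← hyz]
        have hy := hdeg y
        exact b.consW_mem (hdeg y) (hf y) (ih (deg z) (by omega) z rfl)
      exact h (hΘ x)

/-- The recursion for `e` evaluates to g(x) - ∑ eval(e(x_(1))) g(x_(2)). By induction on the degree
this is g(x) - ∑ f(x_(1)) g(x_(2)), which is f(x) by the choice of `g`. -/
theorem eval_eMap_corolla (x : X) :
    b.eval (fun x => g (Finsupp.single x 1)) (TreeSpace.eMap Θ (TreeSpace.corolla K deg x)) =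
      b.letterOf (f (Finsupp.single x 1)) := by
  have hG := b.generator_mem hdeg hΘ hf hg
  induction h : deg x using Nat.strong_induction_on generalizing x with
  | _ n ih =>
    subst h
    have h := LinearMap.congr_fun (TreeSpace.eMap_corollaLin hdeg hΘ) (Finsupp.single x 1)
    have h' := LinearMap.congr_fun hg (Finsupp.single x 1)
    simp only [LinearMap.comp_apply, LinearMap.sub_apply, LinearMap.add_apply,
      TreeSpace.corollaLin_single] at h h'
    rw [h, map_sub, b.eval_corolla, h', sub_eq_iff_eq_add]
    congr 1
    refine eq_of_graded hdeg hΘ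
      (F := TensorProduct.lift b.consW ∘ₗ TensorProduct.map f g)
      (F' := b.eval (fun x => g (Finsupp.single x 1)) ∘ₗ TreeSpace.mul K deg ∘ₗ
        TensorProduct.map (TreeSpace.eMap Θ ∘ₗ TreeSpace.corollaLin K deg)
          (TreeSpace.corollaLin K deg)) x fun y z hy hyz => ?_
    have hz := hdeg z
    simp only [LinearMap.comp_apply, TensorProduct.map_tmul, TreeSpace.corollaLin_single,
      TensorProduct.lift.tmul, TreeSpace.mul_tmul]
    rw [b.eval_graft_zero hG, ih (deg y) (by omega) y rfl, b.eval_corolla, letterOf_apply,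
      b.op_consW 0 hy (hf y), b.op_nil, b.act_zero]

end generators

end PrimGrAlgebra.PositiveBasis

end

/-! ### The universal property -/

noncomputable section

namespace TreeSpace

variable {K : Type*} [Field K] {X : Type*} {deg : X → ℕ} (hdeg : ∀ x, 0 < deg x)
  {Θ : (X →₀ K) →ₗ[K] (X →₀ K) ⊗[K] (X →₀ K)} (hΘ : IsGradedCoproduct deg Θ)
  (hΘ' : IsCoassociative Θ)

/-- The combinations of trees with value in the span of the letters contain e(X) and are closed
under the operations, so they contain the smallest such subspace. -/
theorem primGr_le_comap_eval {W B : Type*} [AddCommGroup W] [Module K W] {Q : PrimGrAlgebra K W}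
    (b : Q.PositiveBasis B) {G : X → List B →₀ K} (hG : ∀ x, G x ∈ b.words (deg x))
    (h : ∀ x, b.eval G (eMap Θ (corolla K deg x)) ∈ b.letters) :
    PrimGr deg Θ ≤ b.letters.comap (b.eval G) := by
  refine sInf_le ⟨h, fun y hy z hz => ?_, fun p n h1 hp y hy z hz hn => ?_⟩
  · rw [Submodule.mem_comap, b.eval_bracket hG]
    exact (b.wordBracket_letters hy hz).1
  · rw [Submodule.mem_comap, b.eval_graft hG hp.le y hn]
    exact (b.op_letters h1 hp hy hz (b.eval_mem hG hn)).1

include hdeg hΘ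

theorem exists_isHom {W : Type*} [AddCommGroup W] [Module K W] (Q : PrimGrAlgebra K W)
    {f : X → W} (hf : ∀ x, f x ∈ Q.comp (deg x)) :
    ∃ φ : PrimGr deg Θ →ₗ[K] W, (primGrAlgebra hdeg hΘ hΘ').IsHom Q φ ∧
      ∀ x, φ ⟨eMap Θ (corolla K deg x), eMap_corolla_mem deg Θ x⟩ = f x := by
  obtain ⟨B, ⟨b⟩⟩ := Q.exists_positiveBasis
  set F : (X →₀ K) →ₗ[K] W := Finsupp.linearCombination K f
  have hF : ∀ x, F (Finsupp.single x 1) = f x := fun x => by simp [F]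
  have hF' : ∀ x, F (Finsupp.single x 1) ∈ Q.comp (deg x) := fun x => (hF x).symm ▸ hf x
  obtain ⟨g, hg⟩ := b.exists_generator hdeg hΘ F
  set G : X → List B →₀ K := fun x => g (Finsupp.single x 1)
  have hG : ∀ x, G x ∈ b.words (deg x) := b.generator_mem hdeg hΘ hF' hg
  have he : ∀ x, b.eval G (eMap Θ (corolla K deg x)) = b.letterOf (f x) := fun x => by
    rw [b.eval_eMap_corolla hdeg hΘ hF' hg, hF]
  have hle := primGr_le_comap_eval b hG fun x => (he x).symm ▸ b.letterOf_mem (f x)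
  have hle' : ∀ y : PrimGr deg Θ, b.eval G (y : TreeSpace K deg) ∈ b.letters := fun y =>
    Submodule.mem_comap.1 (hle y.2)
  set φ : PrimGr deg Θ →ₗ[K] W := b.ofLetters ∘ₗ b.eval G ∘ₗ (PrimGr deg Θ).subtype
  have hφ : ∀ y : PrimGr deg Θ, φ y = b.ofLetters (b.eval G (y : TreeSpace K deg)) :=
    fun _ => rfl
  refine ⟨φ, ⟨fun n y hy => ?_, fun y z => ?_, fun p n h1 hp y z hz => ?_⟩, fun x => ?_⟩
  · have hy' : (y : TreeSpace K deg) ∈ homog K deg n := hy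
    rw [hφ]
    exact b.ofLetters_mem (hle' y) (b.eval_mem hG hy')
  · have h : (((primGrAlgebra hdeg hΘ hΘ').bracket y z : PrimGr deg Θ) : TreeSpace K deg) =
      bracket K deg y z := rfl
    rw [hφ, hφ, hφ, h, b.eval_bracket hG, (b.wordBracket_letters (hle' y) (hle' z)).2]
  · have hz' : (z : TreeSpace K deg) ∈ homog K deg n := hz
    have h : (((primGrAlgebra hdeg hΘ hΘ').graft p y z : PrimGr deg Θ) : TreeSpace K deg) =
      graft K deg p y z := coe_primGrGraft hdeg hΘ hΘ' h1 hp y hz'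
    rw [hφ, hφ, hφ, h, b.eval_graft hG hp.le _ hz',
      (b.op_letters h1 hp (hle' y) (hle' z) (b.eval_mem hG hz')).2]
  · rw [hφ, he, b.ofLetters_letterOf (hdeg x) (hf x)]

/-- The locus where the two morphisms agree, seen in K[T_∞, X], contains e(X) and is closed under
the operations. -/
theorem isHom_ext {W : Type*} [AddCommGroup W] [Module K W] {Q : PrimGrAlgebra K W}
    {φ ψ : PrimGr deg Θ →ₗ[K] W} (hφ : (primGrAlgebra hdeg hΘ hΘ').IsHom Q φ)
    (hψ : (primGrAlgebra hdeg hΘ hΘ').IsHom Q ψ)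
    (h : ∀ x, φ ⟨eMap Θ (corolla K deg x), eMap_corolla_mem deg Θ x⟩ =
      ψ ⟨eMap Θ (corolla K deg x), eMap_corolla_mem deg Θ x⟩) : φ = ψ := by
  have hle : PrimGr deg Θ ≤ (LinearMap.eqLocus φ ψ).map (PrimGr deg Θ).subtype := by
    refine sInf_le ⟨fun x => ⟨_, h x, rfl⟩, ?_, ?_⟩
    · rintro _ ⟨y, hy, rfl⟩ _ ⟨z, hz, rfl⟩
      refine ⟨(primGrAlgebra hdeg hΘ hΘ').bracket y z, ?_, rfl⟩
      rw [SetLike.mem_coe, LinearMap.mem_eqLocus] at hy hz ⊢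
      rw [hφ.map_bracket, hψ.map_bracket, hy, hz]
    · rintro p n h1 hp _ ⟨y, hy, rfl⟩ _ ⟨z, hz, rfl⟩ hn
      refine ⟨(primGrAlgebra hdeg hΘ hΘ').graft p y z, ?_, coe_primGrGraft hdeg hΘ hΘ' h1 hp y hn⟩
      rw [SetLike.mem_coe, LinearMap.mem_eqLocus] at hy hz ⊢
      rw [hφ.map_graft p n h1 hp y z hn, hψ.map_graft p n h1 hp y z hn, hy, hz]
  refine LinearMap.ext fun y => ?_
  obtain ⟨z, hz, hzy⟩ := hle y.2
  rw [← Subtype.ext hzy]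
  exact hz

end TreeSpace

end

theorem mainTheorem6 {K : Type*} [Field K] {X : Type*} (deg : X → ℕ) (hdeg : ∀ x, 0 < deg x)
    (Θ : (X →₀ K) →ₗ[K] (X →₀ K) ⊗[K] (X →₀ K))
    (hΘ : IsGradedCoproduct deg Θ) (hΘ' : IsCoassociative Θ) :
    TreeSpace.PrimGr deg Θ = TreeSpace.primitives deg Θ ∧
    ∃ P : PrimGrAlgebra K (TreeSpace.PrimGr deg Θ),
      (∀ n, P.comp n = (TreeSpace.homog K deg n).comap (TreeSpace.PrimGr deg Θ).subtype) ∧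
      (∀ x y : TreeSpace.PrimGr deg Θ,
        (P.bracket x y : TreeSpace K deg) = TreeSpace.bracket K deg x y) ∧
      (∀ p n : ℕ, 1 ≤ p → p < n → ∀ x y : TreeSpace.PrimGr deg Θ,
        (y : TreeSpace K deg) ∈ TreeSpace.homog K deg n →
        (P.graft p x y : TreeSpace K deg) = TreeSpace.graft K deg p x y) ∧
      (∀ x : X, TreeSpace.eMap Θ (TreeSpace.corolla K deg x) ∈ TreeSpace.homog K deg (deg x)) ∧
      ∀ (W : Type*) [AddCommGroup W] [Module K W] (Q : PrimGrAlgebra K W) (f : X → W),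
        (∀ x, f x ∈ Q.comp (deg x)) →
        ∃! φ : TreeSpace.PrimGr deg Θ →ₗ[K] W, P.IsHom Q φ ∧
          ∀ x, φ ⟨TreeSpace.eMap Θ (TreeSpace.corolla K deg x),
            TreeSpace.eMap_corolla_mem deg Θ x⟩ = f x := by
  refine ⟨TreeSpace.primGr_eq_primitives hdeg hΘ hΘ', TreeSpace.primGrAlgebra hdeg hΘ hΘ',
    fun n => rfl, fun x y => rfl,
    fun p n h1 hp x y hy => TreeSpace.coe_primGrGraft hdeg hΘ hΘ' h1 hp x hy,
    fun x => TreeSpace.eMap_mem_homog hdeg hΘ (TreeSpace.corolla_mem_homog x), ?_⟩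
  intro W _ _ Q f hf
  obtain ⟨φ, hφ, hφf⟩ := TreeSpace.exists_isHom hdeg hΘ hΘ' Q hf
  exact ⟨φ, ⟨hφ, hφf⟩, fun ψ hψ =>
    TreeSpace.isHom_ext hdeg hΘ hΘ' hψ.1 hφ fun x => (hψ.2 x).trans (hφf x).symm⟩
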